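/- Let $N\ge 1$ be an integer and $a>-1$, and let $b=a+1$. The Bures ensemble is the probability law on $z=(z_1,\dots,z_N)\in(0,\infty)^N$ with density $\frac{1}{N!\,Z_N}\,w_N(z)$, where $$w_N(z)=\frac{\prod_{1\le i<j\le N}(z_j-z_i)^2}{\prod_{1\le i<j\le N}(z_i+z_j)}\prod_{j=1}^N z_j^a e^{-z_j},\qquad Z_N=\frac1{N!}\int_{(0,\infty)^N}w_N(z)\,dz .$$ (The weight $w_N$ is integrable and $Z_N>0$.) For $1\le k\le N$ let $$R_k(z_1,\dots,z_k)=\frac{1}{N!\,Z_N}\int_{(0,\infty)^{N-k}}w_N(z_1,\dots,z_N)\,dz_{k+1}\cdots dz_N$$ be the $k$-point correlation function without self-energy terms (normalised to total mass one). For real parameters and $x>0$ let $$G^{m,n}_{p,q}\Big({a_1,\dots,a_n;a_{n+1},\dots,a_p\atop b_1,\dots,b_m;b_{m+1},\dots,b_q}\Big|x\Big)=\int_C\frac{ds}{2\pi i}\,\frac{x^s\prod_{j=1}^m\Gamma(b_j-s)\prod_{j=1}^n\Gamma(1-a_j+s)}{\prod_{j=m+1}^q\Gamma(1-b_j+s)\prod_{j=n+1}^p\Gamma(a_j-s)}$$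 be the Meijer G-function, where $C$ has the poles of the $\Gamma(b_j-s)$ on its right and those of the $\Gamma(1-a_j+s)$ on its left; $C$ runs from $-i\infty$ to $+i\infty$ if $p+q<2(m+n)$, and otherwise (if $p<q$) it is a loop that starts and ends at $+\infty$, coming in below and going out above the real axis. The kernels of the Cauchy two-matrix model are $$K_{11}(x;y)=-\frac{x^ay^b}{x+y}+x^ay^b\int_0^1 G^{2,1}_{2,3}\Big({-a-N;N+b\atop 0,b;-a}\Big|tx\Big)G^{2,1}_{2,3}\Big({-b-N;N+a\atop 0,a;-b}\Big|ty\Big)dt,$$ $$K_{01}(x,x')=x^{a+b}\int_0^1 t^{a+b}\,G^{1,1}_{2,3}\Big({-N-a-b;N\atop 0;-a,-a-b}\Big|tx'\Big)G^{2,1}_{2,3}\Big({-N-a-b;N\atop 0,-b;-a-b}\Big|tx\Big)dt,$$ $$K_{10}(y,y')=y'^{\,a+b}\int_0^1 t^{a+b}\,G^{2,1}_{2,3}\Big({-N-a-b;N\atop 0,-a;-a-b}\Big|ty'\Big)G^{1,1}_{2,3}\Big({-N-a-b;N\atop 0;-b,-a-b}\Big|ty\Big)dt,$$ $$K_{00}(x;y)=\int_0^1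 t^{a+b}\,G^{1,1}_{2,3}\Big({-N-a-b;N\atop 0;-a,-a-b}\Big|tx\Big)G^{1,1}_{2,3}\Big({-N-a-b;N\atop 0;-b,-a-b}\Big|ty\Big)dt .$$ Put $$\Delta K_{11}(x;y)=K_{11}(x;y)-K_{11}(y;x),\quad \Sigma K_{01}(x;y)=K_{01}(x,y)+K_{10}(y,x),\quad \Delta K_{00}(x;y)=K_{00}(x;y)-K_{00}(y;x).$$ Then for $1\le k\le N$ and pairwise distinct $z_1,\dots,z_k>0$ the integral that defines $R_k(z_1,\dots,z_k)$ converges and $$R_k(z_1,\dots,z_k)=(-1)^{k(k-1)/2}\,\frac{(N-k)!}{2^k\,N!}\;\mathrm{Pf}\left[\begin{array}{c|c}\Delta K_{11}(z_i;z_j)&\Sigma K_{01}(z_i;z_j)\\ \hline -\Sigma K_{01}(z_j;z_i)&\Delta K_{00}(z_i;z_j)\end{array}\right]_{1\le i,j\le k},$$ the Pfaffian of a skew-symmetric $2k\times 2k$ matrix. In particular, the Bures ensemble is a Pfaffian point process on $(0,\infty)$: there is a measurable $2\times 2$ matrix kernel $K$ with $K(x,y)=-K(y,x)^T$ such that for every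 $k\ge0$ the $k$-th correlation function of the process of the $N$ points (the density, with respect to Lebesgue measure, of its $k$-th factorial moment measure) is $\mathrm{Pf}[K(z_i,z_j)]_{1\le i,j\le k}$ for almost every $(z_1,\dots,z_k)$. -/

import Mathlib

open MeasureTheory Set
open scoped Nat ENNReal

noncomputable section

/-! ### Pfaffians -/

/-- The Pfaffian of a (skew-symmetric) matrix of even size `2 n`,
`(1 / (2 ^ n n!)) ∑_σ sgn σ ∏_i A (σ (2 i)) (σ (2 i + 1))`;
`finProdFinEquiv (i, j)` is the position `2 i + j`. -/
def pfaffian {R : Type*} [Field R] {n : ℕ} (A : Matrix (Fin (n * 2)) (Fin (n * 2)) R) : R :=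
  1 / (2 ^ n * (n ! : R)) * ∑ σ : Equiv.Perm (Fin (n * 2)),
    ((Equiv.Perm.sign σ : ℤ) : R) *
      ∏ i : Fin n, A (σ (finProdFinEquiv (i, 0))) (σ (finProdFinEquiv (i, 1)))

/-- The `2 k × 2 k` matrix with the four `k × k` blocks `A`, `B` (first rows), `C`, `D`. -/
def blockMatrix {R : Type*} {k : ℕ} (A B C D : Matrix (Fin k) (Fin k) R) :
    Matrix (Fin (k * 2)) (Fin (k * 2)) R :=
  (Matrix.fromBlocks A B C D).reindex
    (finSumFinEquiv.trans (finCongr (mul_two k).symm))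
    (finSumFinEquiv.trans (finCongr (mul_two k).symm))

/-- The `2 k × 2 k` matrix made of the `k × k` array of `2 × 2` blocks `K (z i) (z j)`. -/
def kernelMatrix {R : Type*} {k : ℕ} (K : ℝ → ℝ → Matrix (Fin 2) (Fin 2) R) (z : Fin k → ℝ) :
    Matrix (Fin (k * 2)) (Fin (k * 2)) R :=
  Matrix.of fun p q =>
    K (z (finProdFinEquiv.symm p).1) (z (finProdFinEquiv.symm q).1)
      (finProdFinEquiv.symm p).2 (finProdFinEquiv.symm q).2

/-! ### Meijer G-functions -/

/-- The Mellin–Barnes integrand with upper parameters `a₁` (the first `n`), `a₂` (the others) and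
lower parameters `b₁` (the first `m`), `b₂` (the others). Since `Complex.Gamma` takes the value `0`
at its poles and `u / 0 = 0`, the reciprocal Gamma functions have their correct value `0` there. -/
def meijerIntegrand (a₁ a₂ b₁ b₂ : List ℝ) (x : ℝ) (s : ℂ) : ℂ :=
  (x : ℂ) ^ s *
    ((b₁.map fun b : ℝ => Complex.Gamma ((b : ℂ) - s)).prod *
      (a₁.map fun a : ℝ => Complex.Gamma (1 - (a : ℂ) + s)).prod) /
    ((b₂.map fun b : ℝ => Complex.Gamma (1 - (b : ℂ) + s)).prod *
      (a₂.map fun a : ℝ => Complex.Gamma ((a : ℂ) - s)).prod)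

/-- A real point `c` at which the contour crosses the real axis: all poles of the factors
`Γ(b - s)`, `b ∈ b₁`, lie to the right of `c`, all poles of the factors `Γ(1 - a + s)`, `a ∈ a₁`,
lie to the left (if there is such a point; which one is taken does not matter). -/
def meijerAbscissa (a₁ b₁ : List ℝ) : ℝ :=
  Classical.epsilon fun c : ℝ => (∀ a ∈ a₁, a - 1 < c) ∧ ∀ b ∈ b₁, c < b

/-- The Meijer G-function `G^{m,n}_{p,q}(a₁; a₂ | b₁; b₂ | x)` with real parameters and `x > 0`:
`(2πi)⁻¹ ∫ x^s ∏ Γ(b - s) ∏ Γ(1 - a + s) / (∏ Γ(1 - b + s) ∏ Γ(a - s)) ds` over a contour which has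
the poles of the `Γ(b - s)` on its right and those of the `Γ(1 - a + s)` on its left.
The contour is the vertical line from `c - i∞` to `c + i∞` when the integral converges absolutely
there, `p + q < 2 (m + n)`; otherwise (for `p < q`) its two ends are bent to the right, as usual:
it comes from `+∞ - i`, crosses the real axis at `c` and returns to `+∞ + i`. -/
def meijerG (a₁ a₂ b₁ b₂ : List ℝ) (x : ℝ) : ℂ :=
  let c : ℝ := meijerAbscissa a₁ b₁
  let F : ℂ → ℂ := meijerIntegrand a₁ a₂ b₁ b₂ x
  if (a₁.length + a₂.length) + (b₁.length + b₂.length) < 2 * (b₁.length + a₁.length) then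
    (2 * Real.pi * Complex.I)⁻¹ * (Complex.I * ∫ τ : ℝ, F (c + τ * Complex.I))
  else
    (2 * Real.pi * Complex.I)⁻¹ *
      (-(∫ σ in Ioi c, F (σ - Complex.I))
        + (Complex.I * ∫ τ in (-1 : ℝ)..1, F (c + τ * Complex.I))
        + ∫ σ in Ioi c, F (σ + Complex.I))

/-! ### Kernels of the Cauchy two-matrix model -/

/-- `K₁₁(x; y)`. -/
def cauchyK11 (N : ℕ) (a b x y : ℝ) : ℂ :=
  -((x ^ a * y ^ b / (x + y) : ℝ) : ℂ) +
    ((x ^ a * y ^ b : ℝ) : ℂ) * ∫ t in (0 : ℝ)..1,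
      meijerG [-a - N] [N + b] [0, b] [-a] (t * x) * meijerG [-b - N] [N + a] [0, a] [-b] (t * y)

/-- `K₀₁(x, x')`. -/
def cauchyK01 (N : ℕ) (a b x x' : ℝ) : ℂ :=
  ((x ^ (a + b) : ℝ) : ℂ) * ∫ t in (0 : ℝ)..1, ((t ^ (a + b) : ℝ) : ℂ) *
    meijerG [-N - a - b] [N] [0] [-a, -a - b] (t * x') *
    meijerG [-N - a - b] [N] [0, -b] [-a - b] (t * x)

/-- `K₁₀(y, y')`. -/
def cauchyK10 (N : ℕ) (a b y y' : ℝ) : ℂ :=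
  ((y' ^ (a + b) : ℝ) : ℂ) * ∫ t in (0 : ℝ)..1, ((t ^ (a + b) : ℝ) : ℂ) *
    meijerG [-N - a - b] [N] [0, -a] [-a - b] (t * y') *
    meijerG [-N - a - b] [N] [0] [-b, -a - b] (t * y)

/-- `K₀₀(x; y)`. -/
def cauchyK00 (N : ℕ) (a b x y : ℝ) : ℂ :=
  ∫ t in (0 : ℝ)..1, ((t ^ (a + b) : ℝ) : ℂ) *
    meijerG [-N - a - b] [N] [0] [-a, -a - b] (t * x) *
    meijerG [-N - a - b] [N] [0] [-b, -a - b] (t * y)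

/-- `ΔK₁₁(x; y) = K₁₁(x; y) - K₁₁(y; x)`. -/
def deltaK11 (N : ℕ) (a b x y : ℝ) : ℂ := cauchyK11 N a b x y - cauchyK11 N a b y x

/-- `ΣK₀₁(x; y) = K₀₁(x, y) + K₁₀(y, x)`. -/
def sigmaK01 (N : ℕ) (a b x y : ℝ) : ℂ := cauchyK01 N a b x y + cauchyK10 N a b y x

/-- `ΔK₀₀(x; y) = K₀₀(x; y) - K₀₀(y; x)`. -/
def deltaK00 (N : ℕ) (a b x y : ℝ) : ℂ := cauchyK00 N a b x y - cauchyK00 N a b y x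

/-- The skew-symmetric `2 k × 2 k` matrix with the blocks `ΔK₁₁(z_i; z_j)`, `ΣK₀₁(z_i; z_j)`,
`-ΣK₀₁(z_j; z_i)`, `ΔK₀₀(z_i; z_j)`, for the parameters `a` and `b = a + 1`. -/
def buresMatrix (N : ℕ) (a : ℝ) {k : ℕ} (z : Fin k → ℝ) :
    Matrix (Fin (k * 2)) (Fin (k * 2)) ℂ :=
  blockMatrix
    (Matrix.of fun i j => deltaK11 N a (a + 1) (z i) (z j))
    (Matrix.of fun i j => sigmaK01 N a (a + 1) (z i) (z j))
    (Matrix.of fun i j => -sigmaK01 N a (a + 1) (z j) (z i))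
    (Matrix.of fun i j => deltaK00 N a (a + 1) (z i) (z j))

/-! ### The Bures ensemble -/

/-- The positive orthant `(0, ∞)^n`. -/
def posOrthant (n : ℕ) : Set (Fin n → ℝ) := {z | ∀ i, 0 < z i}

/-- The Vandermonde determinant `∏_{i < j} (z_j - z_i)`. -/
def vandermondeProd {n : ℕ} (z : Fin n → ℝ) : ℝ := ∏ i, ∏ j ∈ Finset.Ioi i, (z j - z i)

/-- The unnormalised joint density `Δ(z)² ∏_{i < j} (z_i + z_j)⁻¹ ∏_j z_j^a e^{-z_j}`. -/
def buresWeight (a : ℝ) {n : ℕ} (z : Fin n → ℝ) : ℝ :=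
  vandermondeProd z ^ 2 / (∏ i, ∏ j ∈ Finset.Ioi i, (z i + z j)) *
    ∏ j, (z j ^ a * Real.exp (-z j))

/-- The partition function `Z = (1 / N!) ∫ Δ(z)² ∏_{i < j} (z_i + z_j)⁻¹ ∏_j z_j^a e^{-z_j} dz`. -/
def buresZ (N : ℕ) (a : ℝ) : ℝ := 1 / (N ! : ℝ) * ∫ z in posOrthant N, buresWeight a z

/-- The `k`-point correlation function `R_k` (for `k ≤ N`), without self-energy terms: the marginal
density of `k` of the `N` variables, normalised to total mass one. -/
def buresR (N : ℕ) (a : ℝ) (k : ℕ) (z : Fin k → ℝ) : ℝ :=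
  1 / buresZ N a * (1 / (N ! : ℝ)) * ∫ w in posOrthant (N - k), buresWeight a (Fin.append z w)

/-- The joint law of the `N` eigenvalues of the Bures ensemble. -/
def buresLaw (N : ℕ) (a : ℝ) : Measure (Fin N → ℝ) :=
  (volume.restrict (posOrthant N)).withDensity fun z =>
    ENNReal.ofReal (1 / buresZ N a * (1 / (N ! : ℝ)) * buresWeight a z)

/-! ### Pfaffian point processes -/

/-- `ρ` is the `k`-th correlation function, with respect to the reference measure `ν`, of the point
process formed by `N` random points with joint law `μ`: the expectation of the sum of
`f (z_{σ 1}, …, z_{σ k})` over all `k`-tuples of distinct points is `∫ f ρ dν^k`. -/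
def IsCorrelationFunction (ν : Measure ℝ) {N : ℕ} (μ : Measure (Fin N → ℝ)) (k : ℕ)
    (ρ : (Fin k → ℝ) → ℝ) : Prop :=
  Measurable ρ ∧ (∀ w, 0 ≤ ρ w) ∧
    ∀ f : (Fin k → ℝ) → ℝ≥0∞, Measurable f →
      ∫⁻ z, ∑ σ : Fin k ↪ Fin N, f (fun i => z (σ i)) ∂μ =
        ∫⁻ w, f w * ENNReal.ofReal (ρ w) ∂(Measure.pi fun _ : Fin k => ν)

/-- The point process formed by `N` random points with joint law `μ` is Pfaffian: there is a
measurable `2 × 2` matrix kernel `K` with `K x y = -(K y x)ᵀ` such that, for every `k`, the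
`k`-th correlation function is the Pfaffian of the array of the blocks `K (w i) (w j)`. -/
def IsPfaffianPointProcess (ν : Measure ℝ) {N : ℕ} (μ : Measure (Fin N → ℝ)) : Prop :=
  ∃ K : ℝ → ℝ → Matrix (Fin 2) (Fin 2) ℂ,
    (∀ i j, Measurable fun p : ℝ × ℝ => K p.1 p.2 i j) ∧
    (∀ x y, K x y = -(K y x).transpose) ∧
    ∀ k : ℕ, ∃ ρ : (Fin k → ℝ) → ℝ, IsCorrelationFunction ν μ k ρ ∧
      ∀ᵐ w ∂(Measure.pi fun _ : Fin k => ν), (ρ w : ℂ) = pfaffian (kernelMatrix K w)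

end

/-! Everything is reduced to one explicit skew kernel, `buresKernel`. It is built from the weight
`ω(x) = x^a e^(-x)`, the functions `U j` (Stieltjes transforms of `y^(a+1+j) e^(-y)`), a skew `N ×
N` matrix `J` and a vector `c`.

The density is a Pfaffian. Schur's identity, in the bordered form `exists_pfSum_schurMatrix_eq`,
says that the Pfaffian of the matrix with blocks `-(z j - z i) / (z i + z j)`, `∓c` and `J` is a
constant times `∏ (z j - z i) / ∏ (z i + z j)`. A congruence by a block triangular matrix of
determinant `± ∏ ω (z i) · Δ(z)` turns it into the kernel matrix (`matrix_eq_reduction`). For `N`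
points the Pfaffian is therefore proportional to the weight; for more than `N` points it vanishes.

Integration follows Dyson and Mehta. The biorthogonality relations `IsReproducing` imply that
integrating one variable out of a Pfaffian gives an explicit multiple of the Pfaffian of the
remaining points (`integral_pfSum`). Descending from `N` points to `k` points gives `R_k`.
Descending to none gives the empty Pfaffian `1`, which fixes the normalisation, so Schur's constant
is never computed.

The kernel is that of the statement. By Mellin inversion the functions `G^{2,1}_{2,3}` are
combinations of `e^(-x)` and generalised exponential integrals, and by residues the functions
`G^{1,1}_{2,3}` are polynomials. The integrals over `t` have explicit primitives. All coefficients
are the `rho`, from the partial fractions of `∏ (κ + l + s) / ∏ (j - s)`. Two identities for them,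
`sum_rho_div` and `sum_rho_mul_rho`, give both the primitives and the biorthogonality. The relation
`b = a + 1` enters through the recurrence `x E_(β-1) = e^(-x) - β E_β`, which expresses the
functions of both matrices of the Cauchy model through the same `U j`; the constants it leaves
behind form `c`.

For the point process, the weight is symmetric, and counting the `N! / (N - k)!` embeddings of `k`
labels turns the marginals into factorial moment densities. -/

noncomputable section

/-! ### Pfaffians as signed sums over permutations of two copies of an index set -/

section PfaffianSum

variable {R : Type*} [CommRing R] {ι κ : Type*} [Fintype ι] [DecidableEq ι] [Fintype κ]
  [DecidableEq κ]

/-- The term of the Pfaffian sum which belongs to a permutation. -/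
def pfTerm (A : Matrix (ι ⊕ ι) (ι ⊕ ι) R) (σ : Equiv.Perm (ι ⊕ ι)) : R :=
  ((Equiv.Perm.sign σ : ℤ) : R) * ∏ i, A (σ (Sum.inl i)) (σ (Sum.inr i))

/-- The Pfaffian, without its normalisation, of a matrix whose index set consists of two copies
of `ι`; the index `Sum.inl i` is paired with `Sum.inr i`. -/
def pfSum (A : Matrix (ι ⊕ ι) (ι ⊕ ι) R) : R := ∑ σ, pfTerm A σ

theorem pfSum_submatrix_sumCongr (e : ι ≃ κ) (A : Matrix (κ ⊕ κ) (κ ⊕ κ) R) :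
    pfSum (A.submatrix (Equiv.sumCongr e e) (Equiv.sumCongr e e)) = pfSum A := by
  unfold pfSum pfTerm
  refine Fintype.sum_equiv (Equiv.sumCongr e e).permCongr _ _ fun σ => ?_
  rw [Equiv.Perm.sign_permCongr]
  congr 1
  refine Fintype.prod_equiv e _ _ fun i => ?_
  simp [Equiv.permCongr_apply]

theorem pfSum_submatrix_perm (π : Equiv.Perm (ι ⊕ ι)) (A : Matrix (ι ⊕ ι) (ι ⊕ ι) R) :
    pfSum (A.submatrix π π) = ((Equiv.Perm.sign π : ℤ) : R) * pfSum A := by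
  unfold pfSum pfTerm
  rw [Finset.mul_sum]
  refine Fintype.sum_equiv (Equiv.mulLeft π) _ _ fun σ => ?_
  simp only [Equiv.coe_mulLeft, Equiv.Perm.sign_mul, Matrix.submatrix_apply, Equiv.Perm.mul_apply,
    Units.val_mul, Int.cast_mul]
  rw [← mul_assoc, ← mul_assoc, ← Int.cast_mul, ← Units.val_mul, Int.units_mul_self]
  simp

theorem pfSum_eq_zero_of_row_eq_zero (A : Matrix (ι ⊕ ι) (ι ⊕ ι) R) (x : ι ⊕ ι)
    (h1 : ∀ y, A x y = 0) (h2 : ∀ y, A y x = 0) : pfSum A = 0 := by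
  refine Finset.sum_eq_zero fun σ _ => ?_
  unfold pfTerm
  obtain ⟨p, hp⟩ := σ.surjective x
  rcases p with i | i
  · rw [Finset.prod_eq_zero (Finset.mem_univ i) (by rw [hp, h1]), mul_zero]
  · rw [Finset.prod_eq_zero (Finset.mem_univ i) (by rw [hp, h2]), mul_zero]

/-- In each term of the signed sum `x₀` occurs exactly once, so a single entry of its row or column
is picked, with partner `y σ`. The coefficients do not depend on `d`; this lets one row vary with a
parameter in the interpolation argument for Schur's identity. -/
theorem pfSum_row_linear (x₀ : ι ⊕ ι) (A : Matrix (ι ⊕ ι) (ι ⊕ ι) R) :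
    ∃ (k : Equiv.Perm (ι ⊕ ι) → R) (y : Equiv.Perm (ι ⊕ ι) → ι ⊕ ι), (∀ σ, y σ ≠ x₀) ∧
      ∀ d : ι ⊕ ι → R,
      pfSum (Matrix.of fun x y => if x = x₀ then d y else if y = x₀ then -d x else A x y) =
        ∑ σ, k σ * d (y σ) := by
  have key : ∀ σ : Equiv.Perm (ι ⊕ ι), ∃ (k : R) (y : ι ⊕ ι), y ≠ x₀ ∧ ∀ d : ι ⊕ ι → R,
      pfTerm (Matrix.of fun x y => if x = x₀ then d y else if y = x₀ then -d x else A x y) σ =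
        k * d y := by
    intro σ
    obtain ⟨p, hp⟩ := σ.surjective x₀
    have hne : ∀ q, q ≠ p → σ q ≠ x₀ := fun q hq h => hq (σ.injective (h.trans hp.symm))
    rcases p with i | i
    · refine ⟨((Equiv.Perm.sign σ : ℤ) : R) * ∏ l ∈ Finset.univ.erase i,
        A (σ (Sum.inl l)) (σ (Sum.inr l)), σ (Sum.inr i), hne _ (by simp), fun d => ?_⟩
      unfold pfTerm
      rw [← Finset.mul_prod_erase _ _ (Finset.mem_univ i)]
      have : ∏ l ∈ Finset.univ.erase i, (Matrix.of fun x y => if x = x₀ then d y else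
          if y = x₀ then -d x else A x y) (σ (Sum.inl l)) (σ (Sum.inr l)) =
          ∏ l ∈ Finset.univ.erase i, A (σ (Sum.inl l)) (σ (Sum.inr l)) := by
        refine Finset.prod_congr rfl fun l hl => ?_
        have hl' := Finset.ne_of_mem_erase hl
        rw [Matrix.of_apply, if_neg (hne _ (by simpa using hl')), if_neg (hne _ (by simp))]
      rw [this, Matrix.of_apply, if_pos hp]
      ring
    · refine ⟨-(((Equiv.Perm.sign σ : ℤ) : R) * ∏ l ∈ Finset.univ.erase i,
        A (σ (Sum.inl l)) (σ (Sum.inr l))), σ (Sum.inl i), hne _ (by simp), fun d => ?_⟩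
      unfold pfTerm
      rw [← Finset.mul_prod_erase _ _ (Finset.mem_univ i)]
      have : ∏ l ∈ Finset.univ.erase i, (Matrix.of fun x y => if x = x₀ then d y else
          if y = x₀ then -d x else A x y) (σ (Sum.inl l)) (σ (Sum.inr l)) =
          ∏ l ∈ Finset.univ.erase i, A (σ (Sum.inl l)) (σ (Sum.inr l)) := by
        refine Finset.prod_congr rfl fun l hl => ?_
        have hl' := Finset.ne_of_mem_erase hl
        rw [Matrix.of_apply, if_neg (hne _ (by simp)), if_neg (hne _ (by simpa using hl'))]
      rw [this, Matrix.of_apply, if_neg (hne _ (by simp)), if_pos hp]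
      ring
  choose k y hy h using key
  exact ⟨k, y, hy, fun d => Finset.sum_congr rfl fun σ _ => h σ d⟩

/-- The vector in slot `p` enters exactly one factor, on the left or on the right of the bilinear
form; the other factors are absorbed into `u`. -/
theorem exists_prod_update_eq_dotProduct (A : Matrix (ι ⊕ ι) (ι ⊕ ι) R) (v : ι ⊕ ι → ι ⊕ ι → R)
    (p : ι ⊕ ι) : ∃ u : ι ⊕ ι → R, ∀ w, ∏ i, (Function.update v p w (Sum.inl i)) ⬝ᵥ
      A.mulVec (Function.update v p w (Sum.inr i)) = u ⬝ᵥ w := by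
  rcases p with i | i
  · refine ⟨(∏ l ∈ Finset.univ.erase i, v (Sum.inl l) ⬝ᵥ A.mulVec (v (Sum.inr l))) •
      A.mulVec (v (Sum.inr i)), fun w => ?_⟩
    rw [← Finset.mul_prod_erase _ _ (Finset.mem_univ i), Function.update_self,
      Function.update_of_ne (by simp), smul_dotProduct, smul_eq_mul, mul_comm, dotProduct_comm]
    congr 1
    refine Finset.prod_congr rfl fun l hl => ?_
    rw [Function.update_of_ne (by simpa using Finset.ne_of_mem_erase hl),
      Function.update_of_ne (by simp)]
  · refine ⟨(∏ l ∈ Finset.univ.erase i, v (Sum.inl l) ⬝ᵥ A.mulVec (v (Sum.inr l))) •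
      A.vecMul (v (Sum.inl i)), fun w => ?_⟩
    rw [← Finset.mul_prod_erase _ _ (Finset.mem_univ i), Function.update_self,
      Function.update_of_ne (by simp), smul_dotProduct, smul_eq_mul, mul_comm,
      Matrix.dotProduct_mulVec]
    congr 1
    refine Finset.prod_congr rfl fun l hl => ?_
    rw [Function.update_of_ne (by simp),
      Function.update_of_ne (by simpa using Finset.ne_of_mem_erase hl)]

/-- The multilinear form `v ↦ ∏ i, v (inl i) ⬝ A v (inr i)`. -/
def pfMultilinear (A : Matrix (ι ⊕ ι) (ι ⊕ ι) R) :
    MultilinearMap R (fun _ : ι ⊕ ι => ι ⊕ ι → R) R :=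
  MultilinearMap.mk' (fun v => ∏ i, v (Sum.inl i) ⬝ᵥ A.mulVec (v (Sum.inr i)))
    (fun v p x y => by
      obtain ⟨u, hu⟩ := exists_prod_update_eq_dotProduct A v p
      simp only [hu, dotProduct_add])
    (fun v p c x => by
      obtain ⟨u, hu⟩ := exists_prod_update_eq_dotProduct A v p
      simp only [hu, dotProduct_smul])

/-- This exhibits the Pfaffian of `X A Xᵀ` as an alternating form of top degree in the rows of `X`,
hence as a multiple of `det X`. -/
theorem alternatization_pfMultilinear (X A : Matrix (ι ⊕ ι) (ι ⊕ ι) R) :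
    MultilinearMap.alternatization (pfMultilinear A) (fun x => X x) =
      pfSum (X * A * X.transpose) := by
  rw [MultilinearMap.alternatization_apply]
  refine Finset.sum_congr rfl fun σ _ => ?_
  rw [Units.smul_def, zsmul_eq_mul, MultilinearMap.domDomCongr_apply]
  unfold pfTerm
  congr 1
  change ∏ i, _ = _
  refine Finset.prod_congr rfl fun i _ => ?_
  rw [Matrix.mul_assoc, Matrix.mul_apply']
  congr 1

/-- A congruence multiplies the Pfaffian by the determinant. -/
theorem pfSum_congruence (X A : Matrix (ι ⊕ ι) (ι ⊕ ι) R) :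
    pfSum (X * A * X.transpose) = X.det * pfSum A := by
  -- The multiple is the value of the form at the standard basis, that is at `X = 1`, namely `pfSum
  -- A`.
  have h := AlternatingMap.eq_smul_basis_det (Pi.basisFun R (ι ⊕ ι))
    (MultilinearMap.alternatization (pfMultilinear A))
  have h1 := congrArg (fun f => f (fun x => X x)) h
  rw [← alternatization_pfMultilinear, h1]
  rw [AlternatingMap.smul_apply, smul_eq_mul, mul_comm]
  congr 1
  · exact Pi.basisFun_det_apply X
  have : (⇑(Pi.basisFun R (ι ⊕ ι)) : ι ⊕ ι → ι ⊕ ι → R) =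
      fun x => (1 : Matrix (ι ⊕ ι) (ι ⊕ ι) R) x := by
    ext x y
    simp [Matrix.one_apply, Pi.single_apply, eq_comm]
  rw [this, alternatization_pfMultilinear]
  simp

theorem pfTerm_mul_sumCongr (A : Matrix (ι ⊕ ι) (ι ⊕ ι) R) (σ : Equiv.Perm (ι ⊕ ι))
    (τ : Equiv.Perm ι) : pfTerm A (σ * Equiv.sumCongr τ τ) = pfTerm A σ := by
  unfold pfTerm
  have hs : Equiv.Perm.sign (Equiv.sumCongr τ τ : Equiv.Perm (ι ⊕ ι)) = 1 :=
    (Equiv.Perm.sign_sumCongr τ τ).trans (Int.units_mul_self _)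
  rw [Equiv.Perm.sign_mul, hs, mul_one]
  congr 1
  exact Fintype.prod_equiv τ _ _ fun i => by simp [Equiv.Perm.mul_apply]

theorem pfTerm_mul_swap (A : Matrix (ι ⊕ ι) (ι ⊕ ι) R) (hA : ∀ x y, A x y = -A y x)
    (σ : Equiv.Perm (ι ⊕ ι)) (i : ι) :
    pfTerm A (σ * Equiv.swap (Sum.inl i) (Sum.inr i)) = pfTerm A σ := by
  unfold pfTerm
  rw [Equiv.Perm.sign_mul, Equiv.Perm.sign_swap (by simp),
    ← Finset.mul_prod_erase _ _ (Finset.mem_univ i),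
    ← Finset.mul_prod_erase _ _ (Finset.mem_univ i)]
  have : ∏ l ∈ Finset.univ.erase i, A ((σ * Equiv.swap (Sum.inl i) (Sum.inr i)) (Sum.inl l))
      ((σ * Equiv.swap (Sum.inl i) (Sum.inr i)) (Sum.inr l)) =
      ∏ l ∈ Finset.univ.erase i, A (σ (Sum.inl l)) (σ (Sum.inr l)) := by
    refine Finset.prod_congr rfl fun l hl => ?_
    have hl' := Finset.ne_of_mem_erase hl
    rw [Equiv.Perm.mul_apply, Equiv.Perm.mul_apply,
      Equiv.swap_apply_of_ne_of_ne (by simpa using hl') (by simp),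
      Equiv.swap_apply_of_ne_of_ne (by simp) (by simpa using hl')]
  rw [this]
  simp only [Equiv.Perm.mul_apply, Equiv.swap_apply_left, Equiv.swap_apply_right]
  rw [hA]
  push_cast
  simp

/-- For skew `A` a term is unchanged when the pairs are permuted or when the two members of a pair
are exchanged. These moves carry the position which `σ` sends to `inl i₀` to any of the `2 |ι|`
positions, so `σ` may be assumed to fix `inl i₀`. -/
theorem pfSum_eq_card_mul (A : Matrix (ι ⊕ ι) (ι ⊕ ι) R) (hA : ∀ x y, A x y = -A y x) (i₀ : ι) :
    pfSum A = (2 * Fintype.card ι : ℕ) *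
      ∑ σ : Equiv.Perm (ι ⊕ ι), if σ (Sum.inl i₀) = Sum.inl i₀ then pfTerm A σ else 0 := by
  set s : ι ⊕ ι := Sum.inl i₀ with hs
  have h1 : pfSum A = ∑ p : ι ⊕ ι, ∑ σ : Equiv.Perm (ι ⊕ ι), if σ p = s then pfTerm A σ else 0 := by
    rw [Finset.sum_comm]
    refine Finset.sum_congr rfl fun σ _ => ?_
    simp_rw [← Equiv.eq_symm_apply (e := σ)]
    simp
  have h2 : ∀ p : ι ⊕ ι, (∑ σ : Equiv.Perm (ι ⊕ ι), if σ p = s then pfTerm A σ else 0) =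
      ∑ σ : Equiv.Perm (ι ⊕ ι), if σ s = s then pfTerm A σ else 0 := by
    have hinl : ∀ i, (∑ σ : Equiv.Perm (ι ⊕ ι), if σ (Sum.inl i) = s then pfTerm A σ else 0) =
        ∑ σ : Equiv.Perm (ι ⊕ ι), if σ s = s then pfTerm A σ else 0 := by
      intro i
      refine Fintype.sum_equiv (Equiv.mulRight (Equiv.sumCongr (Equiv.swap i i₀)
        (Equiv.swap i i₀))) _ _ fun σ => ?_
      rw [Equiv.coe_mulRight, pfTerm_mul_sumCongr]
      simp [hs, Equiv.Perm.mul_apply]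
    intro p
    rcases p with i | i
    · exact hinl i
    · rw [← hinl i]
      refine Fintype.sum_equiv (Equiv.mulRight (Equiv.swap (Sum.inl i) (Sum.inr i))) _ _
        fun σ => ?_
      rw [Equiv.coe_mulRight, pfTerm_mul_swap A hA]
      simp [Equiv.Perm.mul_apply]
  rw [h1, Finset.sum_congr rfl fun p _ => h2 p]
  simp [two_mul]

theorem sum_perm_option_fix {α S : Type*} [Fintype α] [DecidableEq α] [AddCommMonoid S]
    (H : Equiv.Perm (Option α) → S) :
    (∑ σ : Equiv.Perm (Option α), if σ none = none then H σ else 0) =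
      ∑ τ : Equiv.Perm α, H τ.optionCongr := by
  rw [← Equiv.sum_comp Equiv.Perm.decomposeOption.symm, Fintype.sum_prod_type,
    Finset.sum_eq_single none]
  · refine Finset.sum_congr rfl fun τ _ => ?_
    simp only [Equiv.Perm.decomposeOption_symm_apply, Equiv.swap_self]
    exact if_pos rfl
  · intro x _ hx
    simp [hx]
  · simp

/-- The sum is split by the image of `none`. If it is not `none`, it is written as `some (τ q)`, so
that `some q` is the place which is sent to `none`. -/
theorem sum_perm_option {α S : Type*} [Fintype α] [DecidableEq α] [AddCommMonoid S]
    (H : Equiv.Perm (Option α) → S) :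
    (∑ σ : Equiv.Perm (Option α), H σ) = (∑ τ : Equiv.Perm α, H τ.optionCongr) +
      ∑ τ : Equiv.Perm α, ∑ q : α, H (Equiv.swap none (some (τ q)) * τ.optionCongr) := by
  rw [← Equiv.sum_comp Equiv.Perm.decomposeOption.symm, Fintype.sum_prod_type,
    Fintype.sum_option]
  congr 1
  · refine Finset.sum_congr rfl fun τ _ => ?_
    simp only [Equiv.Perm.decomposeOption_symm_apply, Equiv.swap_self]
    rfl
  · rw [Finset.sum_comm]
    refine Finset.sum_congr rfl fun τ _ => ?_
    rw [← Equiv.sum_comp τ]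
    simp

/-- Two copies of `Option ι` are two copies of `ι` and two more points. -/
def optionOptionEquiv (ι : Type*) : Option (Option (ι ⊕ ι)) ≃ Option ι ⊕ Option ι where
  toFun
    | none => Sum.inl none
    | some none => Sum.inr none
    | some (some (Sum.inl i)) => Sum.inl (some i)
    | some (some (Sum.inr i)) => Sum.inr (some i)
  invFun
    | Sum.inl none => none
    | Sum.inr none => some none
    | Sum.inl (some i) => some (some (Sum.inl i))
    | Sum.inr (some i) => some (some (Sum.inr i))
  left_inv x := by rcases x with _ | _ | i | i <;> rfl
  right_inv x := by rcases x with (_ | i) | (_ | i) <;> rfl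

theorem optionOptionEquiv_some_some {α : Type*} (x : α ⊕ α) :
    optionOptionEquiv α (some (some x)) = Sum.map some some x := by
  rcases x with i | i <;> rfl

/-- Expansion of the Pfaffian along two paired rows. -/
theorem pfSum_option (A : Matrix (Option ι ⊕ Option ι) (Option ι ⊕ Option ι) R)
    (hA : ∀ x y, A x y = -A y x) :
    pfSum A = (2 * (Fintype.card ι + 1) : ℕ) *
      (A (Sum.inl none) (Sum.inr none) * pfSum (A.submatrix (Sum.map some some) (Sum.map some some))
      - ∑ σ : Equiv.Perm (ι ⊕ ι), ((Equiv.Perm.sign σ : ℤ) : R) * ∑ i,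
        (A (Sum.inl none) (Sum.map some some (σ (Sum.inl i))) *
            A (Sum.inr none) (Sum.map some some (σ (Sum.inr i))) -
          A (Sum.inl none) (Sum.map some some (σ (Sum.inr i))) *
            A (Sum.inr none) (Sum.map some some (σ (Sum.inl i)))) *
        ∏ l ∈ Finset.univ.erase i, A (Sum.map some some (σ (Sum.inl l)))
          (Sum.map some some (σ (Sum.inr l)))) := by
  rw [pfSum_eq_card_mul A hA none, Fintype.card_option]
  congr 1
  set e := optionOptionEquiv ι
  -- `inl none` becomes the outer `none` and `inr none` the inner one, so that splitting off a point
  -- twice removes the two rows.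
  have h1 : (∑ σ : Equiv.Perm (Option ι ⊕ Option ι), if σ (Sum.inl none) = Sum.inl none then
      pfTerm A σ else 0) = ∑ σ : Equiv.Perm (Option (Option (ι ⊕ ι))), if σ none = none then
      pfTerm A (e.permCongr σ) else 0 := by
    symm
    refine Fintype.sum_equiv e.permCongr _ _ fun σ => ?_
    have : σ none = none ↔ e.permCongr σ (Sum.inl none) = Sum.inl none := by
      rw [Equiv.permCongr_apply]
      change _ ↔ e (σ none) = e none
      simp
    exact if_congr this rfl rfl
  have ht : ∀ τ : Equiv.Perm (Option (ι ⊕ ι)), pfTerm A (e.permCongr τ.optionCongr) =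
      ((Equiv.Perm.sign τ : ℤ) : R) * (A (Sum.inl none) (e (some (τ none))) *
        ∏ i, A (e (some (τ (some (Sum.inl i))))) (e (some (τ (some (Sum.inr i)))))) := by
    intro τ
    unfold pfTerm
    rw [Equiv.Perm.sign_permCongr, Equiv.optionCongr_sign, Fintype.prod_option]
    rfl
  -- Either `inl none` is paired with `inr none`, or with some `τ q`. In the second case `inr none`
  -- occupies the position `q`, and the two positions of a pair give the two products in the
  -- bracket.
  rw [h1, sum_perm_option_fix, sum_perm_option, sub_eq_add_neg]
  congr 1
  · unfold pfSum
    rw [Finset.mul_sum]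
    refine Finset.sum_congr rfl fun τ _ => ?_
    rw [ht, Equiv.optionCongr_sign]
    unfold pfTerm
    simp only [Equiv.optionCongr_apply, Option.map_none, Option.map_some, Matrix.submatrix_apply, e,
      optionOptionEquiv_some_some]
    rw [mul_left_comm]
    rfl
  · rw [← Finset.sum_neg_distrib]
    refine Finset.sum_congr rfl fun τ _ => ?_
    rw [Fintype.sum_sum_type, Finset.mul_sum, ← Finset.sum_neg_distrib, ← Finset.sum_add_distrib]
    refine Finset.sum_congr rfl fun i _ => ?_
    have hs : ∀ q, Equiv.Perm.sign (Equiv.swap none (some (τ q)) * τ.optionCongr) =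
        -Equiv.Perm.sign τ := by
      intro q
      rw [Equiv.Perm.sign_mul, Equiv.Perm.sign_swap (by simp), Equiv.optionCongr_sign]
      simp
    have hn : ∀ q, (Equiv.swap none (some (τ q)) * τ.optionCongr : Equiv.Perm _) none =
        some (τ q) := by
      intro q
      simp [Equiv.Perm.mul_apply]
    have he : ∀ q, (Equiv.swap none (some (τ q)) * τ.optionCongr : Equiv.Perm _) (some q) =
        none := by
      intro q
      simp [Equiv.Perm.mul_apply]
    have ho : ∀ q w, w ≠ q → (Equiv.swap none (some (τ q)) * τ.optionCongr : Equiv.Perm _)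
        (some w) = some (τ w) := by
      intro q w hw
      rw [Equiv.Perm.mul_apply, Equiv.optionCongr_apply, Option.map_some,
        Equiv.swap_apply_of_ne_of_ne (by simp) (by simpa using hw)]
    rw [ht, ht, hs, hs, hn, hn, ← Finset.mul_prod_erase _ _ (Finset.mem_univ i), he,
      ho _ _ (by simp), ← Finset.mul_prod_erase Finset.univ
      (fun j => A (e (some ((Equiv.swap none (some (τ (Sum.inr i))) * τ.optionCongr :
        Equiv.Perm _) (some (Sum.inl j))))) _) (Finset.mem_univ i), he, ho _ _ (by simp)]
    have hP : ∀ q, q = Sum.inl i ∨ q = Sum.inr i → ∏ l ∈ Finset.univ.erase i,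
        A (e (some ((Equiv.swap none (some (τ q)) * τ.optionCongr : Equiv.Perm _)
            (some (Sum.inl l)))))
          (e (some ((Equiv.swap none (some (τ q)) * τ.optionCongr : Equiv.Perm _)
            (some (Sum.inr l))))) =
        ∏ l ∈ Finset.univ.erase i, A (e (some (some (τ (Sum.inl l)))))
          (e (some (some (τ (Sum.inr l))))) := by
      intro q hq
      refine Finset.prod_congr rfl fun l hl => ?_
      have hl' := Finset.ne_of_mem_erase hl
      rw [ho q (Sum.inl l) (by rcases hq with rfl | rfl <;> simp [hl']),
        ho q (Sum.inr l) (by rcases hq with rfl | rfl <;> simp [hl'])]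
    rw [hP _ (Or.inl rfl), hP _ (Or.inr rfl)]
    simp only [e, optionOptionEquiv_some_some]
    change _ * (_ * (A (Sum.inr none) _ * _)) + _ * (_ * (A _ (Sum.inr none) * _)) = _
    rw [hA (Sum.map some some (τ (Sum.inl i))) (Sum.inr none)]
    push_cast
    ring

/-- Two copies of `Fin k` as the pairs `(2 i, 2 i + 1)` of consecutive positions. -/
def pairEquiv (k : ℕ) : Fin k ⊕ Fin k ≃ Fin (k * 2) where
  toFun := Sum.elim (fun i => finProdFinEquiv (i, 0)) (fun i => finProdFinEquiv (i, 1))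
  invFun p := if (finProdFinEquiv.symm p).2 = 0 then Sum.inl (finProdFinEquiv.symm p).1
    else Sum.inr (finProdFinEquiv.symm p).1
  left_inv x := by
    rcases x with i | i
    · simp only [Sum.elim_inl, Equiv.symm_apply_apply]
      rfl
    · simp only [Sum.elim_inr, Equiv.symm_apply_apply]
      rfl
  right_inv p := by
    obtain ⟨⟨i, ε⟩, rfl⟩ := finProdFinEquiv.surjective p
    fin_cases ε
    · simp only [Equiv.symm_apply_apply]
      rfl
    · simp only [Equiv.symm_apply_apply]
      rfl

theorem pfaffian_eq_pfSum {K : Type*} [Field K] {k : ℕ} (A : Matrix (Fin (k * 2)) (Fin (k * 2)) K) :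
    pfaffian A = 1 / (2 ^ k * (k ! : K)) *
      pfSum (A.submatrix (pairEquiv k) (pairEquiv k)) := by
  unfold pfaffian pfSum pfTerm
  congr 1
  refine Fintype.sum_equiv (pairEquiv k).symm.permCongr _ _ fun σ => ?_
  rw [Equiv.Perm.sign_permCongr]
  congr 1
  refine Finset.prod_congr rfl fun i _ => ?_
  simp only [Matrix.submatrix_apply, Equiv.permCongr_apply, Equiv.apply_symm_apply,
    Equiv.symm_symm]
  rfl

theorem pfSum_submatrix_pairEquiv {k : ℕ} {α : Type*} [DecidableEq α] [Fintype α]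
    (e : Fin k ⊕ Fin k ≃ α) (e' : Fin k ⊕ Fin k ≃ α) (A : Matrix (Fin k ⊕ Fin k) (Fin k ⊕ Fin k) R) :
    pfSum ((A.reindex e' e').submatrix e e) =
      ((Equiv.Perm.sign (e.symm.trans e') : ℤ) : R) * pfSum A := by
  have : (A.reindex e' e').submatrix e e = A.submatrix (e.trans e'.symm) (e.trans e'.symm) := rfl
  rw [this, pfSum_submatrix_perm]
  congr 3
  rw [← Equiv.Perm.sign_permCongr e (e.trans e'.symm), ← Equiv.Perm.sign_inv]
  congr 1
  ext x
  rw [Equiv.Perm.inv_eq_iff_eq]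
  simp [Equiv.permCongr_apply]

/-- The permutation passes from interleaved order to block order. Its inversions are exactly the
position pairs `(2 i + 1, 2 j)` with `i < j`, whose images are `k + i` and `j`. -/
theorem sign_pairEquiv (k : ℕ) :
    Equiv.Perm.sign ((pairEquiv k).symm.trans
      (finSumFinEquiv.trans (finCongr (mul_two k).symm))) = (-1) ^ (k * (k - 1) / 2) := by
  set ρ : Equiv.Perm (Fin (k * 2)) := (pairEquiv k).symm.trans
      (finSumFinEquiv.trans (finCongr (mul_two k).symm)) with hρ
  have hl : ∀ i : Fin k, ((ρ (finProdFinEquiv (i, 0)) : Fin (k * 2)) : ℕ) = i := fun i => by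
    have : (pairEquiv k).symm (finProdFinEquiv (i, 0)) = Sum.inl i :=
      (pairEquiv k).symm_apply_apply (Sum.inl i)
    simp [hρ, this]
  have hr : ∀ i : Fin k, ((ρ (finProdFinEquiv (i, 1)) : Fin (k * 2)) : ℕ) = k + i := fun i => by
    have : (pairEquiv k).symm (finProdFinEquiv (i, 1)) = Sum.inr i :=
      (pairEquiv k).symm_apply_apply (Sum.inr i)
    simp [hρ, this, add_comm]
  have h1 : Equiv.Perm.sign ρ = ∏ p, ∏ q, (if p < q ∧ ρ q < ρ p then (-1 : ℤˣ) else 1) := by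
    rw [Equiv.Perm.sign_eq_prod_prod_Ioi]
    refine Finset.prod_congr rfl fun p _ => ?_
    rw [← Finset.prod_subset (Finset.subset_univ (Finset.Ioi p))]
    · refine Finset.prod_congr rfl fun q hq => ?_
      have hq' := Finset.mem_Ioi.1 hq
      have hne : ρ p ≠ ρ q := fun h => hq'.ne (ρ.injective h)
      rcases lt_or_gt_of_ne hne with h | h
      · rw [if_pos h, if_neg (fun h' => lt_asymm h h'.2)]
      · rw [if_neg (lt_asymm h), if_pos ⟨hq', h⟩]
    · intro q _ hq
      rw [if_neg (fun h => hq (Finset.mem_Ioi.2 h.1))]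
  rw [h1, ← Equiv.prod_comp finProdFinEquiv, Fintype.prod_prod_type]
  have h2 : ∀ i : Fin k, (∏ ε : Fin 2, ∏ q, (if finProdFinEquiv (i, ε) < q ∧
      ρ q < ρ (finProdFinEquiv (i, ε)) then (-1 : ℤˣ) else 1)) =
      ∏ j : Fin k, if i < j then -1 else 1 := by
    intro i
    rw [Fin.prod_univ_two, ← Equiv.prod_comp finProdFinEquiv,
      ← Equiv.prod_comp finProdFinEquiv (fun q => if finProdFinEquiv (i, 1) < q ∧
      ρ q < ρ (finProdFinEquiv (i, 1)) then (-1 : ℤˣ) else 1), Fintype.prod_prod_type,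
      Fintype.prod_prod_type, ← Finset.prod_mul_distrib]
    refine Finset.prod_congr rfl fun j _ => ?_
    simp only [Fin.prod_univ_two, Fin.lt_def, hl, hr]
    have v0 : ∀ i : Fin k, ((finProdFinEquiv (i, (0 : Fin 2)) : Fin (k * 2)) : ℕ) = 2 * i :=
      fun i => by simp
    have v1 : ∀ i : Fin k, ((finProdFinEquiv (i, (1 : Fin 2)) : Fin (k * 2)) : ℕ) = 1 + 2 * i :=
      fun i => by simp
    simp only [v0, v1]
    have hi := i.2
    have hj := j.2
    rw [if_neg (by omega), if_neg (by omega), if_neg (c := _ ∧ k + (j : ℕ) < k + i) (by omega)]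
    simp only [one_mul, mul_one]
    exact if_congr (by omega) rfl rfl
  rw [Finset.prod_congr rfl fun i _ => h2 i, Finset.prod_comm]
  have h3 : ∀ j : Fin k, (∏ i : Fin k, if i < j then (-1 : ℤˣ) else 1) = (-1) ^ (j : ℕ) := by
    intro j
    rw [Finset.prod_ite, Finset.prod_const_one, mul_one, Finset.prod_const]
    congr 1
    have : (Finset.univ.filter fun i : Fin k => i < j) = Finset.Iio j := by ext; simp
    rw [this, Fin.card_Iio]
  rw [Finset.prod_congr rfl fun j _ => h3 j, Finset.prod_pow_eq_pow_sum,
    ← Finset.sum_range_id, Finset.sum_range]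

/-- The Pfaffian of a matrix given by four blocks. -/
theorem pfaffian_blockMatrix {K : Type*} [Field K] {k : ℕ} (A B C D : Matrix (Fin k) (Fin k) K) :
    pfaffian (blockMatrix A B C D) = (-1) ^ (k * (k - 1) / 2) * (1 / (2 ^ k * (k ! : K)) *
      pfSum (Matrix.fromBlocks A B C D)) := by
  rw [pfaffian_eq_pfSum, blockMatrix, pfSum_submatrix_pairEquiv, sign_pairEquiv]
  push_cast
  ring

/-- The Pfaffian of an array of `2 × 2` blocks. -/
theorem pfaffian_kernelMatrix {K : Type*} [Field K] {k : ℕ}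
    (M : ℝ → ℝ → Matrix (Fin 2) (Fin 2) K) (z : Fin k → ℝ) :
    pfaffian (kernelMatrix M z) = 1 / (2 ^ k * (k ! : K)) *
      pfSum (Matrix.fromBlocks (Matrix.of fun i j => M (z i) (z j) 0 0)
        (Matrix.of fun i j => M (z i) (z j) 0 1) (Matrix.of fun i j => M (z i) (z j) 1 0)
        (Matrix.of fun i j => M (z i) (z j) 1 1)) := by
  rw [pfaffian_eq_pfSum]
  congr 2
  ext x y
  rcases x with i | i <;> rcases y with j | j <;>
    simp only [kernelMatrix, pairEquiv, Matrix.submatrix_apply, Matrix.of_apply, Equiv.coe_fn_mk,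
      Sum.elim_inl, Sum.elim_inr, Equiv.symm_apply_apply, Matrix.fromBlocks_apply₁₁,
      Matrix.fromBlocks_apply₁₂, Matrix.fromBlocks_apply₂₁, Matrix.fromBlocks_apply₂₂]

end PfaffianSum

/-! ### Schur's Pfaffian identity with a border -/

section SchurPfaffian

/-- The product of the sums `z i + z j`, `i < j`. -/
def sumProd {n : ℕ} (z : Fin n → ℝ) : ℝ := ∏ i, ∏ j ∈ Finset.Ioi i, (z i + z j)

/-- Only factors containing the moved variable depend on it. Those in which it stands second are
turned round at the cost of a factor `ε`, which goes into `C`. It is used for `x + y` and for `y -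
x`. -/
theorem prod_Ioi_update {n : ℕ} (h : ℝ → ℝ → ℝ) (ε : ℝ) (hε : ∀ x y, h y x = ε * h x y)
    (z : Fin n → ℝ) (i₀ : Fin n) : ∃ C : ℝ, ∀ t : ℝ,
    ∏ i, ∏ j ∈ Finset.Ioi i, h (Function.update z i₀ t i) (Function.update z i₀ t j) =
      C * ∏ j ∈ Finset.univ.erase i₀, h t (z j) := by
  refine ⟨(∏ j ∈ Finset.univ.erase i₀, if j < i₀ then ε else 1) *
    ∏ i ∈ Finset.univ.erase i₀, ∏ j ∈ (Finset.Ioi i).erase i₀, h (z i) (z j), fun t => ?_⟩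
  rw [← Finset.mul_prod_erase _ _ (Finset.mem_univ i₀), Function.update_self]
  have h1 : ∏ j ∈ Finset.Ioi i₀, h t (Function.update z i₀ t j) =
      ∏ j ∈ Finset.univ.erase i₀, if i₀ < j then h t (z j) else 1 := by
    rw [Finset.prod_ite, Finset.prod_const_one, mul_one]
    refine Finset.prod_congr ?_ fun j hj => ?_
    · ext j
      simp only [Finset.mem_Ioi, Finset.mem_filter, Finset.mem_erase, Finset.mem_univ, and_true]
      exact ⟨fun h => ⟨h.ne', h⟩, fun h => h.2⟩
    · rw [Finset.mem_filter] at hj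
      rw [Function.update_of_ne hj.2.ne']
  have h2 : ∀ i ∈ Finset.univ.erase i₀, ∏ j ∈ Finset.Ioi i, h (Function.update z i₀ t i)
      (Function.update z i₀ t j) = (if i < i₀ then ε * h t (z i) else 1) *
        ∏ j ∈ (Finset.Ioi i).erase i₀, h (z i) (z j) := by
    intro i hi
    have hi' := Finset.ne_of_mem_erase hi
    rw [Function.update_of_ne hi']
    have h3 : ∏ j ∈ (Finset.Ioi i).erase i₀, h (z i) (z j) =
        ∏ j ∈ (Finset.Ioi i).erase i₀, h (z i) (Function.update z i₀ t j) :=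
      Finset.prod_congr rfl fun j hj => by
        rw [Function.update_of_ne (Finset.ne_of_mem_erase hj)]
    rw [h3]
    split_ifs with hlt
    · rw [← Finset.mul_prod_erase _ _ (Finset.mem_Ioi.2 hlt), Function.update_self, hε]
    · rw [Finset.erase_eq_of_notMem (by simpa using hlt), one_mul]
  rw [h1, Finset.prod_congr rfl h2, Finset.prod_mul_distrib, ← mul_assoc, ← Finset.prod_mul_distrib,
    mul_right_comm]
  congr 1
  rw [← Finset.prod_mul_distrib]
  refine Finset.prod_congr rfl fun j hj => ?_
  rcases lt_or_gt_of_ne (Finset.ne_of_mem_erase hj) with hlt | hlt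
  · rw [if_neg (lt_asymm hlt), if_pos hlt, if_pos hlt, one_mul]
  · rw [if_pos hlt, if_neg (lt_asymm hlt), if_neg (lt_asymm hlt), one_mul, mul_one]

/-- A function of tuples of distinct positive numbers is constant if it does not change when one
entry is moved. -/
theorem exists_const_of_update {n : ℕ} (F : (Fin n → ℝ) → ℝ)
    (hF : ∀ z : Fin n → ℝ, Function.Injective z → (∀ i, 0 < z i) → ∀ i t, 0 < t →
      (∀ j, j ≠ i → t ≠ z j) → F (Function.update z i t) = F z) :
    ∃ κ, ∀ z : Fin n → ℝ, Function.Injective z → (∀ i, 0 < z i) → F z = κ := by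
  have key : ∀ z : Fin n → ℝ, Function.Injective z → (∀ i, 0 < z i) → ∀ M : ℝ, 0 ≤ M →
      (∀ i, z i ≤ M) → F z = F (fun i => M + 1 + (i : ℕ)) := by
    intro z hz hpos M hM0 hM
    -- The entries are moved one at a time to `M + 1 + i`, beyond all `z i`, so every intermediate
    -- tuple has distinct entries.
    set h : ℕ → Fin n → ℝ := fun m i => if (i : ℕ) < m then M + 1 + (i : ℕ) else z i with hh
    have hinj : ∀ m, Function.Injective (h m) := by
      intro m i j hij
      simp only [hh] at hij
      have hi := hM i
      have hj := hM j
      have hi0 : (0 : ℝ) ≤ (i : ℕ) := by positivity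
      have hj0 : (0 : ℝ) ≤ (j : ℕ) := by positivity
      split_ifs at hij with h1 h2 h2
      · exact Fin.ext (by exact_mod_cast add_left_cancel hij)
      · linarith
      · linarith
      · exact hz hij
    have hp : ∀ m i, 0 < h m i := by
      intro m i
      simp only [hh]
      split_ifs
      · positivity
      · exact hpos i
    have step : ∀ m, m ≤ n → F (h m) = F z := by
      intro m
      induction m with
      | zero => intro _; congr 1
      | succ m ih =>
        intro hm
        rw [← ih (by omega)]
        have : h (m + 1) = Function.update (h m) ⟨m, by omega⟩ (M + 1 + (m : ℕ)) := by
          ext i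
          by_cases hi : i = ⟨m, by omega⟩
          · subst hi
            simp [hh]
          · rw [Function.update_of_ne hi]
            have : (i : ℕ) ≠ m := fun h => hi (Fin.ext h)
            simp only [hh]
            exact if_congr (by omega) rfl rfl
        rw [this]
        refine hF _ (hinj m) (hp m) _ _ (by positivity) fun j hj heq => ?_
        have hjm : (j : ℕ) ≠ m := fun h => hj (Fin.ext h)
        simp only [hh] at heq
        split_ifs at heq
        · exact hjm (by exact_mod_cast (add_left_cancel heq).symm)
        · have := hM j
          have hm0 : (0 : ℝ) ≤ m := by positivity
          linarith
    rw [← step n le_rfl]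
    congr 1
    ext i
    simp [hh]
  refine ⟨F (fun i => 0 + 1 + (i : ℕ)), fun z hz hpos => ?_⟩
  -- This bounds the entries of `z` and of the reference tuple `1, …, n`, so both are joined to the
  -- same far tuple.
  set M : ℝ := (∑ i, z i) + (n + 1) with hMdef
  have hle : ∀ i, z i ≤ ∑ i, z i := fun i =>
    Finset.single_le_sum (fun j _ => (hpos j).le) (Finset.mem_univ i)
  have hs : 0 ≤ ∑ i, z i := Finset.sum_nonneg fun i _ => (hpos i).le
  have hn : (0 : ℝ) ≤ n := by positivity
  rw [key z hz hpos M (by positivity) fun i => by linarith [hle i]]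
  symm
  refine key _ ?_ ?_ M (by positivity) ?_
  · intro i j hij
    exact Fin.ext (by exact_mod_cast add_left_cancel hij)
  · intro i
    positivity
  · intro i
    have : ((i : ℕ) : ℝ) ≤ n := by exact_mod_cast i.2.le
    simp only [hMdef]
    linarith

/-- The matrix `[-E, -1 cᵗ; c 1ᵗ, J]` with `E = (z j - z i) / (z i + z j)`. -/
def schurMatrix {n : ℕ} (J : Matrix (Fin n) (Fin n) ℝ) (c : Fin n → ℝ) (z : Fin n → ℝ) :
    Matrix (Fin n ⊕ Fin n) (Fin n ⊕ Fin n) ℝ :=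
  Matrix.fromBlocks (Matrix.of fun i j => -((z j - z i) / (z i + z j)))
    (Matrix.of fun _ j => -c j) (Matrix.of fun i _ => c i) J

open Polynomial in
-- As a function of `t`, the Pfaffian times `∏ (t + z j)` is a polynomial of degree at most `n - 1`,
-- by linearity in one row. It vanishes at the `n - 1` points `t = z j`, hence is a multiple of `∏
-- (t - z j)`; comparison at `t = z i₀` gives the claim.
theorem pfSum_schurMatrix_update {n : ℕ} (J : Matrix (Fin n) (Fin n) ℝ) (c : Fin n → ℝ)
    (z : Fin n → ℝ) (hz : Function.Injective z) (hpos : ∀ i, 0 < z i) (i₀ : Fin n) (t : ℝ)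
    (ht : 0 < t) :
    (pfSum (schurMatrix J c (Function.update z i₀ t)) * ∏ j ∈ Finset.univ.erase i₀, (t + z j)) *
      ∏ j ∈ Finset.univ.erase i₀, (z i₀ - z j) =
    (pfSum (schurMatrix J c z) * ∏ j ∈ Finset.univ.erase i₀, (z i₀ + z j)) *
      ∏ j ∈ Finset.univ.erase i₀, (t - z j) := by
  obtain ⟨k, y, hy, hk⟩ := pfSum_row_linear (Sum.inl i₀) (schurMatrix J c z)
  set S := Finset.univ.erase i₀ with hS
  let d : ℝ → Fin n ⊕ Fin n → ℝ := fun t => Sum.elim (fun j => if j = i₀ then 0 else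
    -((z j - t) / (t + z j))) (fun j => -c j)
  have hD : ∀ t, schurMatrix J c (Function.update z i₀ t) = Matrix.of fun x y =>
      if x = Sum.inl i₀ then d t y else if y = Sum.inl i₀ then -d t x else
        schurMatrix J c z x y := by
    intro t
    ext x y
    rcases x with i | i <;> rcases y with j | j
    · by_cases hi : i = i₀ <;> by_cases hj : j = i₀
      · simp [schurMatrix, d, hi, hj]
      · simp [schurMatrix, d, hi, hj]
      · simp [schurMatrix, d, hi, hj, add_comm, ← neg_div]
      · simp [schurMatrix, d, hi, hj]
    · by_cases hi : i = i₀
      · simp [schurMatrix, d, hi]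
      · simp [schurMatrix, hi]
    · by_cases hj : j = i₀
      · simp [schurMatrix, d, hj]
      · simp [schurMatrix, hj]
    · simp [schurMatrix]
  -- The entries of the moving row, cleared of their denominators.
  let q : Fin n ⊕ Fin n → ℝ[X] := Sum.elim
    (fun j => (X - C (z j)) * ∏ l ∈ S.erase j, (X + C (z l)))
    (fun j => C (-c j) * ∏ l ∈ S, (X + C (z l)))
  have hcard : S.card + 1 = n := by
    rw [hS, Finset.card_erase_of_mem (Finset.mem_univ _), Finset.card_univ, Fintype.card_fin]
    have := i₀.2
    omega
  have hprod : ∀ T : Finset (Fin n), (∏ l ∈ T, (X + C (z l))).degree ≤ (T.card : WithBot ℕ) := by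
    intro T
    refine (degree_prod_le _ _).trans ?_
    refine (Finset.sum_le_card_nsmul _ _ 1 fun l _ => (degree_X_add_C (z l)).le).trans ?_
    simp
  have hdeg : ∀ x, x ≠ Sum.inl i₀ → (q x).degree ≤ (S.card : WithBot ℕ) := by
    intro x hx
    rcases x with j | j
    · have hj : j ∈ S := Finset.mem_erase.2 ⟨fun h => hx (by rw [h]), Finset.mem_univ _⟩
      refine (degree_mul_le _ _).trans ?_
      rw [degree_X_sub_C]
      refine (add_le_add_right (hprod _) 1).trans ?_
      rw [← Finset.card_erase_add_one hj, Nat.cast_add, Nat.cast_one, add_comm]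
    · refine (degree_mul_le _ _).trans ?_
      refine (add_le_add degree_C_le (hprod _)).trans ?_
      simp
  let Q : ℝ[X] := ∑ σ, C (k σ) * q (y σ)
  have hQdeg : Q.degree ≤ (S.card : WithBot ℕ) := by
    refine (degree_sum_le _ _).trans (Finset.sup_le fun σ _ => ?_)
    refine (degree_mul_le _ _).trans ?_
    refine (add_le_add degree_C_le (hdeg _ (hy σ))).trans ?_
    simp
  have hQ : ∀ t, 0 < t → pfSum (schurMatrix J c (Function.update z i₀ t)) *
      ∏ j ∈ S, (t + z j) = Q.eval t := by
    intro t ht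
    rw [hD t, hk, Finset.sum_mul, eval_finsetSum]
    refine Finset.sum_congr rfl fun σ _ => ?_
    rw [mul_assoc, eval_mul, eval_C]
    congr 1
    have hyσ := hy σ
    rcases hyy : y σ with j | j
    · have hj : j ≠ i₀ := fun h => hyσ (by rw [hyy, h])
      have hjS : j ∈ S := Finset.mem_erase.2 ⟨hj, Finset.mem_univ _⟩
      have hne : t + z j ≠ 0 := (add_pos ht (hpos j)).ne'
      simp only [d, q, Sum.elim_inl, if_neg hj, eval_mul, eval_sub, eval_X, eval_C, eval_prod,
        eval_add]
      rw [← Finset.mul_prod_erase _ _ hjS]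
      field_simp
      ring
    · simp only [d, q, Sum.elim_inr, eval_mul, eval_C, eval_prod, eval_add, eval_X]
  have hQ0 : ∀ j ∈ S, Q.eval (z j) = 0 := by
    intro j hj
    have hj' : j ≠ i₀ := Finset.ne_of_mem_erase hj
    rw [← hQ _ (hpos j)]
    -- At `t = z j` the rows `inl i₀` and `inl j` agree, so exchanging them fixes the matrix while
    -- changing the sign of the Pfaffian.
    have hsw := pfSum_submatrix_perm (Equiv.swap (Sum.inl i₀) (Sum.inl j))
      (schurMatrix J c (Function.update z i₀ (z j)))
    have hsub : (schurMatrix J c (Function.update z i₀ (z j))).submatrix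
        (Equiv.swap (Sum.inl i₀) (Sum.inl j)) (Equiv.swap (Sum.inl i₀) (Sum.inl j)) =
        schurMatrix J c (Function.update z i₀ (z j)) := by
      have hz' : ∀ l, Function.update z i₀ (z j) (Equiv.swap i₀ j l) =
          Function.update z i₀ (z j) l := by
        intro l
        rcases eq_or_ne l i₀ with rfl | h1
        · rw [Equiv.swap_apply_left, Function.update_self, Function.update_of_ne hj']
        · rcases eq_or_ne l j with rfl | h2
          · rw [Equiv.swap_apply_right, Function.update_self, Function.update_of_ne hj']
          · rw [Equiv.swap_apply_of_ne_of_ne h1 h2]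
      have hl : ∀ l : Fin n, Equiv.swap (Sum.inl i₀ : Fin n ⊕ Fin n) (Sum.inl j) (Sum.inl l) =
          Sum.inl (Equiv.swap i₀ j l) := fun l =>
        ((Function.Injective.swap_apply Sum.inl_injective i₀ j l))
      have hr : ∀ l : Fin n, Equiv.swap (Sum.inl i₀ : Fin n ⊕ Fin n) (Sum.inl j) (Sum.inr l) =
          Sum.inr l := fun l => Equiv.swap_apply_of_ne_of_ne (by simp) (by simp)
      ext x x'
      rcases x with l | l <;> rcases x' with l' | l' <;>
        simp only [Matrix.submatrix_apply, hl, hr, schurMatrix, Matrix.fromBlocks_apply₁₁,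
          Matrix.fromBlocks_apply₁₂, Matrix.fromBlocks_apply₂₁, Matrix.fromBlocks_apply₂₂,
          Matrix.of_apply, hz']
    rw [hsub, Equiv.Perm.sign_swap (by simpa using hj'.symm)] at hsw
    have : pfSum (schurMatrix J c (Function.update z i₀ (z j))) = 0 := by
      push_cast at hsw
      linarith
    rw [this, zero_mul]
  -- A polynomial of degree less than `n` which vanishes at the `n` distinct points `z j`.
  have hmain : Q * C (∏ j ∈ S, (z i₀ - z j)) - C (Q.eval (z i₀)) * ∏ j ∈ S, (X - C (z j)) = 0 := by
    refine Polynomial.eq_zero_of_degree_lt_of_eval_finset_eq_zero (Finset.univ.image z) ?_ ?_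
    · rw [Finset.card_image_of_injective _ hz, Finset.card_univ, Fintype.card_fin]
      have : ((S.card : ℕ) : WithBot ℕ) < (n : WithBot ℕ) := by
        exact_mod_cast (by omega : S.card < n)
      refine lt_of_le_of_lt ?_ this
      refine (degree_sub_le _ _).trans (max_le ?_ ?_)
      · refine (degree_mul_le _ _).trans ((add_le_add hQdeg degree_C_le).trans ?_)
        simp
      · refine (degree_mul_le _ _).trans ((add_le_add degree_C_le ?_).trans_eq (zero_add _))
        refine (degree_prod_le _ _).trans ?_
        refine (Finset.sum_le_card_nsmul _ _ 1 fun l _ => (degree_X_sub_C (z l)).le).trans ?_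
        simp
    · intro x hx
      obtain ⟨j, _, rfl⟩ := Finset.mem_image.1 hx
      rw [eval_sub, eval_mul, eval_mul, eval_C, eval_C, eval_prod]
      simp only [eval_sub, eval_X, eval_C]
      rcases eq_or_ne j i₀ with rfl | hj
      · ring
      · have hjS : j ∈ S := Finset.mem_erase.2 ⟨hj, Finset.mem_univ _⟩
        have h0 : ∏ l ∈ S, (z j - z l) = 0 := Finset.prod_eq_zero hjS (sub_self _)
        rw [hQ0 j hjS, h0]
        ring
  have h1 := hQ t ht
  have h2 := hQ (z i₀) (hpos i₀)
  rw [Function.update_eq_self] at h2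
  rw [h1, h2]
  have h3 := congrArg (eval t) hmain
  rw [eval_sub, eval_mul, eval_mul, eval_C, eval_C, eval_prod, eval_zero] at h3
  simp only [eval_sub, eval_X, eval_C] at h3
  linarith

theorem vandermondeProd_ne_zero {n : ℕ} {z : Fin n → ℝ} (hz : Function.Injective z) :
    vandermondeProd z ≠ 0 := by
  refine Finset.prod_ne_zero_iff.2 fun i _ => Finset.prod_ne_zero_iff.2 fun j hj => ?_
  exact sub_ne_zero.2 fun h => (Finset.mem_Ioi.1 hj).ne' (hz h)

theorem sumProd_pos {n : ℕ} {z : Fin n → ℝ} (hz : ∀ i, 0 < z i) : 0 < sumProd z :=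
  Finset.prod_pos fun i _ => Finset.prod_pos fun j _ => add_pos (hz i) (hz j)

/-- Schur's Pfaffian identity, up to a constant. -/
theorem exists_pfSum_schurMatrix_eq {n : ℕ} (J : Matrix (Fin n) (Fin n) ℝ) (c : Fin n → ℝ) :
    ∃ κ, ∀ z : Fin n → ℝ, Function.Injective z → (∀ i, 0 < z i) →
      pfSum (schurMatrix J c z) = κ * (vandermondeProd z / sumProd z) := by
  obtain ⟨κ, hκ⟩ := exists_const_of_update
    (fun z : Fin n → ℝ => pfSum (schurMatrix J c z) * sumProd z / vandermondeProd z) (by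
      intro z hz hpos i t ht htz
      have hzt : Function.Injective (Function.update z i t) := by
        intro j l hjl
        by_cases hj : j = i <;> by_cases hl : l = i
        · rw [hj, hl]
        · rw [hj, Function.update_self, Function.update_of_ne hl] at hjl
          exact absurd hjl (htz l hl)
        · rw [hl, Function.update_self, Function.update_of_ne hj] at hjl
          exact absurd hjl.symm (htz j hj)
        · rw [Function.update_of_ne hl, Function.update_of_ne hj] at hjl
          exact hz hjl
      obtain ⟨C₁, h1⟩ := prod_Ioi_update (fun x y => x + y) 1 (fun x y => by ring) z i
      obtain ⟨C₂, h2⟩ := prod_Ioi_update (fun x y => y - x) (-1) (fun x y => by ring) z i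
      have h2' : ∀ t, vandermondeProd (Function.update z i t) =
          C₂ * (-1) ^ (Finset.univ.erase i).card * ∏ j ∈ Finset.univ.erase i, (t - z j) := by
        intro t
        rw [mul_assoc, ← Finset.prod_const, ← Finset.prod_mul_distrib]
        refine (h2 t).trans ?_
        congr 1
        exact Finset.prod_congr rfl fun j _ => by ring
      have h1z := h1 (z i)
      have h2z := h2' (z i)
      rw [Function.update_eq_self] at h1z h2z
      have hstep := pfSum_schurMatrix_update J c z hz hpos i t ht
      rw [div_eq_div_iff (vandermondeProd_ne_zero hzt) (vandermondeProd_ne_zero hz), h2', h2z]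
      unfold sumProd
      rw [h1, h1z]
      linear_combination C₁ * C₂ * (-1) ^ (Finset.univ.erase i).card * hstep)
  refine ⟨κ, fun z hz hpos => ?_⟩
  have h := hκ z hz hpos
  have := vandermondeProd_ne_zero hz
  have := (sumProd_pos hpos).ne'
  rw [← h]
  field_simp

end SchurPfaffian

/-! ### Skew matrix kernels: factorisation through the Schur matrix and integration of a variable -/

section SkewKernels

/-- The data of a skew-symmetric matrix kernel of size two: a weight `ω`, functions `U j`, a
skew-symmetric matrix `J` and a vector `c`, both supported on indices below `N`. -/
structure SkewKernel where
  N : ℕ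
  ω : ℝ → ℝ
  U : ℕ → ℝ → ℝ
  J : ℕ → ℕ → ℝ
  c : ℕ → ℝ
  J_skew : ∀ i j, J i j = -J j i
  J_zero : ∀ i j, N ≤ i → J i j = 0
  c_zero : ∀ i, N ≤ i → c i = 0

namespace SkewKernel

variable (K : SkewKernel)

/-- The functions which are biorthogonal to the monomials. -/
def q (l : ℕ) (x : ℝ) : ℝ := K.ω x * (∑ j ∈ Finset.range K.N, K.J l j * K.U j x + K.c l)

/-- The entries of the matrix kernel, as a function on two copies of `ℝ`. -/
def entry : ℝ ⊕ ℝ → ℝ ⊕ ℝ → ℝ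
  | Sum.inl x, Sum.inl y => K.ω x * K.ω y * (∑ j ∈ Finset.range K.N, K.c j * (K.U j x - K.U j y) +
      ∑ i ∈ Finset.range K.N, ∑ j ∈ Finset.range K.N, K.U i x * K.J i j * K.U j y -
      (y - x) / (x + y))
  | Sum.inl x, Sum.inr y => ∑ l ∈ Finset.range K.N, y ^ l * K.q l x
  | Sum.inr x, Sum.inl y => -∑ l ∈ Finset.range K.N, x ^ l * K.q l y
  | Sum.inr x, Sum.inr y =>
      ∑ i ∈ Finset.range K.N, ∑ j ∈ Finset.range K.N, x ^ i * K.J i j * y ^ j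

theorem entry_skew (p p' : ℝ ⊕ ℝ) : K.entry p p' = -K.entry p' p := by
  rcases p with x | x <;> rcases p' with y | y
  · simp only [entry]
    have h1 : ∑ i ∈ Finset.range K.N, ∑ j ∈ Finset.range K.N, K.U i x * K.J i j * K.U j y =
        -∑ i ∈ Finset.range K.N, ∑ j ∈ Finset.range K.N, K.U i y * K.J i j * K.U j x := by
      rw [Finset.sum_comm, ← Finset.sum_neg_distrib]
      refine Finset.sum_congr rfl fun i _ => ?_
      rw [← Finset.sum_neg_distrib]
      refine Finset.sum_congr rfl fun j _ => ?_
      rw [K.J_skew j i]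
      ring
    have h2 : ∑ j ∈ Finset.range K.N, K.c j * (K.U j x - K.U j y) =
        -∑ j ∈ Finset.range K.N, K.c j * (K.U j y - K.U j x) := by
      rw [← Finset.sum_neg_distrib]
      exact Finset.sum_congr rfl fun i _ => by ring
    rw [h1, h2, add_comm y x]
    ring
  · simp [entry]
  · simp [entry]
  · simp only [entry]
    rw [Finset.sum_comm, ← Finset.sum_neg_distrib]
    refine Finset.sum_congr rfl fun i _ => ?_
    rw [← Finset.sum_neg_distrib]
    refine Finset.sum_congr rfl fun j _ => ?_
    rw [K.J_skew j i]
    ring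

variable {ι κ : Type*}

/-- The kernel matrix of a family of points. -/
def matrix (z : ι → ℝ) : Matrix (ι ⊕ ι) (ι ⊕ ι) ℝ :=
  Matrix.of fun p p' => K.entry (Sum.map z z p) (Sum.map z z p')

theorem pfSum_matrix_comp [Fintype ι] [DecidableEq ι] [Fintype κ] [DecidableEq κ] (e : ι ≃ κ)
    (z : κ → ℝ) : pfSum (K.matrix (z ∘ e)) = pfSum (K.matrix z) := by
  rw [← pfSum_submatrix_sumCongr e]
  congr 1
  ext p p'
  rcases p with i | i <;> rcases p' with j | j <;> rfl

theorem sum_range_eq_sum_fin {n : ℕ} (hn : K.N ≤ n) (f : ℕ → ℝ) (hf : ∀ j, K.N ≤ j → f j = 0) :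
    ∑ j ∈ Finset.range K.N, f j = ∑ j : Fin n, f j := by
  rw [← Finset.sum_range]
  refine Finset.sum_subset (Finset.range_mono hn) fun j _ hj => hf j ?_
  simpa using hj

/-- The block triangular matrix which reduces the kernel matrix to the Schur matrix. -/
def reduction {n : ℕ} (z : Fin n → ℝ) : Matrix (Fin n ⊕ Fin n) (Fin n ⊕ Fin n) ℝ :=
  Matrix.fromBlocks (Matrix.diagonal fun i => K.ω (z i))
    (Matrix.of fun i j => K.ω (z i) * K.U j (z i)) 0 (-Matrix.vandermonde z)

theorem det_reduction {n : ℕ} (z : Fin n → ℝ) :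
    (K.reduction z).det = (∏ i, K.ω (z i)) * ((-1) ^ n * vandermondeProd z) := by
  rw [reduction, Matrix.det_fromBlocks_zero₂₁, Matrix.det_diagonal, Matrix.det_neg,
    Matrix.det_vandermonde, Fintype.card_fin]
  rfl

theorem J_zero' (i j : ℕ) (h : K.N ≤ j) : K.J i j = 0 := by
  rw [K.J_skew, K.J_zero _ _ h, neg_zero]

/-- The kernel entries are the values of the bordered Schur form on the vectors `ω(x) (e_x, U(x))`
and `(0, -(x^i))`. Since `J` and `c` vanish from `N` on, this holds for every number of points `n ≥
N`. -/
theorem matrix_eq_reduction {n : ℕ} (hn : K.N ≤ n) (z : Fin n → ℝ) :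
    K.matrix z = K.reduction z *
      schurMatrix (Matrix.of fun i j : Fin n => K.J i j) (fun j => K.c j) z *
        (K.reduction z).transpose := by
  have hq : ∀ l x, K.q l x = K.ω x * (∑ j : Fin n, K.J l j * K.U j x + K.c l) := by
    intro l x
    rw [q, K.sum_range_eq_sum_fin hn _ fun j hj => by rw [K.J_zero' _ _ hj, zero_mul]]
  have hJJ : ∀ f g : ℕ → ℝ, ∑ i ∈ Finset.range K.N, ∑ j ∈ Finset.range K.N, f i * K.J i j * g j =
      ∑ j : Fin n, ∑ i : Fin n, f i * K.J i j * g j := by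
    intro f g
    rw [Finset.sum_comm, K.sum_range_eq_sum_fin hn _ fun j hj =>
      Finset.sum_eq_zero fun i _ => by rw [K.J_zero' _ _ hj]; ring]
    refine Finset.sum_congr rfl fun j _ => ?_
    rw [K.sum_range_eq_sum_fin hn _ fun i hi => by rw [K.J_zero _ _ hi]; ring]
  have hp : ∀ x y, ∑ l ∈ Finset.range K.N, y ^ l * K.q l x =
      ∑ l : Fin n, y ^ (l : ℕ) * (K.ω x * (∑ j : Fin n, K.J l j * K.U j x + K.c l)) := by
    intro x y
    rw [K.sum_range_eq_sum_fin hn _ fun l hl => by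
      rw [q, K.c_zero l hl, Finset.sum_eq_zero fun j _ => by rw [K.J_zero _ _ hl, zero_mul]]
      ring]
    simp_rw [hq]
  have h12 : ∀ x y, ∑ l ∈ Finset.range K.N, y ^ l * K.q l x =
      ∑ l : Fin n, (K.ω x * -K.c l + ∑ j : Fin n, K.ω x * K.U j x * K.J j l) *
        -y ^ (l : ℕ) := by
    intro x y
    rw [hp]
    refine Finset.sum_congr rfl fun l _ => ?_
    have : ∑ j : Fin n, K.ω x * K.U j x * K.J j l = -(K.ω x * ∑ j : Fin n, K.J l j * K.U j x) := by
      rw [Finset.mul_sum, ← Finset.sum_neg_distrib]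
      refine Finset.sum_congr rfl fun j _ => ?_
      rw [K.J_skew]
      ring
    rw [this]
    ring
  rw [reduction, schurMatrix, Matrix.fromBlocks_transpose, Matrix.fromBlocks_multiply,
    Matrix.fromBlocks_multiply]
  ext p p'
  rcases p with i | i <;> rcases p' with j | j
  · simp only [matrix, Matrix.of_apply, Sum.map_inl, entry, Matrix.fromBlocks_apply₁₁,
      Matrix.diagonal_transpose, Matrix.add_apply, Matrix.mul_apply, Matrix.transpose_apply,
      Matrix.diagonal_apply, ite_mul, mul_ite, zero_mul, mul_zero, Finset.sum_ite_eq,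
      Finset.sum_ite_eq', Finset.mem_univ, if_true]
    rw [hJJ, K.sum_range_eq_sum_fin hn _ fun j hj => by rw [K.c_zero _ hj, zero_mul]]
    simp only [Finset.sum_mul, add_mul, mul_add, Finset.mul_sum, mul_sub, Finset.sum_add_distrib,
      Finset.sum_sub_distrib]
    have e1 : ∀ l : Fin n, K.ω (z i) * K.U l (z i) * K.c l * K.ω (z j) =
        K.ω (z i) * K.ω (z j) * (K.c l * K.U l (z i)) := fun l => by ring
    have e2 : ∀ l : Fin n, K.ω (z i) * -K.c l * (K.ω (z j) * K.U l (z j)) =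
        -(K.ω (z i) * K.ω (z j) * (K.c l * K.U l (z j))) := fun l => by ring
    have e3 : ∀ l m : Fin n, K.ω (z i) * K.U m (z i) * K.J m l * (K.ω (z j) * K.U l (z j)) =
        K.ω (z i) * K.ω (z j) * (K.U m (z i) * K.J m l * K.U l (z j)) := fun l m => by ring
    simp only [e1, e2, e3, Finset.sum_neg_distrib]
    ring
  · simp only [matrix, Matrix.of_apply, Sum.map_inl, Sum.map_inr, entry, Matrix.fromBlocks_apply₁₂,
      Matrix.diagonal_transpose, Matrix.add_apply, Matrix.mul_apply,
      Matrix.diagonal_apply, ite_mul, zero_mul, mul_zero, Finset.sum_ite_eq,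
      Finset.mem_univ, if_true,
      Matrix.transpose_apply, Matrix.transpose_zero, zero_add,
      Matrix.neg_apply, Matrix.vandermonde_apply, h12]
  · simp only [matrix, Matrix.of_apply, Sum.map_inl, Sum.map_inr, entry, Matrix.fromBlocks_apply₂₁,
      Matrix.diagonal_transpose, Matrix.add_apply, Matrix.mul_apply,
      Matrix.diagonal_apply, mul_ite, zero_mul, mul_zero,
      Finset.sum_ite_eq', Finset.mem_univ, if_true,
      Matrix.transpose_apply, zero_add, Matrix.neg_apply,
      Matrix.vandermonde_apply, h12]
    rw [← Finset.sum_neg_distrib]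
    simp only [Finset.sum_mul, add_mul, Finset.sum_add_distrib, mul_neg, neg_mul,
      Finset.sum_neg_distrib, neg_add, neg_neg]
    congr 1
    · rw [neg_inj]
      exact Finset.sum_congr rfl fun l _ => by ring
    · rw [Finset.sum_comm, ← Finset.sum_neg_distrib]
      refine Finset.sum_congr rfl fun l _ => ?_
      rw [← Finset.sum_neg_distrib]
      refine Finset.sum_congr rfl fun m _ => ?_
      rw [K.J_skew]
      ring
  · simp only [matrix, Matrix.of_apply, Sum.map_inr, entry, Matrix.fromBlocks_apply₂₂,
      Matrix.mul_apply, Matrix.transpose_zero, Matrix.mul_zero, zero_add, Matrix.zero_mul,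
      Matrix.transpose_apply, Matrix.neg_apply, Matrix.vandermonde_apply, hJJ, Finset.sum_mul]
    exact Finset.sum_congr rfl fun l _ => Finset.sum_congr rfl fun m _ => by ring

/-- With more than `N` points the Schur matrix has a zero row and column at the index `N` of the
second block. -/
theorem pfSum_matrix_eq_zero {n : ℕ} (hn : K.N < n) (z : Fin n → ℝ) : pfSum (K.matrix z) = 0 := by
  rw [K.matrix_eq_reduction hn.le, pfSum_congruence,
    pfSum_eq_zero_of_row_eq_zero _ (Sum.inr ⟨K.N, hn⟩), mul_zero]
  · rintro (j | j)
    · simp [schurMatrix, K.c_zero]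
    · simp [schurMatrix, K.J_zero]
  · rintro (j | j)
    · simp [schurMatrix, K.c_zero]
    · simp [schurMatrix, K.J_zero']

/-- The determinant of the congruence supplies the weights and one Vandermonde factor, Schur's
identity the other one over `∏ (z i + z j)`. At coinciding points both sides vanish because of the
first factor. -/
theorem exists_pfSum_matrix_eq : ∃ κ : ℝ, ∀ z : Fin K.N → ℝ, (∀ i, 0 < z i) →
    pfSum (K.matrix z) = κ * (vandermondeProd z ^ 2 / sumProd z * ∏ i, K.ω (z i)) := by
  obtain ⟨κ, hκ⟩ := exists_pfSum_schurMatrix_eq (Matrix.of fun i j : Fin K.N => K.J i j)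
    (fun j => K.c j)
  refine ⟨(-1) ^ K.N * κ, fun z hz => ?_⟩
  rw [K.matrix_eq_reduction le_rfl, pfSum_congruence, det_reduction]
  by_cases hinj : Function.Injective z
  · rw [hκ z hinj hz]
    ring
  · have : vandermondeProd z = 0 := by
      have h := Matrix.det_vandermonde z
      have h0 : (Matrix.vandermonde z).det = 0 := by
        by_contra hne
        exact hinj (Matrix.det_vandermonde_ne_zero_iff.1 hne)
      rw [h0] at h
      exact h.symm
    rw [this]
    ring

/-- The biorthogonality relations which make the Pfaffians consistent under integration. -/
structure IsReproducing : Prop where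
  integrable_q : ∀ l i, l < K.N → i < K.N → IntegrableOn (fun y => K.q l y * y ^ i) (Ioi 0)
  integral_q : ∀ l i, l < K.N → i < K.N →
    ∫ y in Ioi (0 : ℝ), K.q l y * y ^ i = if l = i then 2 else 0
  integrable_entry : ∀ x i, 0 < x → i < K.N →
    IntegrableOn (fun y => K.entry (Sum.inl y) (Sum.inl x) * y ^ i) (Ioi 0)
  integral_entry : ∀ x i, 0 < x → i < K.N →
    ∫ y in Ioi (0 : ℝ), K.entry (Sum.inl y) (Sum.inl x) * y ^ i = 0

variable {K}

theorem IsReproducing.integrable_mul_pow (h : K.IsReproducing) (p : ℝ ⊕ ℝ)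
    (hp : 0 < Sum.elim id id p) (i : ℕ) (hi : i < K.N) :
    IntegrableOn (fun y => K.entry (Sum.inl y) p * y ^ i) (Ioi 0) ∧
      ∫ y in Ioi (0 : ℝ), K.entry (Sum.inl y) p * y ^ i =
        Sum.elim (fun _ => 0) (fun x => 2 * x ^ i) p := by
  rcases p with x | x
  · exact ⟨h.integrable_entry x i hp hi, h.integral_entry x i hp hi⟩
  · have he : ∀ y, K.entry (Sum.inl y) (Sum.inr x) * y ^ i =
        ∑ l ∈ Finset.range K.N, x ^ l * (K.q l y * y ^ i) := fun y => by
      simp only [entry, Finset.sum_mul, mul_assoc]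
    have hint : ∀ l ∈ Finset.range K.N,
        IntegrableOn (fun y => x ^ l * (K.q l y * y ^ i)) (Ioi 0) := fun l hl =>
      (h.integrable_q l i (Finset.mem_range.1 hl) hi).const_mul _
    simp only [he]
    refine ⟨integrable_finsetSum _ hint, ?_⟩
    rw [integral_finsetSum _ hint]
    have : ∀ l ∈ Finset.range K.N, ∫ y in Ioi (0 : ℝ), x ^ l * (K.q l y * y ^ i) =
        if l = i then 2 * x ^ i else 0 := by
      intro l hl
      rw [integral_const_mul, h.integral_q l i (Finset.mem_range.1 hl) hi]
      split_ifs with hli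
      · rw [hli, mul_comm]
      · rw [mul_zero]
    rw [Finset.sum_congr rfl this, Finset.sum_ite_eq' _ i, if_pos (Finset.mem_range.2 hi)]
    rfl

/-- Entries from the second copy are polynomials of degree less than `N` in the point, so only
moments against such monomials are needed to integrate a product of entries. -/
theorem exists_entry_inr_eq (p : ℝ ⊕ ℝ) : ∃ b : ℕ → ℝ, ∀ y,
    K.entry (Sum.inr y) p = ∑ i ∈ Finset.range K.N, b i * y ^ i := by
  rcases p with x | x
  · refine ⟨fun i => -K.q i x, fun y => ?_⟩
    simp only [entry, ← Finset.sum_neg_distrib]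
    exact Finset.sum_congr rfl fun i _ => by ring
  · refine ⟨fun i => ∑ j ∈ Finset.range K.N, K.J i j * x ^ j, fun y => ?_⟩
    simp only [entry, Finset.sum_mul]
    exact Finset.sum_congr rfl fun i _ => Finset.sum_congr rfl fun j _ => by ring

/-- The kernel convolved with itself gives `0` or twice itself, according to the copy containing
`p`; this asymmetry is what makes the sum over permutations countable afterwards. -/
theorem IsReproducing.integral_mul (h : K.IsReproducing) (p p' : ℝ ⊕ ℝ)
    (hp : 0 < Sum.elim id id p) :
    IntegrableOn (fun y => K.entry (Sum.inl y) p * K.entry (Sum.inr y) p') (Ioi 0) ∧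
      ∫ y in Ioi (0 : ℝ), K.entry (Sum.inl y) p * K.entry (Sum.inr y) p' =
        Sum.elim (fun _ => 0) (fun _ => 2) p * K.entry p p' := by
  obtain ⟨b, hb⟩ := K.exists_entry_inr_eq p'
  have he : ∀ y, K.entry (Sum.inl y) p * K.entry (Sum.inr y) p' =
      ∑ i ∈ Finset.range K.N, b i * (K.entry (Sum.inl y) p * y ^ i) := fun y => by
    rw [hb, Finset.mul_sum]
    exact Finset.sum_congr rfl fun i _ => by ring
  have hint : ∀ i ∈ Finset.range K.N,
      IntegrableOn (fun y => b i * (K.entry (Sum.inl y) p * y ^ i)) (Ioi 0) := fun i hi =>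
    ((h.integrable_mul_pow p hp i (Finset.mem_range.1 hi)).1).const_mul _
  simp only [he]
  refine ⟨integrable_finsetSum _ hint, ?_⟩
  rw [integral_finsetSum _ hint]
  simp only [integral_const_mul]
  rw [Finset.sum_congr rfl fun i hi => by
    rw [(h.integrable_mul_pow p hp i (Finset.mem_range.1 hi)).2]]
  rcases p with x | x
  · simp
  · simp only [Sum.elim_inr, hb, Finset.mul_sum]
    exact Finset.sum_congr rfl fun i _ => by ring

theorem IsReproducing.integral_diag (h : K.IsReproducing) :
    IntegrableOn (fun y => K.entry (Sum.inl y) (Sum.inr y)) (Ioi 0) ∧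
      ∫ y in Ioi (0 : ℝ), K.entry (Sum.inl y) (Sum.inr y) = 2 * K.N := by
  have he : ∀ y, K.entry (Sum.inl y) (Sum.inr y) =
      ∑ l ∈ Finset.range K.N, K.q l y * y ^ l := fun y => by
    simp only [entry, mul_comm]
  have hint : ∀ l ∈ Finset.range K.N, IntegrableOn (fun y => K.q l y * y ^ l) (Ioi 0) :=
    fun l hl => h.integrable_q l l (Finset.mem_range.1 hl) (Finset.mem_range.1 hl)
  simp only [he]
  refine ⟨integrable_finsetSum _ hint, ?_⟩
  rw [integral_finsetSum _ hint, Finset.sum_congr rfl fun l hl => by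
    rw [h.integral_q l l (Finset.mem_range.1 hl) (Finset.mem_range.1 hl), if_pos rfl]]
  simp [mul_comm]

/-- Integration of one variable of a Pfaffian with a reproducing kernel. -/
theorem IsReproducing.integral_pfSum (h : K.IsReproducing) [Fintype ι] [DecidableEq ι]
    (z : ι → ℝ) (hz : ∀ i, 0 < z i) :
    IntegrableOn (fun y => pfSum (K.matrix fun o : Option ι => o.elim y z)) (Ioi 0) ∧
      ∫ y in Ioi (0 : ℝ), pfSum (K.matrix fun o : Option ι => o.elim y z) =
        2 * (Fintype.card ι + 1) * (2 * (K.N - Fintype.card ι)) * pfSum (K.matrix z) := by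
  set P : ι ⊕ ι → ℝ ⊕ ℝ := Sum.map z z with hP
  have hPpos : ∀ x, 0 < Sum.elim id id (P x) := by
    rintro (i | i) <;> exact hz i
  set w : ℝ ⊕ ℝ → ℝ := Sum.elim (fun _ => 0) (fun _ => 2) with hw
  set T : ℝ → Equiv.Perm (ι ⊕ ι) → ι → ℝ := fun y σ i =>
    (K.entry (Sum.inl y) (P (σ (Sum.inl i))) * K.entry (Sum.inr y) (P (σ (Sum.inr i))) -
      K.entry (Sum.inl y) (P (σ (Sum.inr i))) * K.entry (Sum.inr y) (P (σ (Sum.inl i)))) *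
      ∏ l ∈ Finset.univ.erase i, K.entry (P (σ (Sum.inl l))) (P (σ (Sum.inr l))) with hT
  have hexp : ∀ y, pfSum (K.matrix fun o : Option ι => o.elim y z) =
      (2 * (Fintype.card ι + 1) : ℕ) * (K.entry (Sum.inl y) (Sum.inr y) * pfSum (K.matrix z) -
        ∑ σ : Equiv.Perm (ι ⊕ ι), ((Equiv.Perm.sign σ : ℤ) : ℝ) * ∑ i, T y σ i) := by
    intro y
    rw [pfSum_option (K.matrix fun o : Option ι => o.elim y z) fun x x' => K.entry_skew _ _]
    have hmap : ∀ x : ι ⊕ ι, Sum.map (fun o : Option ι => o.elim y z) (fun o => o.elim y z)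
        (Sum.map some some x) = P x := by
      rintro (i | i) <;> rfl
    have hsub : (K.matrix fun o : Option ι => o.elim y z).submatrix (Sum.map some some)
        (Sum.map some some) = K.matrix z := by
      ext x x'
      simp only [Matrix.submatrix_apply, matrix, Matrix.of_apply, hmap, hP]
    rw [hsub]
    simp only [matrix, Matrix.of_apply, hmap, hT]
    rfl
  have hTint : ∀ σ i, IntegrableOn (fun y => T y σ i) (Ioi 0) ∧ ∫ y in Ioi (0 : ℝ), T y σ i =
      (w (P (σ (Sum.inl i))) + w (P (σ (Sum.inr i)))) *
        ∏ l, K.entry (P (σ (Sum.inl l))) (P (σ (Sum.inr l))) := by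
    intro σ i
    have h1 := h.integral_mul (P (σ (Sum.inl i))) (P (σ (Sum.inr i))) (hPpos _)
    have h2 := h.integral_mul (P (σ (Sum.inr i))) (P (σ (Sum.inl i))) (hPpos _)
    refine ⟨(h1.1.sub h2.1).mul_const _, ?_⟩
    simp only [hT]
    rw [integral_mul_const, integral_sub h1.1 h2.1, h1.2, h2.2,
      ← Finset.mul_prod_erase _ _ (Finset.mem_univ i),
      K.entry_skew (P (σ (Sum.inr i))) (P (σ (Sum.inl i)))]
    ring
  have hSint : ∀ σ : Equiv.Perm (ι ⊕ ι),
      IntegrableOn (fun y => ((Equiv.Perm.sign σ : ℤ) : ℝ) * ∑ i, T y σ i) (Ioi 0) ∧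
      ∫ y in Ioi (0 : ℝ), ((Equiv.Perm.sign σ : ℤ) : ℝ) * ∑ i, T y σ i =
        2 * Fintype.card ι * pfTerm (K.matrix z) σ := by
    intro σ
    refine ⟨(integrable_finsetSum _ fun i _ => (hTint σ i).1).const_mul _, ?_⟩
    rw [integral_const_mul, integral_finsetSum _ fun i _ => (hTint σ i).1,
      Finset.sum_congr rfl fun i _ => (hTint σ i).2, ← Finset.sum_mul]
    -- Exactly half of the `2 |ι|` indices lie in the second copy and each of them has weight `2`,
    -- whatever `σ` is. Against the diagonal contribution `2 N` this leaves `2 (N - |ι|)`.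
    have hsum : ∑ i, (w (P (σ (Sum.inl i))) + w (P (σ (Sum.inr i)))) = 2 * Fintype.card ι := by
      rw [Finset.sum_add_distrib, ← Fintype.sum_sum_type (fun x => w (P (σ x))),
        Equiv.sum_comp σ (fun x => w (P x)), Fintype.sum_sum_type]
      simp [hw, hP, mul_comm]
    rw [hsum]
    unfold pfTerm
    simp only [matrix, Matrix.of_apply, hP]
    ring
  simp only [hexp]
  refine ⟨((h.integral_diag.1.mul_const _).sub
    (integrable_finsetSum _ fun σ _ => (hSint σ).1)).const_mul _, ?_⟩
  rw [integral_const_mul, integral_sub (h.integral_diag.1.mul_const _)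
    (integrable_finsetSum _ fun σ _ => (hSint σ).1), integral_mul_const, h.integral_diag.2,
    integral_finsetSum _ fun σ _ => (hSint σ).1, Finset.sum_congr rfl fun σ _ => (hSint σ).2,
    ← Finset.mul_sum]
  unfold pfSum
  push_cast
  ring

end SkewKernel

end SkewKernels

/-! ### The generalised exponential integral: recurrence, growth at zero, Mellin and Stieltjes
transforms -/

section ExponentialIntegral

open Filter Topology

/-- The generalised exponential integral `∫₁^∞ r^(-β-1) e^(-x r) dr`. -/
def expInt (β x : ℝ) : ℝ := ∫ r in Ioi (1 : ℝ), r ^ (-β - 1) * Real.exp (-(x * r))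

theorem integrableOn_rpow_mul_exp_neg_Ioi_zero {p x : ℝ} (hp : -1 < p) (hx : 0 < x) :
    IntegrableOn (fun r : ℝ => r ^ p * Real.exp (-(x * r))) (Ioi 0) := by
  have := integrableOn_rpow_mul_exp_neg_mul_rpow hp one_pos hx
  simpa only [Real.rpow_one, neg_mul] using this

theorem integrableOn_rpow_mul_exp_neg_Ioi_one (p : ℝ) {x : ℝ} (hx : 0 < x) :
    IntegrableOn (fun r : ℝ => r ^ p * Real.exp (-(x * r))) (Ioi 1) := by
  have h1 : IntegrableOn (fun r : ℝ => r ^ |p| * Real.exp (-(x * r))) (Ioi 1) :=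
    (integrableOn_rpow_mul_exp_neg_Ioi_zero (by linarith [abs_nonneg p]) hx).mono_set
      (Ioi_subset_Ioi zero_le_one)
  refine Integrable.mono' h1 (by fun_prop) ?_
  filter_upwards [ae_restrict_mem measurableSet_Ioi] with r hr
  have hr' : (1 : ℝ) < r := hr
  rw [Real.norm_of_nonneg (mul_nonneg (Real.rpow_nonneg (by linarith) _) (Real.exp_nonneg _))]
  exact mul_le_mul_of_nonneg_right (Real.rpow_le_rpow_of_exponent_le hr'.le (le_abs_self p))
    (Real.exp_nonneg _)

theorem expInt_nonneg (β x : ℝ) : 0 ≤ expInt β x :=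
  setIntegral_nonneg measurableSet_Ioi fun r hr =>
    mul_nonneg (Real.rpow_nonneg (by linarith [mem_Ioi.1 hr]) _) (Real.exp_nonneg _)

theorem measurable_expInt (β : ℝ) : Measurable (expInt β) := by
  have h : StronglyMeasurable (Function.uncurry fun x r : ℝ =>
      r ^ (-β - 1) * Real.exp (-(x * r))) := by
    refine Measurable.stronglyMeasurable ?_
    fun_prop
  exact (h.integral_prod_right (ν := volume.restrict (Ioi (1 : ℝ)))).measurable

/-- Integration by parts: the derivative of `r^(-β) e^(-x r)` is integrated over `(1, ∞)`. -/
theorem mul_expInt_sub_one (β : ℝ) {x : ℝ} (hx : 0 < x) :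
    x * expInt (β - 1) x = Real.exp (-x) - β * expInt β x := by
  have hd : ∀ r ∈ Ici (1 : ℝ), HasDerivAt (fun r : ℝ => r ^ (-β) * Real.exp (-(x * r)))
      (-β * (r ^ (-β - 1) * Real.exp (-(x * r))) - x * (r ^ (-β) * Real.exp (-(x * r)))) r := by
    intro r hr
    have hr0 : r ≠ 0 := (lt_of_lt_of_le one_pos hr).ne'
    have h1 := Real.hasDerivAt_rpow_const (x := r) (p := -β) (Or.inl hr0)
    have h2 : HasDerivAt (fun r : ℝ => Real.exp (-(x * r))) (Real.exp (-(x * r)) * -x) r := by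
      have : HasDerivAt (fun r : ℝ => -(x * r)) (-x) r := by
        simpa using ((hasDerivAt_id r).const_mul x).fun_neg
      exact this.exp
    exact (h1.fun_mul h2).congr_deriv (by ring)
  have i1 := (integrableOn_rpow_mul_exp_neg_Ioi_one (-β - 1) hx).const_mul (-β)
  have i2 := (integrableOn_rpow_mul_exp_neg_Ioi_one (-β) hx).const_mul x
  have hlim : Tendsto (fun r : ℝ => r ^ (-β) * Real.exp (-(x * r))) atTop (𝓝 0) := by
    have := tendsto_rpow_mul_exp_neg_mul_atTop_nhds_zero (-β) x hx
    simpa only [neg_mul] using this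
  have := integral_Ioi_of_hasDerivAt_of_tendsto' hd (i1.sub i2) hlim
  rw [integral_sub i1 i2, integral_const_mul, integral_const_mul] at this
  have e : expInt (β - 1) x = ∫ r in Ioi (1 : ℝ), r ^ (-β) * Real.exp (-(x * r)) := by
    unfold expInt
    rw [show -(β - 1) - 1 = -β by ring]
  rw [e]
  unfold expInt
  simp only [Real.one_rpow, mul_one, one_mul] at this
  linarith

theorem hasDerivAt_expInt (β : ℝ) {x : ℝ} (hx : 0 < x) :
    HasDerivAt (expInt β) (-expInt (β - 1) x) x := by
  have h := hasDerivAt_integral_of_dominated_loc_of_deriv_le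
    (μ := volume.restrict (Ioi (1 : ℝ))) (s := Ioi (x / 2)) (x₀ := x)
    (F := fun x r : ℝ => r ^ (-β - 1) * Real.exp (-(x * r)))
    (F' := fun x r : ℝ => -(r ^ (-(β - 1) - 1) * Real.exp (-(x * r))))
    (bound := fun r : ℝ => r ^ (-(β - 1) - 1) * Real.exp (-(x / 2 * r)))
    (Ioi_mem_nhds (by linarith))
    (Eventually.of_forall fun y => by fun_prop)
    (integrableOn_rpow_mul_exp_neg_Ioi_one _ hx)
    (by fun_prop)
    (by
      filter_upwards [ae_restrict_mem measurableSet_Ioi] with r hr y hy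
      have hr' : (1 : ℝ) < r := hr
      have hy' : x / 2 < y := hy
      rw [norm_neg, Real.norm_of_nonneg
        (mul_nonneg (Real.rpow_nonneg (by linarith) _) (Real.exp_nonneg _))]
      gcongr)
    (integrableOn_rpow_mul_exp_neg_Ioi_one _ (by linarith))
    (by
      filter_upwards [ae_restrict_mem measurableSet_Ioi] with r hr y hy
      have hr' : (1 : ℝ) < r := hr
      have h2 : HasDerivAt (fun y : ℝ => Real.exp (-(y * r))) (Real.exp (-(y * r)) * -r) y := by
        have : HasDerivAt (fun y : ℝ => -(y * r)) (-r) y := by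
          simpa using ((hasDerivAt_id y).mul_const r).fun_neg
        exact this.exp
      refine (h2.const_mul (r ^ (-β - 1))).congr_deriv ?_
      rw [show -(β - 1) - 1 = (-β - 1) + 1 by ring, Real.rpow_add_one (by linarith)]
      ring)
  refine h.2.congr_deriv ?_
  rw [integral_neg]
  rfl

/-- By the recurrence the Euler operator `t d/dt` returns the same function up to an exponential.
This is what gives the integrals over `t` in the kernels elementary primitives. -/
theorem hasDerivAt_expInt_mul (β : ℝ) {x t : ℝ} (hx : 0 < x) (ht : 0 < t) :
    HasDerivAt (fun t => expInt β (t * x)) ((β * expInt β (t * x) - Real.exp (-(t * x))) / t) t := by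
  have h1 : HasDerivAt (fun t : ℝ => t * x) x t := by simpa using (hasDerivAt_id t).mul_const x
  have h2 := (hasDerivAt_expInt β (mul_pos ht hx)).comp t h1
  refine h2.congr_deriv ?_
  have := mul_expInt_sub_one β (mul_pos ht hx)
  field_simp
  linarith

theorem exists_expInt_le {β δ : ℝ} (hδ : 0 < δ) (hβ : -β < δ) :
    ∃ C, 0 ≤ C ∧ ∀ x, 0 < x → expInt β x ≤ C * x ^ (-δ) := by
  refine ⟨δ ^ δ * ∫ r in Ioi (1 : ℝ), r ^ (-β - 1 - δ), mul_nonneg (Real.rpow_nonneg hδ.le _)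
    (setIntegral_nonneg measurableSet_Ioi fun r hr =>
      Real.rpow_nonneg (by linarith [mem_Ioi.1 hr]) _), fun x hx => ?_⟩
  -- From `u / δ ≤ e^(u / δ)`, raised to the power `δ`.
  have hexp : ∀ u : ℝ, 0 < u → Real.exp (-u) ≤ δ ^ δ * u ^ (-δ) := by
    intro u hu
    have h1 : u / δ ≤ Real.exp (u / δ) := by linarith [Real.add_one_le_exp (u / δ)]
    have h2 := Real.rpow_le_rpow (by positivity) h1 hδ.le
    rw [← Real.exp_mul, div_mul_cancel₀ _ hδ.ne', Real.div_rpow hu.le hδ.le] at h2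
    rw [Real.exp_neg, Real.rpow_neg hu.le, ← div_eq_mul_inv]
    rw [inv_le_comm₀ (Real.exp_pos _) (by positivity), inv_div]
    exact h2
  have hint : IntegrableOn (fun r : ℝ => δ ^ δ * x ^ (-δ) * r ^ (-β - 1 - δ)) (Ioi 1) :=
    (integrableOn_Ioi_rpow_of_lt (by linarith) one_pos).const_mul _
  calc expInt β x ≤ ∫ r in Ioi (1 : ℝ), δ ^ δ * x ^ (-δ) * r ^ (-β - 1 - δ) := by
        refine setIntegral_mono_on (integrableOn_rpow_mul_exp_neg_Ioi_one _ hx) hint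
          measurableSet_Ioi fun r hr => ?_
        have hr0 : (0 : ℝ) < r := by linarith [mem_Ioi.1 hr]
        calc r ^ (-β - 1) * Real.exp (-(x * r)) ≤ r ^ (-β - 1) * (δ ^ δ * (x * r) ^ (-δ)) := by
              gcongr
              exact hexp _ (by positivity)
          _ = _ := by
              rw [Real.mul_rpow hx.le hr0.le, show -β - 1 - δ = (-β - 1) + -δ by ring,
                Real.rpow_add hr0]
              ring
    _ = _ := by rw [integral_const_mul]; ring

theorem norm_cpow_ofReal_mul {x : ℝ} (hx : 0 < x) (u : ℂ) (r : ℝ) :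
    ‖(x : ℂ) ^ u * (r : ℂ)‖ = x ^ u.re * |r| := by
  rw [norm_mul, Complex.norm_cpow_eq_rpow_re_of_pos hx, Complex.norm_real, Real.norm_eq_abs]

/-- Tonelli: integrating the modulus over `x` gives `Γ(Re u) r^(-β - 1 - Re u)`, which is integrable
at infinity because `Re u + β > 0`. -/
theorem integrable_cpow_mul_expKernel {β : ℝ} {u : ℂ} (hu : 0 < u.re) (huβ : 0 < u.re + β) :
    Integrable (Function.uncurry fun x r : ℝ =>
      (x : ℂ) ^ (u - 1) * ((r ^ (-β - 1) * Real.exp (-(x * r)) : ℝ) : ℂ))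
      ((volume.restrict (Ioi 0)).prod (volume.restrict (Ioi 1))) := by
  have hre : -1 < (u - 1).re := by simpa using hu
  have hmeas : Measurable (Function.uncurry fun x r : ℝ =>
      (x : ℂ) ^ (u - 1) * ((r ^ (-β - 1) * Real.exp (-(x * r)) : ℝ) : ℂ)) := by
    refine Measurable.mul ?_ ?_
    · exact (Complex.measurable_ofReal.comp measurable_fst).pow_const _
    · refine Complex.measurable_ofReal.comp ?_
      fun_prop
  rw [integrable_prod_iff' hmeas.aestronglyMeasurable]
  have hnorm : ∀ r : ℝ, 1 < r → ∀ x : ℝ, 0 < x →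
      ‖(x : ℂ) ^ (u - 1) * ((r ^ (-β - 1) * Real.exp (-(x * r)) : ℝ) : ℂ)‖ =
      r ^ (-β - 1) * (x ^ (u.re - 1) * Real.exp (-(r * x))) := by
    intro r hr x hx
    rw [norm_cpow_ofReal_mul hx, abs_of_nonneg
      (mul_nonneg (Real.rpow_nonneg (by linarith) _) (Real.exp_nonneg _)), mul_comm x r]
    simp only [Complex.sub_re, Complex.one_re]
    ring
  constructor
  · filter_upwards [ae_restrict_mem measurableSet_Ioi] with r hr
    have hr' : (1 : ℝ) < r := hr
    have hi := (integrableOn_rpow_mul_exp_neg_Ioi_zero (p := u.re - 1) (by linarith)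
      (by linarith : (0 : ℝ) < r)).const_mul (r ^ (-β - 1))
    refine Integrable.mono' hi (hmeas.of_uncurry_right.aestronglyMeasurable) ?_
    filter_upwards [ae_restrict_mem measurableSet_Ioi] with x hx
    exact (hnorm r hr' x hx).le
  · have hi : IntegrableOn (fun r : ℝ => Real.Gamma u.re * r ^ (-β - 1 - u.re)) (Ioi 1) :=
      (integrableOn_Ioi_rpow_of_lt (by linarith) one_pos).const_mul _
    refine hi.congr ?_
    filter_upwards [ae_restrict_mem measurableSet_Ioi] with r hr
    have hr' : (1 : ℝ) < r := hr
    simp only [Function.uncurry]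
    rw [setIntegral_congr_fun measurableSet_Ioi fun x hx => hnorm r hr' x hx, integral_const_mul,
      Real.integral_rpow_mul_exp_neg_mul_Ioi hu (by linarith), one_div, Real.inv_rpow (by linarith),
      ← Real.rpow_neg (by linarith), sub_eq_add_neg (-β - 1), Real.rpow_add (by linarith)]
    ring

/-- After exchanging the integrals, the one over `x` gives `Γ(u) r^(-u)` and the one over `r` gives
`1 / (u + β)`. Simple poles of a Mellin transform thus correspond to exponential integrals. -/
theorem mellin_expInt {β : ℝ} {u : ℂ} (hu : 0 < u.re) (huβ : 0 < u.re + β) :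
    MellinConvergent (fun x => (expInt β x : ℂ)) u ∧
      mellin (fun x => (expInt β x : ℂ)) u = Complex.Gamma u / (u + β) := by
  have hI := integrable_cpow_mul_expKernel hu huβ
  have hin : ∀ x : ℝ, (x : ℂ) ^ (u - 1) • (expInt β x : ℂ) = ∫ r in Ioi (1 : ℝ),
      (x : ℂ) ^ (u - 1) * ((r ^ (-β - 1) * Real.exp (-(x * r)) : ℝ) : ℂ) := by
    intro x
    rw [integral_const_mul, integral_complex_ofReal]
    rfl
  constructor
  · unfold MellinConvergent
    simp only [hin]
    exact hI.integral_prod_left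
  · unfold mellin
    simp only [hin]
    rw [integral_integral_swap hI]
    have h1 : ∀ r ∈ Ioi (1 : ℝ), ∫ x in Ioi (0 : ℝ),
        (x : ℂ) ^ (u - 1) * ((r ^ (-β - 1) * Real.exp (-(x * r)) : ℝ) : ℂ) =
        Complex.Gamma u * (r : ℂ) ^ (-β - 1 - u) := by
      intro r hr
      have hr0 : (0 : ℝ) < r := by linarith [mem_Ioi.1 hr]
      have e : ∀ x : ℝ, (x : ℂ) ^ (u - 1) * ((r ^ (-β - 1) * Real.exp (-(x * r)) : ℝ) : ℂ) =
          ((r ^ (-β - 1) : ℝ) : ℂ) * ((x : ℂ) ^ (u - 1) * Complex.exp (-(r * x))) := by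
        intro x
        push_cast
        rw [mul_comm (x : ℂ) r]
        ring
      simp only [e]
      rw [integral_const_mul, Complex.integral_cpow_mul_exp_neg_mul_Ioi hu hr0,
        Complex.ofReal_cpow hr0.le, one_div, Complex.inv_cpow_eq_ite, if_neg, sub_eq_add_neg _ u,
        Complex.cpow_add _ _ (by exact_mod_cast hr0.ne'), Complex.cpow_neg]
      · push_cast
        ring
      · rw [Complex.arg_ofReal_of_nonneg hr0.le]
        exact Real.pi_pos.ne
    rw [setIntegral_congr_fun measurableSet_Ioi h1, integral_const_mul,
      integral_Ioi_cpow_of_lt (by simp; linarith) one_pos]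
    rw [Complex.ofReal_one, Complex.one_cpow, show (-β - 1 - u + 1 : ℂ) = -(u + β) by ring,
      neg_div_neg_eq, mul_one_div]

theorem integral_rpow_mul_expInt {β u : ℝ} (hu : 0 < u) (huβ : 0 < u + β) :
    IntegrableOn (fun x => x ^ (u - 1) * expInt β x) (Ioi 0) ∧
      ∫ x in Ioi (0 : ℝ), x ^ (u - 1) * expInt β x = Real.Gamma u / (u + β) := by
  have h := mellin_expInt (β := β) (u := u) (by simpa using hu) (by simpa using huβ)
  have e : ∀ x ∈ Ioi (0 : ℝ), (x : ℂ) ^ ((u : ℂ) - 1) • (expInt β x : ℂ) =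
      ((x ^ (u - 1) * expInt β x : ℝ) : ℂ) := by
    intro x hx
    have hx0 : 0 < x := hx
    rw [Complex.ofReal_mul, Complex.ofReal_cpow hx0.le]
    push_cast
    rfl
  have h1 : IntegrableOn (fun x => ((x ^ (u - 1) * expInt β x : ℝ) : ℂ)) (Ioi 0) :=
    IntegrableOn.congr_fun h.1 e measurableSet_Ioi
  constructor
  · have := h1.re
    simpa [IntegrableOn] using this
  · have h2 := h.2
    unfold mellin at h2
    rw [setIntegral_congr_fun measurableSet_Ioi e, integral_complex_ofReal, Complex.Gamma_ofReal] at h2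
    exact_mod_cast h2

/-- Write `e^(-(x + y)) / (x + y)` as the integral of `e^(-(x + y) r)` over `r > 1` and integrate
over `y` first. -/
theorem integral_stieltjes {β x : ℝ} (hβ : -1 < β) (hx : 0 < x) :
    IntegrableOn (fun y => y ^ β * Real.exp (-y) / (x + y)) (Ioi 0) ∧
    ∫ y in Ioi (0 : ℝ), y ^ β * Real.exp (-y) / (x + y) =
      Real.Gamma (β + 1) * (Real.exp x * expInt β x) := by
  have hint0 : IntegrableOn (fun y : ℝ => y ^ β * Real.exp (-y)) (Ioi 0) := by
    simpa only [one_mul] using integrableOn_rpow_mul_exp_neg_Ioi_zero hβ one_pos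
  have hint1 : IntegrableOn (fun y => y ^ β * Real.exp (-y) / (x + y)) (Ioi 0) := by
    refine Integrable.mono' (hint0.const_mul x⁻¹) (by
      refine Measurable.aestronglyMeasurable ?_
      fun_prop) ?_
    filter_upwards [ae_restrict_mem measurableSet_Ioi] with y hy
    have hy0 : 0 < y := hy
    rw [Real.norm_of_nonneg (by positivity), div_eq_inv_mul]
    gcongr
    linarith
  refine ⟨hint1, ?_⟩
  have hinner : ∀ y ∈ Ioi (0 : ℝ), ∫ r in Ioi (1 : ℝ), y ^ β * Real.exp (-((x + y) * r)) =
      y ^ β * (Real.exp (-(x + y)) / (x + y)) := by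
    intro y hy
    have hy0 : 0 < y := hy
    have := integral_exp_mul_Ioi (a := -(x + y)) (by linarith) 1
    rw [integral_const_mul]
    simp only [← neg_mul]
    rw [this]
    congr 1
    rw [mul_one, neg_div_neg_eq]
  have hI : Integrable (Function.uncurry fun y r : ℝ => y ^ β * Real.exp (-((x + y) * r)))
      ((volume.restrict (Ioi 0)).prod (volume.restrict (Ioi 1))) := by
    rw [integrable_prod_iff (by
      refine Measurable.aestronglyMeasurable ?_
      fun_prop)]
    constructor
    · filter_upwards [ae_restrict_mem measurableSet_Ioi] with y hy
      have hy0 : 0 < y := hy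
      have := (integrableOn_exp_mul_Ioi (a := -(x + y)) (by linarith) 1).const_mul (y ^ β)
      simpa only [Function.uncurry, neg_mul] using this
    · have := hint1.const_mul (Real.exp (-x))
      refine this.congr ?_
      filter_upwards [ae_restrict_mem measurableSet_Ioi] with y hy
      have hy0 : 0 < y := hy
      have : ∀ r : ℝ, ‖y ^ β * Real.exp (-((x + y) * r))‖ = y ^ β * Real.exp (-((x + y) * r)) :=
        fun r => Real.norm_of_nonneg (by positivity)
      simp only [Function.uncurry, this]
      rw [hinner y hy, neg_add, Real.exp_add]
      ring
  have h1 : ∫ y in Ioi (0 : ℝ), y ^ β * Real.exp (-y) / (x + y) =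
      Real.exp x * ∫ y in Ioi (0 : ℝ), ∫ r in Ioi (1 : ℝ), y ^ β * Real.exp (-((x + y) * r)) := by
    rw [← integral_const_mul]
    refine setIntegral_congr_fun measurableSet_Ioi fun y hy => ?_
    simp only [hinner y hy]
    rw [neg_add, Real.exp_add]
    have : Real.exp x * Real.exp (-x) = 1 := by rw [← Real.exp_add, add_neg_cancel, Real.exp_zero]
    linear_combination (-(y ^ β * Real.exp (-y) / (x + y))) * this
  rw [h1, integral_integral_swap hI]
  have h2 : ∀ r ∈ Ioi (1 : ℝ), ∫ y in Ioi (0 : ℝ), y ^ β * Real.exp (-((x + y) * r)) =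
      Real.Gamma (β + 1) * (r ^ (-β - 1) * Real.exp (-(x * r))) := by
    intro r hr
    have hr0 : (0 : ℝ) < r := by linarith [mem_Ioi.1 hr]
    have e : ∀ y : ℝ, y ^ β * Real.exp (-((x + y) * r)) =
        Real.exp (-(x * r)) * (y ^ (β + 1 - 1) * Real.exp (-(r * y))) := by
      intro y
      rw [add_sub_cancel_right, mul_left_comm, ← Real.exp_add]
      congr 2
      ring
    simp only [e]
    rw [integral_const_mul, Real.integral_rpow_mul_exp_neg_mul_Ioi (by linarith) hr0, one_div,
      Real.inv_rpow hr0.le, ← Real.rpow_neg hr0.le, show -(β + 1) = -β - 1 by ring]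
    ring
  rw [setIntegral_congr_fun measurableSet_Ioi h2, integral_const_mul]
  unfold expInt
  ring

end ExponentialIntegral

/-! ### Partial fractions and the identities for the coefficients `rho` -/

section PartialFractions

open Polynomial in
/-- Partial fractions for the nodes `β, β + 1, …, β + N - 1`. -/
theorem eval_div_prod_eq_sum {F : Type*} [Field F] [CharZero F] {N : ℕ} (β : F) (P : F[X])
    (hP : P.degree < N) (s : F) (hs : ∀ j < N, s ≠ β + j) :
    P.eval s / ∏ j ∈ Finset.range N, (β + j - s) = ∑ j ∈ Finset.range N,
      P.eval (β + j) / (∏ l ∈ (Finset.range N).erase j, ((l : F) - j)) / (β + j - s) := by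
  have hinj : Set.InjOn (fun j : ℕ => β + (j : F)) (Finset.range N) := by
    intro i _ j _ hij
    exact_mod_cast add_left_cancel hij
  have h1 := Lagrange.eq_interpolate hinj (f := P) (by simpa using hP)
  have h2 := Lagrange.eval_interpolate_not_at_node (s := Finset.range N)
    (v := fun j : ℕ => β + (j : F)) (r := fun j => P.eval (β + j)) (x := s)
    (fun j hj => hs j (Finset.mem_range.1 hj))
  rw [← h1, Lagrange.eval_nodal] at h2
  have hne : ∏ j ∈ Finset.range N, (β + j - s) ≠ 0 := Finset.prod_ne_zero_iff.2 fun j hj =>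
    sub_ne_zero.2 (hs j (Finset.mem_range.1 hj)).symm
  rw [div_eq_iff hne, h2]
  have h3 : ∏ j ∈ Finset.range N, (s - (β + j)) =
      (-1) ^ N * ∏ j ∈ Finset.range N, (β + j - s) := by
    rw [← Finset.card_range N, ← Finset.prod_const, Finset.card_range, ← Finset.prod_mul_distrib]
    exact Finset.prod_congr rfl fun j _ => by ring
  rw [h3, mul_right_comm]
  congr 1
  rw [Finset.mul_sum]
  refine Finset.sum_congr rfl fun j hj => ?_
  have h4 : ∏ l ∈ (Finset.range N).erase j, ((l : F) - j) =
      -(-1) ^ N * ∏ l ∈ (Finset.range N).erase j, ((β + j) - (β + l)) := by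
    have hc : ((Finset.range N).erase j).card + 1 = N := by
      rw [Finset.card_erase_add_one hj, Finset.card_range]
    have : -(-1 : F) ^ N = (-1) ^ ((Finset.range N).erase j).card := by
      conv_lhs => rw [← hc]
      ring
    rw [this, ← Finset.prod_const, ← Finset.prod_mul_distrib]
    exact Finset.prod_congr rfl fun l _ => by ring
  have h5 : Lagrange.nodalWeight (Finset.range N) (fun j : ℕ => β + (j : F)) j =
      (∏ l ∈ (Finset.range N).erase j, ((β + j) - (β + l)))⁻¹ := by
    rw [Lagrange.nodalWeight, Finset.prod_inv_distrib]
  have h6 : ((-1 : F) ^ N)⁻¹ = (-1) ^ N := by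
    rw [← inv_pow, inv_neg_one]
  rw [h4, h5, div_eq_mul_inv, div_eq_mul_inv, mul_inv, inv_neg, h6, ← neg_sub s, inv_neg]
  ring

open Polynomial in
-- Numerator and denominator have the same degree. Subtracting from the numerator the monic
-- polynomial `Q` with the nodes as roots lowers its degree without changing its values there; `Q`
-- itself contributes `(-1)^N`.
theorem prod_div_prod_eq_add_sum {F : Type*} [Field F] [CharZero F] (N : ℕ) (α β s : F)
    (hs : ∀ j < N, s ≠ β + j) :
    (∏ l ∈ Finset.range N, (α + 1 + l + s)) / ∏ j ∈ Finset.range N, (β + j - s) = (-1) ^ N +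
      ∑ j ∈ Finset.range N, (∏ l ∈ Finset.range N, (α + β + 1 + j + l)) /
        (∏ l ∈ (Finset.range N).erase j, ((l : F) - j)) / (β + j - s) := by
  set P : F[X] := ∏ l ∈ Finset.range N, (X + C (α + 1 + l)) with hP
  set Q : F[X] := ∏ l ∈ Finset.range N, (X - C (β + l)) with hQ
  have hPm : P.Monic := monic_prod_of_monic _ _ fun l _ => monic_X_add_C _
  have hQm : Q.Monic := monic_prod_of_monic _ _ fun l _ => monic_X_sub_C _
  have hPd : P.degree = N := by
    rw [hP, degree_prod]
    simp only [degree_X_add_C]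
    simp
  have hQd : Q.degree = N := by
    rw [hQ, degree_prod]
    simp only [degree_X_sub_C]
    simp
  have hdeg : (P - Q).degree < N := by
    rw [← hPd]
    exact degree_sub_lt_left (by rw [hPd, hQd]) hPm.ne_zero
      (by rw [hPm.leadingCoeff, hQm.leadingCoeff])
  have h := eval_div_prod_eq_sum β (P - Q) hdeg s hs
  have hPe : ∀ x, P.eval x = ∏ l ∈ Finset.range N, (α + 1 + l + x) := by
    intro x
    rw [hP, eval_prod]
    exact Finset.prod_congr rfl fun l _ => by simp [add_comm]
  have hQe : ∀ x, Q.eval x = ∏ l ∈ Finset.range N, (x - (β + l)) := by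
    intro x
    rw [hQ, eval_prod]
    simp
  have hQ0 : ∀ j ∈ Finset.range N, Q.eval (β + j) = 0 := by
    intro j hj
    rw [hQe]
    exact Finset.prod_eq_zero hj (by ring)
  have hQs : Q.eval s = (-1) ^ N * ∏ j ∈ Finset.range N, (β + j - s) := by
    rw [hQe]
    rw [← Finset.card_range N, ← Finset.prod_const, Finset.card_range, ← Finset.prod_mul_distrib]
    exact Finset.prod_congr rfl fun j _ => by ring
  have hne : ∏ j ∈ Finset.range N, (β + j - s) ≠ 0 := Finset.prod_ne_zero_iff.2 fun j hj =>
    sub_ne_zero.2 (hs j (Finset.mem_range.1 hj)).symm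
  rw [eval_sub, hQs, hPe, sub_div, mul_div_cancel_right₀ _ hne, sub_eq_iff_eq_add] at h
  rw [h, add_comm]
  congr 1
  refine Finset.sum_congr rfl fun j hj => ?_
  rw [eval_sub, hQ0 j hj, sub_zero, hPe]
  congr 2
  exact Finset.prod_congr rfl fun l _ => by ring

/-- The coefficients `ρ_j` of the partial fraction expansions (zero for `j ≥ N`). -/
def rho (N : ℕ) (κ : ℝ) (j : ℕ) : ℝ :=
  if j < N then (∏ l ∈ Finset.range N, (κ + j + l)) /
    ∏ l ∈ (Finset.range N).erase j, ((l : ℝ) - j) else 0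

theorem rho_of_le {N j : ℕ} (κ : ℝ) (h : N ≤ j) : rho N κ j = 0 := if_neg (by omega)

theorem ofReal_rho {N j : ℕ} (κ : ℝ) (h : j ∈ Finset.range N) : ((rho N κ j : ℝ) : ℂ) =
    (∏ l ∈ Finset.range N, ((κ : ℂ) + j + l)) / ∏ l ∈ (Finset.range N).erase j, ((l : ℂ) - j) := by
  rw [rho, if_pos (Finset.mem_range.1 h)]
  push_cast
  rfl

theorem prod_div_prod_eq_sum_rho (N : ℕ) (α β : ℝ) (s : ℂ) (hs : ∀ j < N, s ≠ (β : ℂ) + j) :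
    (∏ l ∈ Finset.range N, ((α : ℂ) + 1 + l + s)) / ∏ j ∈ Finset.range N, ((β : ℂ) + j - s) =
      (-1) ^ N + ∑ j ∈ Finset.range N, (rho N (α + β + 1) j : ℂ) / (β + j - s) := by
  rw [prod_div_prod_eq_add_sum N (α : ℂ) β s hs]
  congr 1
  refine Finset.sum_congr rfl fun j hj => ?_
  rw [ofReal_rho _ hj]
  push_cast
  rfl

/-- The partial fraction expansion with nodes `0, …, N - 1` is evaluated at `s = -κ - i`, a zero of
the numerator. -/
theorem sum_rho_div {N i : ℕ} (hi : i < N) {κ : ℝ} (hκ : 0 < κ) :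
    ∑ j ∈ Finset.range N, rho N κ j / (κ + i + j) = -(-1) ^ N := by
  have h := prod_div_prod_eq_add_sum N (κ - 1) 0 (-κ - i : ℝ) (fun j _ h => by
    have : (0 : ℝ) < κ + i + j := by positivity
    linarith)
  have h0 : ∏ l ∈ Finset.range N, (κ - 1 + 1 + l + (-κ - i)) = 0 :=
    Finset.prod_eq_zero (Finset.mem_range.2 hi) (by ring)
  rw [h0, zero_div] at h
  have : ∑ j ∈ Finset.range N, rho N κ j / (κ + i + j) =
      ∑ j ∈ Finset.range N, (∏ l ∈ Finset.range N, (κ - 1 + 0 + 1 + j + l)) /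
        (∏ l ∈ (Finset.range N).erase j, ((l : ℝ) - j)) / (0 + j - (-κ - i)) := by
    refine Finset.sum_congr rfl fun j hj => ?_
    rw [rho, if_pos (Finset.mem_range.1 hj)]
    congr 1
    · congr 1
      exact Finset.prod_congr rfl fun l _ => by ring
    · ring
  rw [this]
  linarith

open Polynomial in
-- This inverts the Cauchy matrix `1 / (κ + j + m)`. Dividing `ρ_j` by `1 / (κ + i + j)`'s
-- reciprocal, that is by `κ + i + j`, removes the factor of index `i` from its numerator; the sum
-- is then the expansion of the shortened quotient at `s = -κ - m`, which is zero there unless `m =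
-- i`.
theorem sum_rho_mul_rho {N i m : ℕ} (hi : i < N) (hm : m < N) {κ : ℝ} (hκ : 0 < κ) :
    ∑ j ∈ Finset.range N, rho N κ i * rho N κ j / ((κ + i + j) * (κ + m + j)) =
      if i = m then 1 else 0 := by
  have hi' := Finset.mem_range.2 hi
  have hm' := Finset.mem_range.2 hm
  set P : ℝ[X] := ∏ l ∈ (Finset.range N).erase i, (X + C (κ + l)) with hP
  have hPd : P.degree < N := by
    rw [hP, degree_prod]
    simp only [degree_X_add_C, Finset.sum_const, Finset.card_erase_of_mem hi', Finset.card_range]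
    rw [nsmul_one]
    exact_mod_cast (by omega : N - 1 < N)
  have h := eval_div_prod_eq_sum 0 P hPd (-κ - m : ℝ) (fun j _ h => by
    have : (0 : ℝ) < κ + m + j := by positivity
    linarith)
  have hPe : ∀ x, P.eval x = ∏ l ∈ (Finset.range N).erase i, (κ + l + x) := by
    intro x
    rw [hP, eval_prod]
    exact Finset.prod_congr rfl fun l _ => by simp [add_comm]
  have hsum : ∑ j ∈ Finset.range N, rho N κ i * rho N κ j / ((κ + i + j) * (κ + m + j)) =
      rho N κ i * ∑ j ∈ Finset.range N, P.eval (0 + (j : ℝ)) /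
        (∏ l ∈ (Finset.range N).erase j, ((l : ℝ) - j)) / (0 + j - (-κ - m)) := by
    rw [Finset.mul_sum]
    refine Finset.sum_congr rfl fun j hj => ?_
    have hpos : 0 < κ + i + j := by positivity
    have hnum : ∏ l ∈ Finset.range N, (κ + j + l) = (κ + i + j) * P.eval (0 + (j : ℝ)) := by
      rw [← Finset.mul_prod_erase _ _ hi', hPe]
      congr 1
      · ring
      · exact Finset.prod_congr rfl fun l _ => by ring
    have hrj : rho N κ j = (κ + i + j) * P.eval (0 + (j : ℝ)) /
        ∏ l ∈ (Finset.range N).erase j, ((l : ℝ) - j) := by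
      rw [rho, if_pos (Finset.mem_range.1 hj), hnum]
    rw [hrj, show (0 + (j : ℝ) - (-κ - m)) = κ + m + j by ring, mul_div_assoc, mul_div_assoc,
      mul_div_mul_left _ _ hpos.ne']
  rw [hsum, ← h, hPe]
  split_ifs with him
  · subst him
    rw [rho, if_pos hi]
    have e1 : ∏ l ∈ (Finset.range N).erase i, (κ + l + (-κ - i)) =
        ∏ l ∈ (Finset.range N).erase i, ((l : ℝ) - i) :=
      Finset.prod_congr rfl fun l _ => by ring
    have e2 : ∏ j ∈ Finset.range N, (0 + (j : ℝ) - (-κ - i)) =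
        ∏ l ∈ Finset.range N, (κ + i + l) := Finset.prod_congr rfl fun l _ => by ring
    rw [e1, e2, div_mul_div_comm, mul_comm]
    refine div_self (mul_ne_zero ?_ ?_)
    · refine Finset.prod_ne_zero_iff.2 fun l hl => sub_ne_zero.2 ?_
      exact_mod_cast Finset.ne_of_mem_erase hl
    · exact Finset.prod_ne_zero_iff.2 fun l _ => by positivity
  · rw [Finset.prod_eq_zero (Finset.mem_erase.2 ⟨fun h => him h.symm, hm'⟩) (by ring), zero_div,
      mul_zero]

end PartialFractions

/-! ### The functions `G^{2,1}_{2,3}` by Mellin inversion -/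

section MeijerVertical

open Filter Topology

/-- The value of the Meijer G-functions `G^{2,1}_{2,3}` which occur in the kernels. -/
def meijerH (N : ℕ) (a b x : ℝ) : ℝ :=
  (-1) ^ N * Real.exp (-x) + ∑ j ∈ Finset.range N, rho N (a + b + 1) j * expInt (b + j) x

/-- The rational factor of the Mellin transform of `meijerH`. -/
def meijerRat (N : ℕ) (a b : ℝ) (s : ℂ) : ℂ :=
  (-1) ^ N + ∑ j ∈ Finset.range N, (rho N (a + b + 1) j : ℂ) / (b + j - s)

theorem Gamma_add_natCast_eq_prod (N : ℕ) (z : ℂ) (hz : ∀ l < N, z + l ≠ 0) :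
    Complex.Gamma (z + N) = (∏ l ∈ Finset.range N, (z + l)) * Complex.Gamma z := by
  induction N with
  | zero => simp
  | succ N ih =>
    rw [Finset.prod_range_succ, Nat.cast_succ, ← add_assoc, Complex.Gamma_add_one _ (hz N (by omega)),
      ih fun l hl => hz l (by omega)]
    ring

theorem norm_Gamma_le_Gamma_re {s : ℂ} (hs : 0 < s.re) : ‖Complex.Gamma s‖ ≤ Real.Gamma s.re := by
  rw [Complex.Gamma_eq_integral hs, Real.Gamma_eq_integral hs, Complex.GammaIntegral]
  refine (norm_integral_le_integral_norm _).trans_eq ?_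
  refine setIntegral_congr_fun measurableSet_Ioi fun x hx => ?_
  have hx0 : 0 < x := hx
  simp only [norm_mul, Complex.norm_real, Complex.norm_cpow_eq_rpow_re_of_pos hx0, Real.norm_eq_abs,
    abs_of_pos (Real.exp_pos _), Complex.sub_re, Complex.one_re]

/-- `Γ(u) = Γ(u + 2) / (u (u + 1))` with `Γ(u + 2)` bounded on the line. Quadratic decay is all that
integrability along the contour requires. -/
theorem norm_Gamma_vertical_le {σ : ℝ} (hσ : 0 < σ) (y : ℝ) :
    ‖Complex.Gamma (σ + y * Complex.I)‖ ≤ Real.Gamma (σ + 2) / min (σ ^ 2) 1 * (1 + y ^ 2)⁻¹ := by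
  set u : ℂ := σ + y * Complex.I with hu
  have hure : u.re = σ := by simp [hu]
  have huim : u.im = y := by simp [hu]
  have hu0 : u ≠ 0 := fun h => by rw [h] at hure; simp at hure; linarith
  have hu1 : u + 1 ≠ 0 := fun h => by
    have := congrArg Complex.re h
    simp [hure] at this
    linarith
  have h1 : Complex.Gamma (u + 2) = (u + 1) * (u * Complex.Gamma u) := by
    rw [← Complex.Gamma_add_one u hu0, ← Complex.Gamma_add_one _ hu1]
    congr 1
    ring
  have h2 : ‖Complex.Gamma (u + 2)‖ ≤ Real.Gamma (σ + 2) := by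
    have := norm_Gamma_le_Gamma_re (s := u + 2) (by simp [hure]; linarith)
    simpa [hure] using this
  have h3 : ‖u‖ ^ 2 = σ ^ 2 + y ^ 2 := by
    rw [Complex.sq_norm, Complex.normSq_apply, hure, huim]
    ring
  have h4 : ‖u‖ ≤ ‖u + 1‖ := by
    rw [← sq_le_sq₀ (norm_nonneg _) (norm_nonneg _), h3, Complex.sq_norm, Complex.normSq_apply]
    simp only [Complex.add_re, Complex.one_re, Complex.add_im, Complex.one_im, hure, huim]
    nlinarith
  have h5 : min (σ ^ 2) 1 * (1 + y ^ 2) ≤ ‖u‖ * ‖u + 1‖ := by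
    calc min (σ ^ 2) 1 * (1 + y ^ 2) ≤ σ ^ 2 + y ^ 2 := by
          nlinarith [min_le_left (σ ^ 2) 1, min_le_right (σ ^ 2) 1, sq_nonneg y]
      _ = ‖u‖ * ‖u‖ := by rw [← h3, sq]
      _ ≤ _ := by gcongr
  have hm : 0 < min (σ ^ 2) 1 := by positivity
  rw [h1, norm_mul, norm_mul] at h2
  rw [div_mul_eq_mul_div, le_div_iff₀ hm, ← div_eq_mul_inv, le_div_iff₀ (by positivity)]
  calc ‖Complex.Gamma u‖ * min (σ ^ 2) 1 * (1 + y ^ 2)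
      = min (σ ^ 2) 1 * (1 + y ^ 2) * ‖Complex.Gamma u‖ := by ring
    _ ≤ ‖u‖ * ‖u + 1‖ * ‖Complex.Gamma u‖ := by gcongr
    _ ≤ _ := by linarith

theorem mellin_meijerH (N : ℕ) (a b : ℝ) {u : ℂ} (hu : 0 < u.re) (hub : 0 < u.re + b) :
    MellinConvergent (fun x => (meijerH N a b x : ℂ)) u ∧
      mellin (fun x => (meijerH N a b x : ℂ)) u = Complex.Gamma u * meijerRat N a b (-u) := by
  have hexp : IntegrableOn (fun x : ℝ => (x : ℂ) ^ (u - 1) • ((Real.exp (-x) : ℝ) : ℂ)) (Ioi 0) ∧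
      ∫ x in Ioi (0 : ℝ), (x : ℂ) ^ (u - 1) • ((Real.exp (-x) : ℝ) : ℂ) = Complex.Gamma u := by
    constructor
    · refine (Complex.GammaIntegral_convergent hu).congr_fun (fun x _ => ?_) measurableSet_Ioi
      simp [mul_comm]
    · rw [Complex.Gamma_eq_integral hu, Complex.GammaIntegral]
      exact setIntegral_congr_fun measurableSet_Ioi fun x _ => by simp [mul_comm]
  have hE : ∀ j : ℕ, MellinConvergent (fun x => (expInt (b + j) x : ℂ)) u ∧
      mellin (fun x => (expInt (b + j) x : ℂ)) u = Complex.Gamma u / (u + (b + j : ℝ)) := fun j =>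
    mellin_expInt hu (by
      have : (0 : ℝ) ≤ j := by positivity
      linarith)
  have he : ∀ x : ℝ, (x : ℂ) ^ (u - 1) • (meijerH N a b x : ℂ) =
      (-1) ^ N * ((x : ℂ) ^ (u - 1) • ((Real.exp (-x) : ℝ) : ℂ)) +
      ∑ j ∈ Finset.range N, (rho N (a + b + 1) j : ℂ) *
        ((x : ℂ) ^ (u - 1) • (expInt (b + j) x : ℂ)) := by
    intro x
    simp only [meijerH, smul_eq_mul]
    push_cast
    rw [mul_add, Finset.mul_sum]
    congr 1
    · ring
    · exact Finset.sum_congr rfl fun j _ => by ring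
  have hs : ∀ j ∈ Finset.range N, IntegrableOn (fun x : ℝ => (rho N (a + b + 1) j : ℂ) *
        ((x : ℂ) ^ (u - 1) • (expInt (b + j) x : ℂ))) (Ioi 0) := fun j _ => (hE j).1.const_mul _
  constructor
  · unfold MellinConvergent
    simp only [he]
    exact (hexp.1.const_mul _).add (integrable_finsetSum _ hs)
  · unfold mellin
    simp only [he]
    rw [integral_add (hexp.1.const_mul _) (integrable_finsetSum _ hs), integral_const_mul,
      integral_finsetSum _ hs, hexp.2, meijerRat, mul_add]
    congr 1
    · ring
    · rw [Finset.mul_sum]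
      refine Finset.sum_congr rfl fun j _ => ?_
      have := (hE j).2
      unfold mellin at this
      rw [integral_const_mul, this]
      push_cast
      ring

theorem continuousOn_meijerRat (N : ℕ) (a b : ℝ) :
    ContinuousOn (fun u : ℂ => meijerRat N a b (-u)) {u | 0 < u.re + b} := by
  unfold meijerRat
  refine continuousOn_const.add (continuousOn_finsetSum _ fun j _ => ?_)
  refine continuousOn_const.div (by fun_prop) fun u hu h => ?_
  have := congrArg Complex.re h
  have hj : (0 : ℝ) ≤ j := by positivity
  simp at this
  have hu' : 0 < u.re + b := hu
  linarith

theorem exists_norm_meijerRat_le (N : ℕ) (a b σ : ℝ) (hσ : 0 < σ + b) :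
    ∃ C, ∀ u : ℂ, u.re = σ → ‖meijerRat N a b (-u)‖ ≤ C := by
  refine ⟨1 + ∑ j ∈ Finset.range N, |rho N (a + b + 1) j| / (σ + b), fun u hu => ?_⟩
  unfold meijerRat
  refine (norm_add_le _ _).trans (add_le_add (by simp) ?_)
  refine (norm_sum_le _ _).trans (Finset.sum_le_sum fun j _ => ?_)
  rw [norm_div, Complex.norm_real, Real.norm_eq_abs]
  have hj : (0 : ℝ) ≤ j := by positivity
  refine div_le_div_of_nonneg_left (abs_nonneg _) hσ ?_
  refine le_trans ?_ (Complex.re_le_norm _)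
  simp [hu]
  linarith

theorem verticalIntegrable_mellin_meijerH (N : ℕ) (a b : ℝ) {σ : ℝ} (hσ : 0 < σ)
    (hσb : 0 < σ + b) :
    Complex.VerticalIntegrable (mellin fun x => (meijerH N a b x : ℂ)) σ := by
  obtain ⟨C, hC⟩ := exists_norm_meijerRat_le N a b σ hσb
  have hC0 : 0 ≤ C := (norm_nonneg _).trans (hC σ (by simp))
  unfold Complex.VerticalIntegrable
  have he : ∀ y : ℝ, mellin (fun x => (meijerH N a b x : ℂ)) (σ + y * Complex.I) =
      Complex.Gamma (σ + y * Complex.I) * meijerRat N a b (-(σ + y * Complex.I)) := fun y =>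
    (mellin_meijerH N a b (by simpa using hσ) (by simpa using hσb)).2
  simp only [he]
  have hc : Continuous fun y : ℝ => Complex.Gamma (σ + y * Complex.I) *
      meijerRat N a b (-(σ + y * Complex.I)) := by
    refine Continuous.mul ?_ ?_
    · refine continuous_iff_continuousAt.2 fun y => ?_
      refine ContinuousAt.comp (g := Complex.Gamma) (f := fun y : ℝ => (σ + y * Complex.I : ℂ))
        (Complex.differentiableAt_Gamma _ fun m h => ?_).continuousAt (by fun_prop)
      have := congrArg Complex.re h
      have hm : (0 : ℝ) ≤ m := by positivity
      simp at this
      linarith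
    · exact (continuousOn_meijerRat N a b).comp_continuous (by fun_prop) fun y => by
        simpa using hσb
  refine Integrable.mono' ((integrable_inv_one_add_sq.const_mul
    (Real.Gamma (σ + 2) / min (σ ^ 2) 1)).mul_const C) hc.aestronglyMeasurable
    (Eventually.of_forall fun y => ?_)
  rw [norm_mul]
  have hG : 0 ≤ Real.Gamma (σ + 2) := (Real.Gamma_pos_of_pos (by linarith)).le
  exact mul_le_mul (norm_Gamma_vertical_le hσ y) (hC _ (by simp)) (norm_nonneg _) (by positivity)

/-- Mellin inversion on the line `Re u = -c` with `s = -u`. The conditions on `c` put this line in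
the half-plane where the Mellin transform converges. -/
theorem integral_vertical_meijerH (N : ℕ) (a b : ℝ) {c x : ℝ} (hx : 0 < x) (hc : c < 0)
    (hcb : c < b) :
    (2 * Real.pi * Complex.I)⁻¹ * (Complex.I * ∫ τ : ℝ, (x : ℂ) ^ (c + τ * Complex.I) *
      (Complex.Gamma (-(c + τ * Complex.I)) * meijerRat N a b (c + τ * Complex.I))) =
      meijerH N a b x := by
  have hσ : 0 < -c := by linarith
  have hσb : 0 < -c + b := by linarith
  have hcont : ContinuousAt (fun x => (meijerH N a b x : ℂ)) x := by
    refine Complex.continuous_ofReal.continuousAt.comp ?_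
    unfold meijerH
    refine ContinuousAt.add (by fun_prop) ?_
    refine tendsto_finsetSum _ fun j _ => ?_
    exact ((hasDerivAt_expInt (b + j) hx).continuousAt).const_mul _
  have h := mellinInv_mellin_eq (-c) (fun x => (meijerH N a b x : ℂ)) hx
    (mellin_meijerH N a b (by simpa using hσ) (by simpa using hσb)).1
    (verticalIntegrable_mellin_meijerH N a b hσ hσb) hcont
  rw [← h, mellinInv, Complex.real_smul, ← integral_neg_eq_self]
  have he : ∀ τ : ℝ, (x : ℂ) ^ (c + ((-τ : ℝ) : ℂ) * Complex.I) *
      (Complex.Gamma (-(c + ((-τ : ℝ) : ℂ) * Complex.I)) *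
        meijerRat N a b (c + ((-τ : ℝ) : ℂ) * Complex.I)) =
      (x : ℂ) ^ (-(((-c : ℝ) : ℂ) + τ * Complex.I)) •
        mellin (fun x => (meijerH N a b x : ℂ)) (((-c : ℝ) : ℂ) + τ * Complex.I) := by
    intro τ
    rw [(mellin_meijerH N a b (by simpa using hσ) (by simpa using hσb)).2]
    push_cast
    rw [show (-(-(c : ℂ) + τ * Complex.I)) = c + -τ * Complex.I by ring,
      show (-((c : ℂ) + -τ * Complex.I)) = -c + τ * Complex.I by ring]
    rfl
  simp only [he]
  rw [← mul_assoc]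
  congr 1
  push_cast
  field_simp

theorem ne_ofReal_of_im_ne_zero {s : ℂ} (hs : s.im ≠ 0) (r : ℝ) : s ≠ r := fun h => hs (by
  rw [h, Complex.ofReal_im])

theorem Gamma_ne_zero_of_im_ne_zero {s : ℂ} (hs : s.im ≠ 0) : Complex.Gamma s ≠ 0 :=
  Complex.Gamma_ne_zero fun m => by
    have := ne_ofReal_of_im_ne_zero hs (-m)
    push_cast at this
    exact this

/-- Gamma functions whose arguments differ by `N` have a polynomial quotient, and the resulting
rational function is expanded in partial fractions. Off the real axis there are neither poles nor
default values; on a vertical line only a null set is lost. -/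
theorem meijerRat_eq_Gamma_ratio (N : ℕ) (a b : ℝ) {s : ℂ} (hs : s.im ≠ 0) :
    Complex.Gamma (b - s) * Complex.Gamma (1 + a + N + s) /
      (Complex.Gamma (1 + a + s) * Complex.Gamma (N + b - s)) = meijerRat N a b s := by
  have h1 : Complex.Gamma (1 + a + N + s) =
      (∏ l ∈ Finset.range N, ((a : ℂ) + 1 + l + s)) * Complex.Gamma (1 + a + s) := by
    rw [show (1 + a + N + s : ℂ) = (1 + a + s) + N by ring,
      Gamma_add_natCast_eq_prod N _ fun l _ h => hs (by simpa using congrArg Complex.im h)]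
    congr 1
    exact Finset.prod_congr rfl fun l _ => by ring
  have h2 : Complex.Gamma (N + b - s) =
      (∏ l ∈ Finset.range N, ((b : ℂ) + l - s)) * Complex.Gamma (b - s) := by
    rw [show (N + b - s : ℂ) = (b - s) + N by ring,
      Gamma_add_natCast_eq_prod N _ fun l _ h => hs (by simpa using congrArg Complex.im h)]
    congr 1
    exact Finset.prod_congr rfl fun l _ => by ring
  have h3 : Complex.Gamma (1 + a + s) ≠ 0 := Gamma_ne_zero_of_im_ne_zero (by simpa using hs)
  have h4 : Complex.Gamma (b - s) ≠ 0 := Gamma_ne_zero_of_im_ne_zero (by simpa using hs)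
  rw [meijerRat, ← prod_div_prod_eq_sum_rho N a b s fun j _ h =>
    hs (by simpa using congrArg Complex.im h), h1, h2]
  rw [mul_comm (Complex.Gamma (b - s)), mul_assoc, mul_comm (Finset.prod _ _) (Complex.Gamma (b - s)),
    ← mul_assoc, mul_div_mul_comm]
  field_simp

theorem ae_im_ne_zero (c : ℝ) : ∀ᵐ τ : ℝ, ((c : ℂ) + τ * Complex.I).im ≠ 0 := by
  filter_upwards [Measure.ae_ne volume (0 : ℝ)] with τ hτ
  simpa using hτ

theorem meijerAbscissa_spec {a₁ b₁ : List ℝ}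
    (h : ∃ c : ℝ, (∀ a ∈ a₁, a - 1 < c) ∧ ∀ b ∈ b₁, c < b) :
    (∀ a ∈ a₁, a - 1 < meijerAbscissa a₁ b₁) ∧ ∀ b ∈ b₁, meijerAbscissa a₁ b₁ < b :=
  Classical.epsilon_spec h

theorem meijerG_eq_meijerH (N : ℕ) {a b x : ℝ} (ha : -1 < a) (hab : 0 < a + b + 1) (hx : 0 < x) :
    meijerG [-a - N] [N + b] [0, b] [-a] x = meijerH N a b x := by
  have hN : (0 : ℝ) ≤ N := by positivity
  -- A separating abscissa exists because `-a - N - 1` is smaller than `0` and than `b`; its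
  -- existence is what gives the chosen point its defining property.
  have hsp := meijerAbscissa_spec (a₁ := [-a - N]) (b₁ := [0, b]) (by
    obtain ⟨c, h1, h2⟩ := exists_between (show -a - N - 1 < min 0 b by
      refine lt_min ?_ ?_ <;> linarith)
    refine ⟨c, by simpa using h1, by simpa using lt_min_iff.1 h2⟩)
  simp only [List.mem_cons, List.not_mem_nil, or_false, forall_eq, forall_eq_or_imp] at hsp
  rw [← integral_vertical_meijerH N a b hx hsp.2.1 hsp.2.2]
  unfold meijerG
  simp only [List.length_cons, List.length_nil]
  -- `p + q = 5` is less than `2 (m + n) = 6`: the contour is the vertical line.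
  rw [if_pos (by norm_num)]
  congr 2
  refine integral_congr_ae ?_
  filter_upwards [ae_im_ne_zero (meijerAbscissa [-a - N] [0, b])] with τ hτ
  set s : ℂ := (meijerAbscissa [-a - N] [0, b] : ℂ) + τ * Complex.I with hs
  rw [← meijerRat_eq_Gamma_ratio N a b hτ]
  simp only [meijerIntegrand, List.map_cons, List.map_nil, List.prod_cons, List.prod_nil, mul_one]
  push_cast
  rw [show (1 - (-a - N) + s : ℂ) = 1 + a + N + s by ring, show (1 - -a + s : ℂ) = 1 + a + s by ring,
    zero_sub]
  ring

/-- The translation `s ↦ s + b` of the contour variable leads back to the previous function and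
costs the factor `x^(-b)`. -/
theorem meijerG_eq_rpow_mul_meijerH (N : ℕ) {a b x : ℝ} (ha : -1 < a) (hab : 0 < a + b + 1)
    (hx : 0 < x) :
    meijerG [-N - a - b] [N] [0, -b] [-a - b] x = ((x ^ (-b) * meijerH N a b x : ℝ) : ℂ) := by
  have hN : (0 : ℝ) ≤ N := by positivity
  have hsp := meijerAbscissa_spec (a₁ := [-N - a - b]) (b₁ := [0, -b]) (by
    obtain ⟨c, h1, h2⟩ := exists_between (show -N - a - b - 1 < min 0 (-b) by
      refine lt_min ?_ ?_ <;> linarith)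
    refine ⟨c, by simpa using h1, by simpa using lt_min_iff.1 h2⟩)
  simp only [List.mem_cons, List.not_mem_nil, or_false, forall_eq, forall_eq_or_imp] at hsp
  set c := meijerAbscissa [-N - a - b] [0, -b] with hc
  rw [Complex.ofReal_mul, ← integral_vertical_meijerH N a b (c := c + b) hx (by linarith)
    (by linarith)]
  unfold meijerG
  simp only [List.length_cons, List.length_nil]
  rw [if_pos (by norm_num), ← hc]
  suffices hint : ∫ τ : ℝ, meijerIntegrand [-N - a - b] [N] [0, -b] [-a - b] x (c + τ * Complex.I) =
      ((x ^ (-b) : ℝ) : ℂ) * ∫ τ : ℝ, (x : ℂ) ^ (((c + b : ℝ) : ℂ) + τ * Complex.I) *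
        (Complex.Gamma (-(((c + b : ℝ) : ℂ) + τ * Complex.I)) *
          meijerRat N a b (((c + b : ℝ) : ℂ) + τ * Complex.I)) by
    rw [hint]
    ring
  rw [← integral_const_mul]
  refine integral_congr_ae ?_
  filter_upwards [ae_im_ne_zero c] with τ hτ
  set s : ℂ := (c : ℂ) + τ * Complex.I with hs
  have hs' : ((c + b : ℝ) : ℂ) + τ * Complex.I = s + b := by rw [hs]; push_cast; ring
  have hx0 : (x : ℂ) ≠ 0 := by exact_mod_cast hx.ne'
  rw [hs', ← meijerRat_eq_Gamma_ratio N a b (s := s + b) (by simpa using hτ)]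
  simp only [meijerIntegrand, List.map_cons, List.map_nil, List.prod_cons, List.prod_nil, mul_one]
  rw [Complex.cpow_add s (b : ℂ) hx0, ← Complex.ofReal_cpow hx.le, Real.rpow_neg hx.le]
  have hxb : ((x ^ b : ℝ) : ℂ) ≠ 0 := by exact_mod_cast (Real.rpow_pos_of_pos hx b).ne'
  push_cast at hxb ⊢
  rw [show (1 - (-N - a - b) + s : ℂ) = 1 + a + N + (s + b) by ring,
    show (1 - (-a - b) + s : ℂ) = 1 + a + (s + b) by ring, show (-b - s : ℂ) = -(s + b) by ring,
    show (b - (s + b) : ℂ) = 0 - s by ring, show (N + b - (s + b) : ℂ) = N - s by ring]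
  field_simp

end MeijerVertical

/-! ### The functions `G^{1,1}_{2,3}` by residues inside a loop -/

section MeijerLoop

open Filter Topology

/-- The integral of `f` over the boundary, taken counterclockwise, of the rectangle
`[c, R] × [-1, 1]`. -/
def rectIntegral (c R : ℝ) (f : ℂ → ℂ) : ℂ :=
  (∫ x : ℝ in c..R, f (x - Complex.I)) - (∫ x : ℝ in c..R, f (x + Complex.I)) +
    Complex.I * (∫ y : ℝ in (-1 : ℝ)..1, f (R + y * Complex.I)) -
    Complex.I * (∫ y : ℝ in (-1 : ℝ)..1, f (c + y * Complex.I))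

/-- A set which contains the boundary of the rectangle `[c, R] × [-1, 1]`. -/
def rectSides (c R : ℝ) : Set ℂ := {s | s.im ≠ 0 ∨ s.re = c ∨ s.re = R}

variable {c R : ℝ} {f g : ℂ → ℂ}

theorem continuous_sides_of_continuousOn (hf : ContinuousOn f (rectSides c R)) :
    (Continuous fun x : ℝ => f (x - Complex.I)) ∧ (Continuous fun x : ℝ => f (x + Complex.I)) ∧
      (Continuous fun y : ℝ => f (R + y * Complex.I)) ∧
      Continuous fun y : ℝ => f (c + y * Complex.I) :=
  ⟨hf.comp_continuous (by fun_prop) fun x => Or.inl (by simp),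
    hf.comp_continuous (by fun_prop) fun x => Or.inl (by simp),
    hf.comp_continuous (by fun_prop) fun x => Or.inr (Or.inr (by simp)),
    hf.comp_continuous (by fun_prop) fun x => Or.inr (Or.inl (by simp))⟩

theorem rectIntegral_add (hf : ContinuousOn f (rectSides c R))
    (hg : ContinuousOn g (rectSides c R)) :
    rectIntegral c R (fun s => f s + g s) = rectIntegral c R f + rectIntegral c R g := by
  obtain ⟨f1, f2, f3, f4⟩ := continuous_sides_of_continuousOn hf
  obtain ⟨g1, g2, g3, g4⟩ := continuous_sides_of_continuousOn hg
  unfold rectIntegral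
  rw [intervalIntegral.integral_add (f1.intervalIntegrable _ _) (g1.intervalIntegrable _ _),
    intervalIntegral.integral_add (f2.intervalIntegrable _ _) (g2.intervalIntegrable _ _),
    intervalIntegral.integral_add (f3.intervalIntegrable _ _) (g3.intervalIntegrable _ _),
    intervalIntegral.integral_add (f4.intervalIntegrable _ _) (g4.intervalIntegrable _ _)]
  ring

theorem rectIntegral_const_mul (u : ℂ) (f : ℂ → ℂ) :
    rectIntegral c R (fun s => u * f s) = u * rectIntegral c R f := by
  simp only [rectIntegral, intervalIntegral.integral_const_mul]
  ring

theorem rectIntegral_sum {ι : Type*} (t : Finset ι) (f : ι → ℂ → ℂ)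
    (hf : ∀ i ∈ t, ContinuousOn (f i) (rectSides c R)) :
    rectIntegral c R (fun s => ∑ i ∈ t, f i s) = ∑ i ∈ t, rectIntegral c R (f i) := by
  classical
  induction t using Finset.induction_on with
  | empty => simp [rectIntegral]
  | insert i t hi ih =>
    simp only [Finset.sum_insert hi]
    rw [rectIntegral_add (hf i (by simp)) (continuousOn_finsetSum _ fun j hj =>
      hf j (Finset.mem_insert_of_mem hj)), ih fun j hj => hf j (Finset.mem_insert_of_mem hj)]

theorem rectIntegral_congr (h : ∀ s ∈ rectSides c R, f s = g s) :
    rectIntegral c R f = rectIntegral c R g := by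
  unfold rectIntegral
  congr 1
  · congr 1
    · congr 1
      · exact intervalIntegral.integral_congr fun x _ => h _ (Or.inl (by simp))
      · exact intervalIntegral.integral_congr fun x _ => h _ (Or.inl (by simp))
    · congr 1
      exact intervalIntegral.integral_congr fun x _ => h _ (Or.inr (Or.inr (by simp)))
  · congr 1
    exact intervalIntegral.integral_congr fun x _ => h _ (Or.inr (Or.inl (by simp)))

theorem rectIntegral_eq_zero (hf : Differentiable ℂ f) : rectIntegral c R f = 0 := by
  have := Complex.integral_boundary_rect_eq_zero_of_differentiableOn f (c - Complex.I)
    (R + Complex.I) hf.differentiableOn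
  simpa [rectIntegral, sub_eq_add_neg] using this

theorem integral_affine_inv (p v : ℂ) {α β : ℝ}
    (h : ∀ x ∈ uIcc α β, p + x * v ∈ Complex.slitPlane) :
    ∫ x in α..β, v / (p + x * v) = Complex.log (p + β * v) - Complex.log (p + α * v) := by
  refine intervalIntegral.integral_eq_sub_of_hasDerivAt
    (f := fun x : ℝ => Complex.log (p + x * v)) (fun x hx => ?_) ?_
  · have h1 : HasDerivAt (fun x : ℝ => p + x * v) v x := by
      simpa using ((Complex.ofRealCLM.hasDerivAt (x := x)).mul_const v).const_add p
    exact h1.clog_real (h x hx)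
  · refine ContinuousOn.intervalIntegrable ?_
    exact continuousOn_const.div (by fun_prop) fun x hx => Complex.slitPlane_ne_zero (h x hx)

/-- Three sides are integrated with the logarithm of `s - w`. The left one meets its cut, so there
the logarithm of `w - s` is used; the two branches differ by `π i` in size at each of the two left
corners, and this makes up `2 π i`. -/
theorem rectIntegral_inv_sub {w : ℝ} (hc : c < w) (hR : w < R) :
    rectIntegral c R (fun s => 1 / (s - w)) = 2 * Real.pi * Complex.I := by
  have h1 := integral_affine_inv (-Complex.I - w) 1 (α := c) (β := R) fun x _ =>
    Or.inr (by simp)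
  have h2 := integral_affine_inv (Complex.I - w) 1 (α := c) (β := R) fun x _ =>
    Or.inr (by simp)
  have h3 := integral_affine_inv (R - w) Complex.I (α := -1) (β := 1) fun x _ =>
    Or.inl (by simp [hR])
  have h4 := integral_affine_inv (w - c) (-Complex.I) (α := -1) (β := 1) fun x _ =>
    Or.inl (by simp [hc])
  have hl : ∀ z : ℂ, 0 < z.im → Complex.log (-z) = Complex.log z - Real.pi * Complex.I := by
    intro z hz
    simp only [Complex.log, norm_neg, Complex.arg_neg_eq_arg_sub_pi_of_im_pos hz]
    push_cast
    ring
  unfold rectIntegral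
  rw [← intervalIntegral.integral_const_mul, ← intervalIntegral.integral_const_mul]
  have e1 : (∫ x : ℝ in c..R, 1 / ((x : ℂ) - Complex.I - w)) =
      ∫ x : ℝ in c..R, 1 / (-Complex.I - w + x * 1) := by
    congr 1; ext x; congr 1; ring
  have e2 : (∫ x : ℝ in c..R, 1 / ((x : ℂ) + Complex.I - w)) =
      ∫ x : ℝ in c..R, 1 / (Complex.I - w + x * 1) := by
    congr 1; ext x; congr 1; ring
  have e3 : (∫ y : ℝ in (-1 : ℝ)..1, Complex.I * (1 / ((R : ℂ) + y * Complex.I - w))) =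
      ∫ y : ℝ in (-1 : ℝ)..1, Complex.I / (R - w + y * Complex.I) := by
    congr 1; ext x; rw [mul_one_div]; congr 1; ring
  have e4 : (∫ y : ℝ in (-1 : ℝ)..1, Complex.I * (1 / ((c : ℂ) + y * Complex.I - w))) =
      ∫ y : ℝ in (-1 : ℝ)..1, -Complex.I / (w - c + y * -Complex.I) := by
    congr 1; ext x; rw [mul_one_div, ← neg_div_neg_eq]; congr 1; ring
  rw [e1, e2, e3, e4, h1, h2, h3, h4]
  have l1 := hl (c - w + Complex.I) (by simp)
  have l2 := hl (w - c + Complex.I) (by simp)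
  push_cast
  rw [show (w - c + 1 * -Complex.I : ℂ) = -(c - w + Complex.I) by ring,
    show (w - c + -1 * -Complex.I : ℂ) = w - c + Complex.I by ring,
    show (-Complex.I - w + R * 1 : ℂ) = R - w + -1 * Complex.I by ring,
    show (-Complex.I - w + c * 1 : ℂ) = -(w - c + Complex.I) by ring,
    show (Complex.I - w + R * 1 : ℂ) = R - w + 1 * Complex.I by ring,
    show (Complex.I - w + c * 1 : ℂ) = c - w + Complex.I by ring, l1, l2]
  ring

theorem ne_of_mem_rectSides {w : ℝ} (hc : c < w) (hR : w < R) {s : ℂ} (hs : s ∈ rectSides c R) :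
    s ≠ w := by
  rintro rfl
  rcases hs with h | h | h <;> simp at h <;> linarith

theorem continuousOn_one_div_sub {w : ℝ} (hc : c < w) (hR : w < R) :
    ContinuousOn (fun s : ℂ => 1 / (s - w)) (rectSides c R) :=
  continuousOn_const.div (by fun_prop) fun _ hs => sub_ne_zero.2 (ne_of_mem_rectSides hc hR hs)

/-- `f(s) = f(w) + (s - w) g(s)` with the entire function `g = dslope f w`, whose integral over the
boundary is zero. -/
theorem rectIntegral_div_sub (hf : Differentiable ℂ f) {w : ℝ} (hc : c < w) (hR : w < R) :
    rectIntegral c R (fun s => f s / (w - s)) = -(2 * Real.pi * Complex.I) * f w := by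
  have hd : Differentiable ℂ (dslope f w) := by
    rw [← differentiableOn_univ]
    exact (Complex.differentiableOn_dslope univ_mem).2 hf.differentiableOn
  have h1 : rectIntegral c R (fun s => f s / (w - s)) =
      rectIntegral c R (fun s => -1 * dslope f w s + -(f w) * (1 / (s - w))) := by
    refine rectIntegral_congr fun s hs => ?_
    have hne := ne_of_mem_rectSides hc hR hs
    have h2 : s - w ≠ 0 := sub_ne_zero.2 hne
    have h3 : (w : ℂ) - s ≠ 0 := sub_ne_zero.2 hne.symm
    rw [dslope_of_ne _ hne, slope_def_field]
    field_simp
    ring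
  rw [h1, rectIntegral_add ((hd.continuous.const_mul _).continuousOn)
    ((continuousOn_one_div_sub hc hR).const_mul _), rectIntegral_const_mul, rectIntegral_const_mul,
    rectIntegral_eq_zero hd, rectIntegral_inv_sub hc hR]
  ring

theorem rectIntegral_mul_partialFraction (hf : Differentiable ℂ f) (N : ℕ) (u : ℂ) (r : ℕ → ℂ)
    (hc : c < 0) (hR : (N : ℝ) < R) :
    rectIntegral c R (fun s => f s * (u + ∑ j ∈ Finset.range N, r j / (j - s))) =
      -(2 * Real.pi * Complex.I) * ∑ j ∈ Finset.range N, r j * f j := by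
  have hj : ∀ j ∈ Finset.range N, c < (j : ℝ) ∧ (j : ℝ) < R := fun j hj => by
    have h1 : (0 : ℝ) ≤ j := by positivity
    have h2 : (j : ℝ) < N := by exact_mod_cast Finset.mem_range.1 hj
    constructor <;> linarith
  have hcont : ∀ j ∈ Finset.range N,
      ContinuousOn (fun s : ℂ => r j * (f s / (((j : ℝ) : ℂ) - s))) (rectSides c R) := fun j hj' =>
    continuousOn_const.mul (hf.continuous.continuousOn.div (by fun_prop) fun s hs =>
      sub_ne_zero.2 (ne_of_mem_rectSides (hj j hj').1 (hj j hj').2 hs).symm)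
  have h1 : (fun s => f s * (u + ∑ j ∈ Finset.range N, r j / (j - s))) =
      fun s => u * f s + ∑ j ∈ Finset.range N, r j * (f s / (((j : ℝ) : ℂ) - s)) := by
    ext s
    rw [mul_add, Finset.mul_sum]
    congr 1
    · ring
    · refine Finset.sum_congr rfl fun j _ => ?_
      rw [Complex.ofReal_natCast]
      ring
  rw [h1, rectIntegral_add ((hf.continuous.const_mul _).continuousOn)
    (continuousOn_finsetSum _ hcont), rectIntegral_sum _ _ hcont, rectIntegral_const_mul,
    rectIntegral_eq_zero hf, mul_zero, zero_add, Finset.mul_sum]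
  refine Finset.sum_congr rfl fun j hj' => ?_
  rw [rectIntegral_const_mul, rectIntegral_div_sub hf (hj j hj').1 (hj j hj').2]
  push_cast
  ring

/-- The integral of `f` over the loop from `+∞ - i` through `c` to `+∞ + i`. -/
def loopIntegral (c : ℝ) (f : ℂ → ℂ) : ℂ :=
  -(∫ σ in Ioi c, f (σ - Complex.I)) + (Complex.I * ∫ τ in (-1 : ℝ)..1, f (c + τ * Complex.I)) +
    ∫ σ in Ioi c, f (σ + Complex.I)

/-- The right side of the rectangle contributes nothing in the limit, because of the exponential
decay. The minus sign appears because the loop runs clockwise. -/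
theorem tendsto_rectIntegral {C : ℝ} {R₀ : ℝ} (hf : ContinuousOn f {s | s.im ≠ 0})
    (hb : ∀ s : ℂ, (s.im = 1 ∨ s.im = -1 ∨ R₀ ≤ s.re) → c ≤ s.re → |s.im| ≤ 1 →
      ‖f s‖ ≤ C * Real.exp (-s.re)) :
    Tendsto (fun R => rectIntegral c R f) atTop (𝓝 (-loopIntegral c f)) := by
  have hexp : IntegrableOn (fun x : ℝ => C * Real.exp (-x)) (Ioi c) := by
    have := (exp_neg_integrableOn_Ioi c one_pos).const_mul C
    simpa [IntegrableOn] using this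
  have hi1 : IntegrableOn (fun x : ℝ => f (x - Complex.I)) (Ioi c) := by
    refine Integrable.mono' hexp (Continuous.aestronglyMeasurable
      (hf.comp_continuous (by fun_prop) fun x => by simp)) ?_
    refine (ae_restrict_mem measurableSet_Ioi).mono fun x hx => ?_
    have := hb (x - Complex.I) (by simp) (by simpa using hx.le) (by simp)
    simpa using this
  have hi2 : IntegrableOn (fun x : ℝ => f (x + Complex.I)) (Ioi c) := by
    refine Integrable.mono' hexp (Continuous.aestronglyMeasurable
      (hf.comp_continuous (by fun_prop) fun x => by simp)) ?_
    refine (ae_restrict_mem measurableSet_Ioi).mono fun x hx => ?_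
    have := hb (x + Complex.I) (by simp) (by simpa using hx.le) (by simp)
    simpa using this
  have h3 : Tendsto (fun R : ℝ => ∫ y : ℝ in (-1 : ℝ)..1, f (R + y * Complex.I)) atTop (𝓝 0) := by
    have hz : Tendsto (fun R : ℝ => C * Real.exp (-R) * |(1 : ℝ) - (-1)|) atTop (𝓝 0) := by
      have := ((Real.tendsto_exp_neg_atTop_nhds_zero).const_mul C).mul_const |(1 : ℝ) - (-1)|
      simpa using this
    refine squeeze_zero_norm' ?_ hz
    filter_upwards [eventually_ge_atTop R₀, eventually_ge_atTop c] with R hR hRc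
    refine intervalIntegral.norm_integral_le_of_norm_le_const fun y hy => ?_
    have hy' : |y| ≤ 1 := by
      rw [uIoc_of_le (by norm_num)] at hy
      exact abs_le.2 ⟨hy.1.le, hy.2⟩
    have := hb (R + y * Complex.I) (by simp [hR]) (by simpa using hRc) (by simpa using hy')
    simpa using this
  have h := (((intervalIntegral_tendsto_integral_Ioi c hi1 tendsto_id).sub
    (intervalIntegral_tendsto_integral_Ioi c hi2 tendsto_id)).add (h3.const_mul Complex.I)).sub
    (tendsto_const_nhds (x := Complex.I * ∫ y : ℝ in (-1 : ℝ)..1, f (c + y * Complex.I)))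
  have he : -loopIntegral c f = (∫ σ in Ioi c, f (σ - Complex.I)) -
      (∫ σ in Ioi c, f (σ + Complex.I)) + Complex.I * 0 -
        Complex.I * ∫ τ in (-1 : ℝ)..1, f (c + τ * Complex.I) := by
    unfold loopIntegral
    ring
  rw [he]
  exact h

/-- On a compact rectangle the function is bounded by continuity. Further to the right, a unit step
multiplies it by `y / (d + s - 1)`, which has modulus at most `1` there. -/
theorem exists_norm_cpow_mul_inv_Gamma_le (c d : ℝ) {y : ℝ} (hy : 0 < y) :
    ∃ C, ∀ s : ℂ, c ≤ s.re → |s.im| ≤ 1 →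
      ‖(y : ℂ) ^ s * (Complex.Gamma (d + s))⁻¹‖ ≤ C := by
  have hy0 : (y : ℂ) ≠ 0 := by exact_mod_cast hy.ne'
  have hcont : Continuous fun s : ℂ => (y : ℂ) ^ s * (Complex.Gamma (d + s))⁻¹ := by
    refine Continuous.mul ?_ ?_
    · exact Continuous.const_cpow continuous_id (Or.inl hy0)
    · exact Complex.differentiable_one_div_Gamma.continuous.comp (by fun_prop)
  obtain ⟨M, hM⟩ := exists_nat_ge (y - d - c + 1)
  set L : ℝ := c + M with hL
  have hK : IsCompact (Icc c (L + 1) ×ℂ Icc (-1 : ℝ) 1) := isCompact_Icc.reProdIm isCompact_Icc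
  obtain ⟨C, hC⟩ := hK.exists_bound_of_continuousOn hcont.continuousOn
  have hind : ∀ n : ℕ, ∀ s : ℂ, c ≤ s.re → s.re ≤ L + 1 + n → |s.im| ≤ 1 →
      ‖(y : ℂ) ^ s * (Complex.Gamma (d + s))⁻¹‖ ≤ C := by
    intro n
    induction n with
    | zero =>
      intro s h1 h2 h3
      exact hC s ⟨⟨h1, by simpa using h2⟩, abs_le.1 h3⟩
    | succ n ih =>
      intro s h1 h2 h3
      rcases le_or_gt s.re (L + 1) with h | h
      · exact hC s ⟨⟨h1, h⟩, abs_le.1 h3⟩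
      have hM0 : (0 : ℝ) ≤ M := by positivity
      have hre : y ≤ (d + (s - 1)).re := by
        simp
        linarith
      have hne : (d + (s - 1) : ℂ) ≠ 0 := fun h0 => by
        rw [h0] at hre
        simp at hre
        linarith
      have hrec : (y : ℂ) ^ s * (Complex.Gamma (d + s))⁻¹ =
          y / (d + (s - 1)) * ((y : ℂ) ^ (s - 1) * (Complex.Gamma (d + (s - 1)))⁻¹) := by
        rw [Complex.cpow_sub _ _ hy0, Complex.cpow_one,
          show (d + s : ℂ) = (d + (s - 1)) + 1 by ring, Complex.Gamma_add_one _ hne, mul_inv]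
        field_simp
      rw [hrec, norm_mul]
      have hle : ‖(y : ℂ) / (d + (s - 1))‖ ≤ 1 := by
        rw [norm_div, Complex.norm_real, Real.norm_eq_abs, abs_of_pos hy]
        exact div_le_one_of_le₀ (hre.trans (Complex.re_le_norm _)) (norm_nonneg _)
      refine (mul_le_of_le_one_left (norm_nonneg _) hle).trans (ih _ ?_ ?_ ?_)
      · simp
        linarith
      · simp
        push_cast at h2
        linarith
      · simpa using h3
  refine ⟨C, fun s h1 h2 => ?_⟩
  obtain ⟨n, hn⟩ := exists_nat_ge (s.re - (L + 1))
  exact hind n s h1 (by linarith) h2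

theorem loopIntegral_cpow_mul_inv_Gamma (N : ℕ) (u : ℂ) (r : ℕ → ℂ) (d : ℝ) {c x : ℝ} (hc : c < 0)
    (hx : 0 < x) :
    loopIntegral c (fun s => (x : ℂ) ^ s * (Complex.Gamma (d + s))⁻¹ *
      (u + ∑ j ∈ Finset.range N, r j / (j - s))) =
      2 * Real.pi * Complex.I * ∑ j ∈ Finset.range N,
        r j * ((x : ℂ) ^ (j : ℂ) * (Complex.Gamma (d + j))⁻¹) := by
  have hx0 : (x : ℂ) ≠ 0 := by exact_mod_cast hx.ne'
  have hd : Differentiable ℂ fun s : ℂ => (x : ℂ) ^ s * (Complex.Gamma (d + s))⁻¹ := by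
    refine Differentiable.mul ?_ ?_
    · exact differentiable_id.const_cpow (Or.inl hx0)
    · exact Complex.differentiable_one_div_Gamma.comp (by fun_prop)
  -- Taking `x e` in place of `x` in the bound produces the decay `e^(-Re s)`.
  obtain ⟨C, hC⟩ := exists_norm_cpow_mul_inv_Gamma_le c d (y := x * Real.exp 1) (by positivity)
  have hb1 : ∀ s : ℂ, c ≤ s.re → |s.im| ≤ 1 →
      ‖(x : ℂ) ^ s * (Complex.Gamma (d + s))⁻¹‖ ≤ C * Real.exp (-s.re) := by
    intro s h1 h2
    have := hC s h1 h2
    rw [norm_mul, Complex.norm_cpow_eq_rpow_re_of_pos (by positivity),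
      Real.mul_rpow hx.le (Real.exp_pos _).le, ← Real.exp_mul, one_mul] at this
    rw [norm_mul, Complex.norm_cpow_eq_rpow_re_of_pos hx, Real.exp_neg, ← div_eq_mul_inv,
      le_div_iff₀ (Real.exp_pos _)]
    linarith
  set q : ℂ → ℂ := fun s => u + ∑ j ∈ Finset.range N, r j / (j - s) with hq
  have hb2 : ∀ s : ℂ, (s.im = 1 ∨ s.im = -1 ∨ (N : ℝ) + 1 ≤ s.re) →
      ‖q s‖ ≤ ‖u‖ + ∑ j ∈ Finset.range N, ‖r j‖ := by
    intro s hs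
    refine (norm_add_le _ _).trans (add_le_add le_rfl ((norm_sum_le _ _).trans
      (Finset.sum_le_sum fun j hj => ?_)))
    have h1 : (j : ℝ) < N := by exact_mod_cast Finset.mem_range.1 hj
    rw [norm_div]
    refine div_le_self (norm_nonneg _) ?_
    rcases hs with h | h | h
    · refine le_trans ?_ (Complex.abs_im_le_norm _)
      simp [h]
    · refine le_trans ?_ (Complex.abs_im_le_norm _)
      simp [h]
    · refine le_trans ?_ (Complex.abs_re_le_norm _)
      simp only [Complex.sub_re, Complex.natCast_re]
      rw [abs_sub_comm]
      exact le_trans (by linarith) (le_abs_self _)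
  have hqc : ContinuousOn q {s | s.im ≠ 0} := by
    refine continuousOn_const.add (continuousOn_finsetSum _ fun j _ => ?_)
    refine continuousOn_const.div (by fun_prop) fun s hs h => hs ?_
    simpa using congrArg Complex.im h
  have ht := tendsto_rectIntegral (c := c) (R₀ := N + 1)
    (C := C * (‖u‖ + ∑ j ∈ Finset.range N, ‖r j‖))
    (f := fun s => (x : ℂ) ^ s * (Complex.Gamma (d + s))⁻¹ * q s)
    (hd.continuous.continuousOn.mul hqc) (fun s h1 h2 h3 => by
      rw [norm_mul]
      calc _ ≤ C * Real.exp (-s.re) * (‖u‖ + ∑ j ∈ Finset.range N, ‖r j‖) :=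
            mul_le_mul (hb1 s h2 h3) (hb2 s h1) (norm_nonneg _) ((norm_nonneg _).trans (hb1 s h2 h3))
        _ = _ := by ring)
  have ht' : Tendsto (fun R => rectIntegral c R fun s =>
      (x : ℂ) ^ s * (Complex.Gamma (d + s))⁻¹ * q s) atTop (𝓝 (-(2 * Real.pi * Complex.I) *
        ∑ j ∈ Finset.range N, r j * ((x : ℂ) ^ (j : ℂ) * (Complex.Gamma (d + j))⁻¹))) := by
    refine tendsto_const_nhds.congr' ?_
    filter_upwards [eventually_gt_atTop (N : ℝ)] with R hR
    exact (rectIntegral_mul_partialFraction hd N u r hc hR).symm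
  have := tendsto_nhds_unique ht ht'
  rw [neg_eq_iff_eq_neg] at this
  rw [this]
  ring

/-- The value of the Meijer G-functions `G^{1,1}_{2,3}` which occur in the kernels. -/
def meijerP (N : ℕ) (a b x : ℝ) : ℝ :=
  ∑ j ∈ Finset.range N, rho N (a + b + 1) j / Real.Gamma (a + 1 + j) * x ^ j

/-- Apart from `1 / Γ(a + 1 + s)`, the Gamma quotient is the earlier one for the parameters `a + b`
and `0`, so its poles are `0, …, N - 1`. -/
theorem meijerIntegrand_loop (N : ℕ) (a b x : ℝ) {s : ℂ} (hs : s.im ≠ 0) :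
    meijerIntegrand [-N - a - b] [N] [0] [-a, -a - b] x s =
      (x : ℂ) ^ s * (Complex.Gamma ((a + 1 : ℝ) + s))⁻¹ *
        ((-1) ^ N + ∑ j ∈ Finset.range N, (rho N (a + b + 1) j : ℂ) / (j - s)) := by
  have h := meijerRat_eq_Gamma_ratio N (a + b) 0 hs
  simp only [meijerRat, add_zero, Complex.ofReal_zero, zero_add] at h
  rw [← h]
  simp only [meijerIntegrand, List.map_cons, List.map_nil, List.prod_cons, List.prod_nil, mul_one]
  push_cast
  rw [show (1 - (-N - a - b) + s : ℂ) = 1 + (a + b) + N + s by ring,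
    show (1 - (-a - b) + s : ℂ) = 1 + (a + b) + s by ring,
    show (1 - -a + s : ℂ) = a + 1 + s by ring]
  field_simp

theorem meijerG_eq_meijerP (N : ℕ) {a b x : ℝ} (hab : 0 < a + b + 1) (hx : 0 < x) :
    meijerG [-N - a - b] [N] [0] [-a, -a - b] x = meijerP N a b x := by
  have hN : (0 : ℝ) ≤ N := by positivity
  have hsp := meijerAbscissa_spec (a₁ := [-N - a - b]) (b₁ := [0]) (by
    obtain ⟨c, h1, h2⟩ := exists_between (show -N - a - b - 1 < 0 by linarith)
    exact ⟨c, by simpa using h1, by simpa using h2⟩)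
  simp only [List.mem_cons, List.not_mem_nil, or_false, forall_eq] at hsp
  set c := meijerAbscissa [-N - a - b] [0] with hc
  have hl := loopIntegral_cpow_mul_inv_Gamma N ((-1) ^ N) (fun j => (rho N (a + b + 1) j : ℂ))
    (a + 1) hsp.2 hx
  have he : loopIntegral c (meijerIntegrand [-N - a - b] [N] [0] [-a, -a - b] x) =
      loopIntegral c (fun s => (x : ℂ) ^ s * (Complex.Gamma ((a + 1 : ℝ) + s))⁻¹ *
        ((-1) ^ N + ∑ j ∈ Finset.range N, (rho N (a + b + 1) j : ℂ) / (j - s))) := by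
    unfold loopIntegral
    congr 1
    · congr 1
      · congr 1
        exact setIntegral_congr_fun measurableSet_Ioi fun σ _ =>
          meijerIntegrand_loop N a b x (by simp)
      · congr 1
        refine intervalIntegral.integral_congr_ae ?_
        filter_upwards [ae_im_ne_zero c] with τ hτ _ using meijerIntegrand_loop N a b x hτ
    · exact setIntegral_congr_fun measurableSet_Ioi fun σ _ =>
        meijerIntegrand_loop N a b x (by simp)
  unfold meijerG
  simp only [List.length_cons, List.length_nil]
  -- `p + q = 5` is not less than `2 (m + n) = 4`: the contour is the loop.
  rw [if_neg (by norm_num), ← hc]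
  change (2 * Real.pi * Complex.I)⁻¹ * loopIntegral c _ = _
  rw [he, hl, ← mul_assoc, inv_mul_cancel₀ Complex.two_pi_I_ne_zero, one_mul, meijerP]
  push_cast
  refine Finset.sum_congr rfl fun j _ => ?_
  rw [Complex.cpow_natCast, ← Complex.Gamma_ofReal]
  push_cast
  ring

end MeijerLoop

/-! ### Integrals over `0 < t < 1` by explicit primitives -/

section UnitIntervalIntegrals

open Filter Topology Asymptotics

theorem isBigO_rpow_mul {f g : ℝ → ℝ} {p q : ℝ} (hf : f =O[𝓝[>] 0] fun t : ℝ => t ^ p)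
    (hg : g =O[𝓝[>] 0] fun t : ℝ => t ^ q) :
    (fun t => f t * g t) =O[𝓝[>] 0] fun t : ℝ => t ^ (p + q) := by
  refine (hf.mul hg).trans_eventuallyEq ?_
  filter_upwards [self_mem_nhdsWithin] with t ht using (Real.rpow_add ht p q).symm

theorem intervalIntegrable_of_isBigO_rpow {f : ℝ → ℝ} {q : ℝ} (hq : -1 < q)
    (hc : ContinuousOn f (Ioi 0)) (hf : f =O[𝓝[>] 0] fun t : ℝ => t ^ q) :
    IntervalIntegrable f volume 0 1 := by
  obtain ⟨c, hc0, hci⟩ := mellin_convergent_zero_of_isBigO (b := -q) (s := 1)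
    (hc.aestronglyMeasurable measurableSet_Ioi) (by simpa using hf) (by linarith)
  have h1 : IntervalIntegrable f volume 0 c := by
    rw [intervalIntegrable_iff_integrableOn_Ioc_of_le hc0.le]
    simpa using hci
  refine h1.trans (ContinuousOn.intervalIntegrable (hc.mono fun t ht => ?_))
  have := (mem_uIcc.1 ht)
  rcases this with h | h
  · exact lt_of_lt_of_le hc0 h.1
  · exact lt_of_lt_of_le one_pos h.1

theorem integral_of_hasDerivAt_of_isBigO {f f' : ℝ → ℝ} {p q : ℝ} (hp : 0 < p) (hq : -1 < q)
    (hd : ∀ t, 0 < t → HasDerivAt f (f' t) t) (hc : ContinuousOn f' (Ioi 0))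
    (hf : f =O[𝓝[>] 0] fun t : ℝ => t ^ p) (hf' : f' =O[𝓝[>] 0] fun t : ℝ => t ^ q) :
    ∫ t in (0 : ℝ)..1, f' t = f 1 := by
  have h0 : Tendsto (fun t : ℝ => t ^ p) (𝓝[>] 0) (𝓝 0) := by
    have := (Real.continuousAt_rpow_const 0 p (Or.inr hp.le)).tendsto
    rw [Real.zero_rpow hp.ne'] at this
    exact this.mono_left nhdsWithin_le_nhds
  have := intervalIntegral.integral_eq_sub_of_hasDerivAt_of_tendsto zero_lt_one
    (fun t ht => hd t ht.1) (intervalIntegrable_of_isBigO_rpow hq hc hf') (hf.trans_tendsto h0)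
    ((hd 1 one_pos).continuousAt.tendsto.mono_left nhdsWithin_le_nhds)
  rw [this, sub_zero]

theorem isBigO_expInt_mul {β δ x : ℝ} (hx : 0 < x) (hδ : 0 < δ) (hβ : -β < δ) :
    (fun t => expInt β (t * x)) =O[𝓝[>] 0] fun t : ℝ => t ^ (-δ) := by
  obtain ⟨C, hC0, hC⟩ := exists_expInt_le hδ hβ
  refine IsBigO.of_bound (C * x ^ (-δ)) ?_
  filter_upwards [self_mem_nhdsWithin] with t ht
  have ht0 : 0 < t := ht
  rw [Real.norm_of_nonneg (expInt_nonneg _ _), Real.norm_of_nonneg (by positivity), mul_assoc,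
    mul_comm (x ^ (-δ)), ← Real.mul_rpow ht0.le hx.le]
  exact hC _ (by positivity)

theorem isBigO_exp_neg_mul (x : ℝ) {δ : ℝ} (hδ : 0 < δ) :
    (fun t => Real.exp (-(t * x))) =O[𝓝[>] 0] fun t : ℝ => t ^ (-δ) := by
  have h1 : (fun t : ℝ => Real.exp (-(t * x))) =O[𝓝[>] 0] fun _ => (1 : ℝ) := by
    have : Continuous fun t : ℝ => Real.exp (-(t * x)) := by fun_prop
    exact (this.tendsto 0).isBigO_one ℝ |>.mono nhdsWithin_le_nhds
  refine h1.trans (IsBigO.of_bound 1 ?_)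
  filter_upwards [Ioc_mem_nhdsGT one_pos] with t ht
  rw [norm_one, one_mul, Real.norm_of_nonneg (Real.rpow_nonneg ht.1.le _)]
  exact Real.one_le_rpow_of_pos_of_le_one_of_nonpos ht.1 ht.2 (by linarith)

theorem isBigO_meijerH (N : ℕ) (a : ℝ) {b δ x : ℝ} (hx : 0 < x) (hδ : 0 < δ) (hb : -b < δ) :
    (fun t => meijerH N a b (t * x)) =O[𝓝[>] 0] fun t : ℝ => t ^ (-δ) := by
  unfold meijerH
  refine ((isBigO_exp_neg_mul x hδ).const_mul_left _).add (IsBigO.fun_sum fun j _ => ?_)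
  refine (isBigO_expInt_mul hx hδ ?_).const_mul_left _
  have : (0 : ℝ) ≤ j := by positivity
  linarith

theorem continuousOn_expInt_mul (β : ℝ) {x : ℝ} (hx : 0 < x) :
    ContinuousOn (fun t => expInt β (t * x)) (Ioi 0) := fun _ ht =>
  (hasDerivAt_expInt_mul β hx ht).continuousAt.continuousWithinAt

theorem continuousOn_meijerH (N : ℕ) (a b : ℝ) {x : ℝ} (hx : 0 < x) :
    ContinuousOn (fun t => meijerH N a b (t * x)) (Ioi 0) := by
  unfold meijerH
  refine ContinuousOn.add (by fun_prop) (continuousOn_finsetSum _ fun j _ => ?_)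
  exact continuousOn_const.mul (continuousOn_expInt_mul _ hx)

theorem continuousOn_rpow_Ioi (α : ℝ) : ContinuousOn (fun t : ℝ => t ^ α) (Ioi 0) := fun t ht =>
  (Real.continuousAt_rpow_const t α (Or.inl (ne_of_gt ht))).continuousWithinAt

theorem intervalIntegrable_rpow_mul_meijerH (N : ℕ) {a b α x : ℝ} (hα : -1 < α)
    (hαb : 0 < α + b + 1) (hx : 0 < x) :
    IntervalIntegrable (fun t => t ^ α * meijerH N a b (t * x)) volume 0 1 := by
  obtain ⟨δ, h1, h2⟩ := exists_between (show max 0 (-b) < α + 1 from max_lt (by linarith)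
    (by linarith))
  rw [max_lt_iff] at h1
  exact intervalIntegrable_of_isBigO_rpow (q := α + -δ) (by linarith)
    ((continuousOn_rpow_Ioi α).mul (continuousOn_meijerH N a b hx))
    (isBigO_rpow_mul (isBigO_refl _ _) (isBigO_meijerH N a hx h1.1 h1.2))

/-- The primitive is `∑ ρ_j / (κ + i + j) t^(a+i+1) E_(b+j)(t x)` with `κ = a + b + 1`.
Differentiation cancels the denominators and leaves exponential terms, whose coefficients add up to
`(-1)^N` by `sum_rho_div`. -/
theorem integral_rpow_mul_meijerH {N i : ℕ} (hi : i < N) {a b x : ℝ} (ha : -1 < a)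
    (hab : 0 < a + b + 1) (hx : 0 < x) :
    ∫ t in (0 : ℝ)..1, t ^ (a + i) * meijerH N a b (t * x) =
      ∑ j ∈ Finset.range N, rho N (a + b + 1) j / (a + b + 1 + i + j) * expInt (b + j) x := by
  have hi0 : (0 : ℝ) ≤ i := by positivity
  -- `t^(-δ)` bounds the growth of the exponential integrals at `0`; the upper bound on `δ` makes
  -- the primitive vanish there.
  obtain ⟨δ, h1, h2⟩ := exists_between (show max 0 (-b) < a + i + 1 from max_lt (by linarith)
    (by linarith))
  rw [max_lt_iff] at h1
  have h := integral_of_hasDerivAt_of_isBigO (p := a + i + 1 + -δ) (q := a + i + -δ)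
    (f := fun t => ∑ j ∈ Finset.range N, rho N (a + b + 1) j / (a + b + 1 + i + j) *
      (t ^ (a + i + 1) * expInt (b + j) (t * x)))
    (f' := fun t => t ^ (a + i) * meijerH N a b (t * x)) (by linarith) (by linarith)
    (fun t ht => ?_)
    ((continuousOn_rpow_Ioi _).mul (continuousOn_meijerH N a b hx))
    (IsBigO.fun_sum fun j _ => ?_)
    (isBigO_rpow_mul (isBigO_refl _ _) (isBigO_meijerH N a hx h1.1 h1.2))
  · rw [h]
    simp
  · have hd : ∀ j ∈ Finset.range N, HasDerivAt (fun t => rho N (a + b + 1) j /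
        (a + b + 1 + i + j) * (t ^ (a + i + 1) * expInt (b + j) (t * x)))
        (rho N (a + b + 1) j * (t ^ (a + i) * expInt (b + j) (t * x)) -
          t ^ (a + i) * Real.exp (-(t * x)) * (rho N (a + b + 1) j / (a + b + 1 + i + j))) t := by
      intro j _
      have hj0 : (0 : ℝ) ≤ j := by positivity
      have hne : a + b + 1 + i + j ≠ 0 := by positivity
      have h3 := (((Real.hasDerivAt_rpow_const (p := a + i + 1) (Or.inl ht.ne')).fun_mul
        (hasDerivAt_expInt_mul (b + j) hx ht)).const_mul
          (rho N (a + b + 1) j / (a + b + 1 + i + j)))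
      refine h3.congr_deriv ?_
      rw [show a + i + 1 - 1 = a + i by ring, Real.rpow_add_one ht.ne']
      field_simp
      ring
    refine (HasDerivAt.fun_sum hd).congr_deriv ?_
    rw [Finset.sum_sub_distrib, ← Finset.mul_sum, sum_rho_div hi hab, meijerH, mul_add,
      Finset.mul_sum]
    rw [Finset.sum_congr rfl fun j _ => mul_left_comm _ _ _]
    ring
  · refine (isBigO_rpow_mul (isBigO_refl _ _) (isBigO_expInt_mul hx h1.1 ?_)).const_mul_left _
    have : (0 : ℝ) ≤ j := by positivity
    linarith

/-- The bilinear primitive `∑ ρ_i ρ_j / (κ + i + j) t E_(a+i)(t y) E_(b+j)(t x)`, with `κ = a + b +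
1`, has the derivative `H(t x) H(t y) - e^(-t (x + y))`, where the two `H` have the roles of `a` and
`b` exchanged. -/
theorem integral_meijerH_mul_meijerH (N : ℕ) {a b x y : ℝ} (ha : -1 < a) (hb : -1 < b)
    (hab : 0 < a + b + 1) (hx : 0 < x) (hy : 0 < y) :
    ∫ t in (0 : ℝ)..1, meijerH N a b (t * x) * meijerH N b a (t * y) =
      (1 - Real.exp (-(x + y))) / (x + y) +
      ∑ i ∈ Finset.range N, ∑ j ∈ Finset.range N, rho N (a + b + 1) i * rho N (a + b + 1) j /
        (a + b + 1 + i + j) * (expInt (a + i) y * expInt (b + j) x) := by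
  -- The hypotheses `a, b, a + b > -1` say that the two orders of growth `max 0 (-a)` and `max 0
  -- (-b)` add up to less than `1`. A third of the gap is given to each of them.
  obtain ⟨ε, hε, hab1, ha1, hb1⟩ : ∃ ε : ℝ, 0 < ε ∧ max 0 (-a) + max 0 (-b) + 2 * ε < 1 ∧
      -a < max 0 (-a) + ε ∧ -b < max 0 (-b) + ε := by
    refine ⟨(1 - (max 0 (-a) + max 0 (-b))) / 3, ?_, ?_, ?_, ?_⟩ <;>
    rcases le_total 0 (-a) with h | h <;> rcases le_total 0 (-b) with h' | h' <;>
    simp only [max_eq_left, max_eq_right, h, h'] <;> linarith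
  have hm1 : 0 ≤ max 0 (-a) := le_max_left _ _
  have hm2 : 0 ≤ max 0 (-b) := le_max_left _ _
  have hOa : ∀ i : ℕ, (fun t => expInt (a + i) (t * y)) =O[𝓝[>] 0]
      fun t : ℝ => t ^ (-(max 0 (-a) + ε)) := fun i =>
    isBigO_expInt_mul hy (by linarith) (by
      have : (0 : ℝ) ≤ i := by positivity
      linarith)
  have hOb : ∀ j : ℕ, (fun t => expInt (b + j) (t * x)) =O[𝓝[>] 0]
      fun t : ℝ => t ^ (-(max 0 (-b) + ε)) := fun i =>
    isBigO_expInt_mul hx (by linarith) (by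
      have : (0 : ℝ) ≤ i := by positivity
      linarith)
  have hint : IntervalIntegrable (fun t => meijerH N a b (t * x) * meijerH N b a (t * y))
      volume 0 1 := intervalIntegrable_of_isBigO_rpow (q := -(max 0 (-b) + ε) + -(max 0 (-a) + ε))
    (by linarith) ((continuousOn_meijerH N a b hx).mul (continuousOn_meijerH N b a hy))
    (isBigO_rpow_mul (isBigO_meijerH N a hx (by linarith) hb1)
      (isBigO_meijerH N b hy (by linarith) ha1))
  have hexp : ∫ t in (0 : ℝ)..1, Real.exp (-(t * (x + y))) =
      (1 - Real.exp (-(x + y))) / (x + y) := by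
    have hxy : x + y ≠ 0 := by positivity
    rw [intervalIntegral.integral_eq_sub_of_hasDerivAt
      (f := fun t => -Real.exp (-(t * (x + y))) / (x + y)) (fun t _ => ?_)
      (Continuous.intervalIntegrable (by fun_prop) _ _)]
    · simp
      ring
    · have h1 : HasDerivAt (fun t : ℝ => -(t * (x + y))) (-(x + y)) t := by
        simpa using ((hasDerivAt_id t).mul_const (x + y)).fun_neg
      refine (h1.exp.fun_neg.div_const (x + y)).congr_deriv ?_
      field_simp
  have hi2 : IntervalIntegrable (fun t => Real.exp (-(t * (x + y)))) volume 0 1 :=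
    Continuous.intervalIntegrable (by fun_prop) _ _
  have h := integral_of_hasDerivAt_of_isBigO (p := 1 + (-(max 0 (-a) + ε) + -(max 0 (-b) + ε)))
    (q := -(max 0 (-b) + ε) + -(max 0 (-a) + ε))
    (f := fun t => ∑ i ∈ Finset.range N, ∑ j ∈ Finset.range N, rho N (a + b + 1) i *
      rho N (a + b + 1) j / (a + b + 1 + i + j) *
        (t * (expInt (a + i) (t * y) * expInt (b + j) (t * x))))
    (f' := fun t => meijerH N a b (t * x) * meijerH N b a (t * y) - Real.exp (-(t * (x + y))))
    (by linarith) (by linarith) (fun t ht => ?_)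
    (((continuousOn_meijerH N a b hx).mul (continuousOn_meijerH N b a hy)).sub (by fun_prop))
    (IsBigO.fun_sum fun i _ => IsBigO.fun_sum fun j _ => ?_)
    ((isBigO_rpow_mul (isBigO_meijerH N a hx (by linarith) hb1)
      (isBigO_meijerH N b hy (by linarith) ha1)).sub ?_)
  · rw [intervalIntegral.integral_sub hint hi2, hexp, sub_eq_iff_eq_add'] at h
    rw [h]
    simp
  · have hd : ∀ i ∈ Finset.range N, ∀ j ∈ Finset.range N, HasDerivAt (fun t =>
        rho N (a + b + 1) i * rho N (a + b + 1) j / (a + b + 1 + i + j) *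
          (t * (expInt (a + i) (t * y) * expInt (b + j) (t * x))))
        (rho N (a + b + 1) i * expInt (a + i) (t * y) *
            (rho N (a + b + 1) j * expInt (b + j) (t * x)) -
          Real.exp (-(t * y)) * (rho N (a + b + 1) j * expInt (b + j) (t * x) *
            (rho N (a + b + 1) i / (a + b + 1 + j + i))) -
          Real.exp (-(t * x)) * (rho N (a + b + 1) i * expInt (a + i) (t * y) *
            (rho N (a + b + 1) j / (a + b + 1 + i + j)))) t := by
      intro i _ j _
      have hi0 : (0 : ℝ) ≤ i := by positivity
      have hj0 : (0 : ℝ) ≤ j := by positivity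
      have hne : a + b + 1 + i + j ≠ 0 := by positivity
      have h3 := ((hasDerivAt_id t).fun_mul ((hasDerivAt_expInt_mul (a + i) hy ht).fun_mul
        (hasDerivAt_expInt_mul (b + j) hx ht))).const_mul
          (rho N (a + b + 1) i * rho N (a + b + 1) j / (a + b + 1 + i + j))
      refine h3.congr_deriv ?_
      rw [show a + b + 1 + (j : ℝ) + i = a + b + 1 + i + j by ring]
      simp only [id]
      field_simp
      ring
    refine (HasDerivAt.fun_sum fun i hi => HasDerivAt.fun_sum fun j hj => hd i hi j hj).congr_deriv ?_
    simp only [Finset.sum_sub_distrib, ← Finset.mul_sum]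
    -- In each of the two mixed sums one index occurs only in `ρ / (κ + i + j)`; summed over first,
    -- it collapses by `sum_rho_div`.
    rw [Finset.sum_comm (s := Finset.range N) (f := fun i j => rho N (a + b + 1) j *
      expInt (b + j) (t * x) * (rho N (a + b + 1) i / (a + b + 1 + j + i)))]
    simp only [← Finset.mul_sum]
    have hS : ∀ g : ℕ → ℝ, ∑ i ∈ Finset.range N, g i *
        ∑ j ∈ Finset.range N, rho N (a + b + 1) j / (a + b + 1 + i + j) =
        ∑ i ∈ Finset.range N, g i * -(-1) ^ N := fun g => Finset.sum_congr rfl fun i hi => by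
      rw [sum_rho_div (Finset.mem_range.1 hi) hab]
    rw [hS fun i => rho N (a + b + 1) i * expInt (b + i) (t * x),
      hS fun i => rho N (a + b + 1) i * expInt (a + i) (t * y)]
    simp only [← Finset.sum_mul]
    rw [meijerH, meijerH, show b + a + 1 = a + b + 1 by ring,
      show -(t * (x + y)) = -(t * x) + -(t * y) by ring, Real.exp_add]
    have : ((-1 : ℝ) ^ N) * (-1) ^ N = 1 := by rw [← mul_pow]; simp
    linear_combination (-Real.exp (-(t * x)) * Real.exp (-(t * y))) * this
  · refine IsBigO.const_mul_left ?_ _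
    refine isBigO_rpow_mul ?_ (isBigO_rpow_mul (hOa i) (hOb j))
    simpa using isBigO_refl (fun t : ℝ => t) _
  · have := isBigO_exp_neg_mul (x + y) (δ := max 0 (-b) + ε + (max 0 (-a) + ε)) (by linarith)
    refine this.congr_right fun t => ?_
    congr 1
    ring

end UnitIntervalIntegrals

/-! ### The kernel of the Bures ensemble and its biorthogonality -/

section BuresKernel

/-- The coefficients of the kernels of the Cauchy two-matrix model. -/
def cauchyCoeff (N : ℕ) (a b : ℝ) (i j : ℕ) : ℝ :=
  rho N (a + b + 1) i * rho N (a + b + 1) j /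
    (Real.Gamma (a + 1 + i) * Real.Gamma (b + 1 + j) * (a + b + 1 + i + j))

theorem cauchyCoeff_swap (N : ℕ) (a b : ℝ) (i j : ℕ) :
    cauchyCoeff N b a i j = cauchyCoeff N a b j i := by
  unfold cauchyCoeff
  rw [show b + a + 1 = a + b + 1 by ring, show a + b + 1 + (j : ℝ) + i = a + b + 1 + i + j by ring]
  ring

/-- The data of the matrix kernel of the Bures ensemble. -/
def buresKernel (N : ℕ) (a : ℝ) : SkewKernel where
  N := N
  ω x := x ^ a * Real.exp (-x)
  -- For `a > -1` and `x > 0` this is the integral of `y^(a+1+j) e^(-y) / (x + y)` over `y > 0`, by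
  -- `integral_stieltjes`.
  U j x := Real.exp x * (Real.Gamma (a + 1 + 1 + j) * expInt (a + 1 + j) x)
  J i j := cauchyCoeff N a (a + 1) i j - cauchyCoeff N a (a + 1) j i
  c i := ∑ j ∈ Finset.range N, cauchyCoeff N a (a + 1) j i * Real.Gamma (a + 1 + j)
  J_skew i j := by ring
  J_zero i j h := by simp [cauchyCoeff, rho_of_le _ h]
  c_zero i h := by simp [cauchyCoeff, rho_of_le _ h]

variable {N : ℕ} {a : ℝ}

theorem Gamma_shift_pos (ha : -1 < a) (j : ℕ) : 0 < Real.Gamma (a + 1 + j) :=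
  Real.Gamma_pos_of_pos (by
    have : (0 : ℝ) ≤ j := by positivity
    linarith)

theorem Gamma_shift_add_one (ha : -1 < a) (j : ℕ) :
    Real.Gamma (a + 1 + 1 + j) = (a + 1 + j) * Real.Gamma (a + 1 + j) := by
  have : (0 : ℝ) ≤ j := by positivity
  rw [← Real.Gamma_add_one (by linarith)]
  congr 1
  ring

theorem buresKernel_c (ha : -1 < a) {i : ℕ} (hi : i < N) :
    (buresKernel N a).c i =
      -(-1) ^ N * (rho N (a + (a + 1) + 1) i / Real.Gamma (a + 1 + 1 + i)) := by
  have h := sum_rho_div hi (κ := a + (a + 1) + 1) (by linarith)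
  rw [← h, Finset.sum_mul]
  change ∑ j ∈ Finset.range N, cauchyCoeff N a (a + 1) j i * Real.Gamma (a + 1 + j) = _
  refine Finset.sum_congr rfl fun j _ => ?_
  have h1 := (Gamma_shift_pos ha j).ne'
  unfold cauchyCoeff
  rw [show a + (a + 1) + 1 + (i : ℝ) + j = a + (a + 1) + 1 + j + i by ring]
  field_simp

/-- The mixed moments of the weight and the functions `U`. -/
def buresMoment (a : ℝ) (i j : ℕ) : ℝ :=
  Real.Gamma (a + 1 + i) * Real.Gamma (a + 1 + 1 + j) / (a + (a + 1) + 1 + i + j)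

/-- Both halves of `J` reduce to the inverse Cauchy matrix. In the second one `Γ(a + 2 + j)` leaves
a factor `a + 1 + j = (2 a + 2 + i + j) - (a + 1 + i)`: the first summand cancels a denominator and
gives the term with `c`, the second adds to the other half. At `l = i` each half contributes `1`,
whence the `2`. -/
theorem sum_J_mul_buresMoment (ha : -1 < a) {l i : ℕ} (hl : l < N) (hi : i < N) :
    ∑ j ∈ Finset.range N, (buresKernel N a).J l j * buresMoment a i j =
      (if l = i then 2 else 0) - (buresKernel N a).c l * Real.Gamma (a + 1 + i) := by
  have hκ : 0 < a + (a + 1) + 1 := by linarith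
  have h1 := sum_rho_mul_rho hl hi hκ
  have h2 := sum_rho_div hl hκ
  have hgl := (Gamma_shift_pos ha l).ne'
  have hgl' : Real.Gamma (a + 1 + 1 + l) ≠ 0 := (Gamma_shift_pos (by linarith) l).ne'
  have hl0 : (0 : ℝ) ≤ l := by positivity
  have hi0 : (0 : ℝ) ≤ i := by positivity
  have hterm : ∀ j ∈ Finset.range N, (buresKernel N a).J l j * buresMoment a i j =
      (Real.Gamma (a + 1 + i) / Real.Gamma (a + 1 + l) +
          (a + 1 + i) * Real.Gamma (a + 1 + i) / Real.Gamma (a + 1 + 1 + l)) *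
        (rho N (a + (a + 1) + 1) l * rho N (a + (a + 1) + 1) j /
          ((a + (a + 1) + 1 + l + j) * (a + (a + 1) + 1 + i + j))) -
      rho N (a + (a + 1) + 1) l * Real.Gamma (a + 1 + i) / Real.Gamma (a + 1 + 1 + l) *
        (rho N (a + (a + 1) + 1) j / (a + (a + 1) + 1 + l + j)) := by
    intro j _
    have hj0 : (0 : ℝ) ≤ j := by positivity
    have h3 := (Gamma_shift_pos ha j).ne'
    have h4 : Real.Gamma (a + 1 + 1 + j) ≠ 0 := (Gamma_shift_pos (by linarith) j).ne'
    have h5 : a + (a + 1) + 1 + (l : ℝ) + j ≠ 0 := by positivity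
    have h6 : a + (a + 1) + 1 + (i : ℝ) + j ≠ 0 := by positivity
    have h7 : a + 1 + (j : ℝ) ≠ 0 := by
      have : 0 < a + 1 + (j : ℝ) := by linarith
      exact this.ne'
    have e1 : cauchyCoeff N a (a + 1) l j * buresMoment a i j =
        Real.Gamma (a + 1 + i) / Real.Gamma (a + 1 + l) *
        (rho N (a + (a + 1) + 1) l * rho N (a + (a + 1) + 1) j /
          ((a + (a + 1) + 1 + l + j) * (a + (a + 1) + 1 + i + j))) := by
      unfold cauchyCoeff buresMoment
      field_simp
    have e2 : cauchyCoeff N a (a + 1) j l * buresMoment a i j =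
        Real.Gamma (a + 1 + i) / Real.Gamma (a + 1 + 1 + l) *
        (rho N (a + (a + 1) + 1) l * rho N (a + (a + 1) + 1) j * (a + 1 + j) /
          ((a + (a + 1) + 1 + l + j) * (a + (a + 1) + 1 + i + j))) := by
      unfold cauchyCoeff buresMoment
      rw [Gamma_shift_add_one ha j,
        show a + (a + 1) + 1 + (j : ℝ) + l = a + (a + 1) + 1 + l + j by ring]
      field_simp
    change (cauchyCoeff N a (a + 1) l j - cauchyCoeff N a (a + 1) j l) * _ = _
    rw [sub_mul, e1, e2]
    field_simp
    ring
  rw [Finset.sum_congr rfl hterm, Finset.sum_sub_distrib, ← Finset.mul_sum, ← Finset.mul_sum, h1, h2,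
    buresKernel_c ha hl]
  by_cases h : l = i
  · subst h
    rw [if_pos rfl, if_pos rfl, ← Gamma_shift_add_one ha l, div_self hgl, div_self hgl']
    ring
  · rw [if_neg h, if_neg h]
    ring

theorem sum_buresMoment_mul_c (ha : -1 < a) {i : ℕ} (hi : i < N) :
    ∑ j ∈ Finset.range N, (buresKernel N a).c j * buresMoment a i j = Real.Gamma (a + 1 + i) := by
  have h2 := sum_rho_div hi (κ := a + (a + 1) + 1) (by linarith)
  have hterm : ∀ j ∈ Finset.range N, (buresKernel N a).c j * buresMoment a i j =
      -(-1) ^ N * Real.Gamma (a + 1 + i) *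
        (rho N (a + (a + 1) + 1) j / (a + (a + 1) + 1 + i + j)) := by
    intro j hj
    have h4 : Real.Gamma (a + 1 + 1 + j) ≠ 0 := (Gamma_shift_pos (by linarith) j).ne'
    rw [buresKernel_c ha (Finset.mem_range.1 hj), buresMoment]
    field_simp
  rw [Finset.sum_congr rfl hterm, ← Finset.mul_sum, h2]
  have : ((-1 : ℝ) ^ N) * (-1) ^ N = 1 := by rw [← mul_pow]; simp
  linear_combination Real.Gamma (a + 1 + i) * this

theorem integral_weight_mul_pow (ha : -1 < a) (i : ℕ) :
    IntegrableOn (fun y => (buresKernel N a).ω y * y ^ i) (Ioi 0) ∧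
      ∫ y in Ioi (0 : ℝ), (buresKernel N a).ω y * y ^ i = Real.Gamma (a + 1 + i) := by
  have hi0 : (0 : ℝ) ≤ i := by positivity
  have he : EqOn (fun y => Real.exp (-y) * y ^ (a + 1 + i - 1)) (fun y => (buresKernel N a).ω y * y ^ i)
      (Ioi 0) := by
    intro y hy
    have hy0 : 0 < y := hy
    simp only [buresKernel]
    rw [show a + 1 + i - 1 = a + i by ring, Real.rpow_add hy0, Real.rpow_natCast]
    ring
  refine ⟨(Real.GammaIntegral_convergent (by linarith)).congr_fun he measurableSet_Ioi, ?_⟩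
  rw [Real.Gamma_eq_integral (by linarith)]
  exact (setIntegral_congr_fun measurableSet_Ioi he).symm

theorem integral_weight_mul_U_mul_pow (ha : -1 < a) (i j : ℕ) :
    IntegrableOn (fun y => (buresKernel N a).ω y * (buresKernel N a).U j y * y ^ i) (Ioi 0) ∧
      ∫ y in Ioi (0 : ℝ), (buresKernel N a).ω y * (buresKernel N a).U j y * y ^ i =
        buresMoment a i j := by
  have hi0 : (0 : ℝ) ≤ i := by positivity
  have hj0 : (0 : ℝ) ≤ j := by positivity
  obtain ⟨h1, h2⟩ := integral_rpow_mul_expInt (β := a + 1 + j) (u := a + 1 + i) (by linarith)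
    (by linarith)
  have he : EqOn (fun y => Real.Gamma (a + 1 + 1 + j) * (y ^ (a + 1 + i - 1) * expInt (a + 1 + j) y))
      (fun y => (buresKernel N a).ω y * (buresKernel N a).U j y * y ^ i) (Ioi 0) := by
    intro y hy
    have hy0 : 0 < y := hy
    simp only [buresKernel]
    rw [show a + 1 + i - 1 = a + i by ring, Real.rpow_add hy0, Real.rpow_natCast, Real.exp_neg]
    field_simp
  refine ⟨IntegrableOn.congr_fun (h1.const_mul _) he measurableSet_Ioi, ?_⟩
  rw [← setIntegral_congr_fun measurableSet_Ioi he, integral_const_mul, h2, buresMoment]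
  rw [show a + 1 + i + (a + 1 + j) = a + (a + 1) + 1 + i + j by ring]
  ring

/-- `(x - y) / (x + y) = 2 x / (x + y) - 1`, and the recurrence turns `x` times the Stieltjes
transform with exponent `a + i` into `Γ(a + 1 + i) - U i x`. -/
theorem integral_weight_mul_pow_mul_div (ha : -1 < a) (i : ℕ) {x : ℝ} (hx : 0 < x) :
    IntegrableOn (fun y => (buresKernel N a).ω y * y ^ i * ((x - y) / (x + y))) (Ioi 0) ∧
      ∫ y in Ioi (0 : ℝ), (buresKernel N a).ω y * y ^ i * ((x - y) / (x + y)) =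
        Real.Gamma (a + 1 + i) - 2 * (buresKernel N a).U i x := by
  have hi0 : (0 : ℝ) ≤ i := by positivity
  obtain ⟨h1, h2⟩ := integral_stieltjes (β := a + i) (by linarith) hx
  obtain ⟨h3, h4⟩ := integral_weight_mul_pow (N := N) ha i
  have he : EqOn (fun y => 2 * x * (y ^ (a + i) * Real.exp (-y) / (x + y)) -
      (buresKernel N a).ω y * y ^ i)
      (fun y => (buresKernel N a).ω y * y ^ i * ((x - y) / (x + y))) (Ioi 0) := by
    intro y hy
    have hy0 : 0 < y := hy
    have hne : x + y ≠ 0 := by positivity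
    simp only [buresKernel]
    rw [Real.rpow_add hy0, Real.rpow_natCast]
    field_simp
    ring
  refine ⟨IntegrableOn.congr_fun ((h1.const_mul _).sub h3) he measurableSet_Ioi, ?_⟩
  rw [← setIntegral_congr_fun measurableSet_Ioi he, integral_sub (h1.const_mul _) h3,
    integral_const_mul, h2, h4]
  have h5 := mul_expInt_sub_one (a + 1 + i) hx
  rw [show a + 1 + (i : ℝ) - 1 = a + i by ring] at h5
  simp only [buresKernel]
  rw [Gamma_shift_add_one ha, show a + (i : ℝ) + 1 = a + 1 + i by ring]
  have h6 : Real.exp x * Real.exp (-x) = 1 := by rw [← Real.exp_add]; simp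
  linear_combination (2 * Real.Gamma (a + 1 + i) * Real.exp x) * h5 +
    2 * Real.Gamma (a + 1 + i) * h6

/-- The relations between the two copies are the inversion of the moment matrix. Within the first
copy, the part with `J` and `c` yields `-2 U i x` besides terms in `Γ(a + 1 + i)`, and the moment of
`(x - y) / (x + y)` cancels all of them. -/
theorem buresKernel_isReproducing (ha : -1 < a) : (buresKernel N a).IsReproducing := by
  set K := buresKernel N a with hK
  have hq : ∀ l i, (fun y => K.q l y * y ^ i) = fun y =>
      (∑ j ∈ Finset.range N, K.J l j * (K.ω y * K.U j y * y ^ i)) + K.c l * (K.ω y * y ^ i) := by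
    intro l i
    ext y
    simp only [SkewKernel.q]
    rw [mul_add, add_mul, Finset.mul_sum, Finset.sum_mul]
    congr 1
    · exact Finset.sum_congr rfl fun j _ => by ring
    · ring
  have hU := fun i j => integral_weight_mul_U_mul_pow (N := N) ha i j
  have hw := fun i => integral_weight_mul_pow (N := N) ha i
  have hsum : ∀ (f : ℕ → ℝ) i, Integrable (fun y => ∑ j ∈ Finset.range N,
      f j * (K.ω y * K.U j y * y ^ i)) (volume.restrict (Ioi 0)) := fun f i =>
    integrable_finsetSum _ fun j _ => (hU i j).1.const_mul _
  have hsum' : ∀ (f : ℕ → ℝ) i, ∫ y in Ioi (0 : ℝ), (∑ j ∈ Finset.range N,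
      f j * (K.ω y * K.U j y * y ^ i)) = ∑ j ∈ Finset.range N, f j * buresMoment a i j := by
    intro f i
    rw [integral_finsetSum _ fun j _ => (hU i j).1.const_mul _]
    exact Finset.sum_congr rfl fun j _ => by rw [integral_const_mul, (hU i j).2]
  have hE : ∀ x i, (fun y => K.entry (Sum.inl y) (Sum.inl x) * y ^ i) = fun y =>
      K.ω x * ((∑ l ∈ Finset.range N, (K.c l + ∑ j ∈ Finset.range N, K.J l j * K.U j x) *
        (K.ω y * K.U l y * y ^ i)) - (∑ l ∈ Finset.range N, K.c l * K.U l x) * (K.ω y * y ^ i) -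
        K.ω y * y ^ i * ((x - y) / (x + y))) := by
    intro x i
    ext y
    have e1 : ∑ l ∈ Finset.range N, (K.c l + ∑ j ∈ Finset.range N, K.J l j * K.U j x) *
        (K.ω y * K.U l y * y ^ i) = K.ω y * y ^ i * (∑ l ∈ Finset.range N, K.c l * K.U l y +
          ∑ l ∈ Finset.range N, ∑ j ∈ Finset.range N, K.U l y * K.J l j * K.U j x) := by
      rw [← Finset.sum_add_distrib, Finset.mul_sum]
      refine Finset.sum_congr rfl fun l _ => ?_
      rw [Finset.sum_congr rfl fun j _ => mul_assoc (K.U l y) (K.J l j) (K.U j x), ← Finset.mul_sum]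
      ring
    have e2 : ∑ j ∈ Finset.range N, K.c j * (K.U j y - K.U j x) =
        ∑ l ∈ Finset.range N, K.c l * K.U l y - ∑ l ∈ Finset.range N, K.c l * K.U l x := by
      rw [← Finset.sum_sub_distrib]
      exact Finset.sum_congr rfl fun l _ => by ring
    change (K.ω y * K.ω x * (∑ j ∈ Finset.range N, K.c j * (K.U j y - K.U j x) +
      ∑ l ∈ Finset.range N, ∑ j ∈ Finset.range N, K.U l y * K.J l j * K.U j x -
      (x - y) / (y + x))) * y ^ i = _
    rw [e1, e2, add_comm y x]
    ring
  refine ⟨fun l i _ _ => ?_, fun l i hl hi => ?_, fun x i hx _ => ?_, fun x i hx hi => ?_⟩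
  · rw [hq]
    exact (hsum _ i).add ((hw i).1.const_mul _)
  · simp only [hq]
    rw [integral_add (hsum _ i) ((hw i).1.const_mul _), hsum', integral_const_mul, (hw i).2,
      sum_J_mul_buresMoment ha (show l < N from hl) (show i < N from hi)]
    ring
  · rw [hE]
    exact (((hsum _ i).sub ((hw i).1.const_mul _)).sub
      (integral_weight_mul_pow_mul_div ha i hx).1).const_mul _
  · obtain ⟨h1, h2⟩ := integral_weight_mul_pow_mul_div (N := N) ha i hx
    have hsub : Integrable (fun y => (∑ l ∈ Finset.range N, (K.c l + ∑ j ∈ Finset.range N,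
        K.J l j * K.U j x) * (K.ω y * K.U l y * y ^ i)) -
        (∑ l ∈ Finset.range N, K.c l * K.U l x) * (K.ω y * y ^ i)) (volume.restrict (Ioi 0)) :=
      (hsum _ i).sub ((hw i).1.const_mul _)
    rw [hE, integral_const_mul, integral_sub hsub h1,
      integral_sub (hsum _ i) ((hw i).1.const_mul _), hsum', integral_const_mul, (hw i).2, h2]
    have e3 : ∑ l ∈ Finset.range N, (K.c l + ∑ j ∈ Finset.range N, K.J l j * K.U j x) *
        buresMoment a i l = Real.Gamma (a + 1 + i) +
          (Real.Gamma (a + 1 + i) * (∑ l ∈ Finset.range N, K.c l * K.U l x) - 2 * K.U i x) := by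
      simp only [add_mul, Finset.sum_add_distrib]
      rw [sum_buresMoment_mul_c ha (show i < N from hi)]
      congr 1
      simp only [Finset.sum_mul]
      rw [Finset.sum_comm]
      have e4 : ∀ j ∈ Finset.range N, ∑ l ∈ Finset.range N, K.J l j * K.U j x * buresMoment a i l =
          Real.Gamma (a + 1 + i) * (K.c j * K.U j x) - if j = i then 2 * K.U j x else 0 := by
        intro j hj
        have := sum_J_mul_buresMoment ha (Finset.mem_range.1 hj) (show i < N from hi)
        calc _ = -K.U j x * ∑ l ∈ Finset.range N, K.J j l * buresMoment a i l := by
              rw [Finset.mul_sum]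
              refine Finset.sum_congr rfl fun l _ => ?_
              rw [K.J_skew l j]
              ring
          _ = _ := by
              rw [this]
              split_ifs <;> ring
      rw [Finset.sum_congr rfl e4, Finset.sum_sub_distrib, ← Finset.mul_sum,
        Finset.sum_ite_eq', if_pos (Finset.mem_range.2 (show i < N from hi))]
    rw [e3]
    ring

end BuresKernel

/-! ### Closed forms of the kernels of the Cauchy two-matrix model -/

section CauchyKernels

variable {N : ℕ} {a b x y : ℝ}

theorem intervalIntegral_congr_Ioc {E : Type*} [NormedAddCommGroup E] [NormedSpace ℝ E]
    {f g : ℝ → E} (h : ∀ t, 0 < t → f t = g t) :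
    ∫ t in (0 : ℝ)..1, f t = ∫ t in (0 : ℝ)..1, g t := by
  rw [intervalIntegral.integral_of_le zero_le_one, intervalIntegral.integral_of_le zero_le_one]
  exact setIntegral_congr_fun measurableSet_Ioc fun t ht => h t ht.1

theorem cauchyK00_eq (hab : 0 < a + b + 1) (hx : 0 < x) (hy : 0 < y) :
    cauchyK00 N a b x y = ((∑ i ∈ Finset.range N, ∑ j ∈ Finset.range N,
      x ^ i * cauchyCoeff N a b i j * y ^ j : ℝ) : ℂ) := by
  have hG : ∀ t : ℝ, 0 < t → ((t ^ (a + b) : ℝ) : ℂ) *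
      meijerG [-N - a - b] [N] [0] [-a, -a - b] (t * x) *
      meijerG [-N - a - b] [N] [0] [-b, -a - b] (t * y) =
      ((∑ i ∈ Finset.range N, ∑ j ∈ Finset.range N, rho N (a + b + 1) i * rho N (a + b + 1) j /
        (Real.Gamma (a + 1 + i) * Real.Gamma (b + 1 + j)) * x ^ i * y ^ j *
          t ^ (a + b + i + j) : ℝ) : ℂ) := by
    intro t ht
    -- The second factor is the first one with `a` and `b` exchanged, up to the order of the
    -- parameters in the sums.
    have h2 := meijerG_eq_meijerP N (a := b) (b := a) (by linarith) (mul_pos ht hy)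
    rw [show (-(N : ℝ) - b - a) = -N - a - b by ring, show -b - a = -a - b by ring] at h2
    rw [meijerG_eq_meijerP N hab (mul_pos ht hx), h2, ← Complex.ofReal_mul, ← Complex.ofReal_mul,
      meijerP, meijerP, show b + a + 1 = a + b + 1 by ring, mul_assoc, Finset.sum_mul_sum,
      Finset.mul_sum]
    congr 1
    refine Finset.sum_congr rfl fun i _ => ?_
    rw [Finset.mul_sum]
    refine Finset.sum_congr rfl fun j _ => ?_
    rw [Real.rpow_add ht _ (j : ℝ), Real.rpow_add ht _ (i : ℝ), Real.rpow_natCast,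
      Real.rpow_natCast, mul_pow, mul_pow]
    ring
  unfold cauchyK00
  rw [intervalIntegral_congr_Ioc hG, intervalIntegral.integral_ofReal]
  congr 1
  have hij : ∀ i j : ℕ, -1 < a + b + i + j := fun i j => by
    have hi0 : (0 : ℝ) ≤ i := by positivity
    have hj0 : (0 : ℝ) ≤ j := by positivity
    linarith
  have hi : ∀ i j : ℕ, ∀ u : ℝ, IntervalIntegrable (fun t : ℝ => u * t ^ (a + b + i + j)) volume 0 1 :=
    fun i j u => (intervalIntegral.intervalIntegrable_rpow' (hij i j)).const_mul u
  have hi' : ∀ i : ℕ, ∀ u : ℕ → ℝ, IntervalIntegrable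
      (fun t : ℝ => ∑ j ∈ Finset.range N, u j * t ^ (a + b + i + j)) volume 0 1 := fun i u => by
    have := IntervalIntegrable.sum (Finset.range N) fun j _ => hi i j (u j)
    simpa only [Finset.sum_fn] using this
  rw [intervalIntegral.integral_finsetSum fun i _ => hi' i _]
  refine Finset.sum_congr rfl fun i _ => ?_
  rw [intervalIntegral.integral_finsetSum fun j _ => hi i j _]
  refine Finset.sum_congr rfl fun j _ => ?_
  rw [intervalIntegral.integral_const_mul, integral_rpow (Or.inl (hij i j)), Real.one_rpow,
    Real.zero_rpow (by linarith [hij i j]), cauchyCoeff]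
  rw [show a + b + i + j + 1 = a + b + 1 + i + (j : ℝ) by ring]
  have := hij i j
  have h1 : a + b + 1 + (i : ℝ) + j ≠ 0 := by linarith
  field_simp
  ring

theorem cauchyK01_eq (ha : -1 < a) (hab : 0 < a + b + 1) (hb : -1 < b) (hx : 0 < x) (hy : 0 < y) :
    cauchyK01 N a b x y = ((∑ i ∈ Finset.range N, y ^ i * ∑ j ∈ Finset.range N,
      cauchyCoeff N a b i j * (x ^ a * (Real.Gamma (b + 1 + j) * expInt (b + j) x)) : ℝ) : ℂ) := by
  have hG : ∀ t : ℝ, 0 < t → ((t ^ (a + b) : ℝ) : ℂ) *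
      meijerG [-N - a - b] [N] [0] [-a, -a - b] (t * y) *
      meijerG [-N - a - b] [N] [0, -b] [-a - b] (t * x) =
      ((∑ i ∈ Finset.range N, rho N (a + b + 1) i / Real.Gamma (a + 1 + i) * y ^ i * x ^ (-b) *
        (t ^ (a + i) * meijerH N a b (t * x)) : ℝ) : ℂ) := by
    intro t ht
    rw [meijerG_eq_meijerP N hab (mul_pos ht hy),
      meijerG_eq_rpow_mul_meijerH N ha hab (mul_pos ht hx), ← Complex.ofReal_mul,
      ← Complex.ofReal_mul, meijerP, Finset.mul_sum, Finset.sum_mul]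
    congr 1
    refine Finset.sum_congr rfl fun i _ => ?_
    rw [Real.rpow_add ht, Real.rpow_add ht, Real.rpow_natCast, Real.mul_rpow ht.le hx.le, mul_pow,
      Real.rpow_neg ht.le]
    have : t ^ b ≠ 0 := (Real.rpow_pos_of_pos ht b).ne'
    field_simp
  unfold cauchyK01
  rw [intervalIntegral_congr_Ioc hG, intervalIntegral.integral_ofReal, ← Complex.ofReal_mul]
  congr 1
  have hint : ∀ i : ℕ, ∀ u : ℝ, IntervalIntegrable (fun t : ℝ => u *
      (t ^ (a + i) * meijerH N a b (t * x))) volume 0 1 := fun i u => by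
    have hi0 : (0 : ℝ) ≤ i := by positivity
    exact (intervalIntegrable_rpow_mul_meijerH N (by linarith) (by linarith) hx).const_mul u
  rw [intervalIntegral.integral_finsetSum fun i _ => hint i _, Finset.mul_sum]
  refine Finset.sum_congr rfl fun i hi => ?_
  rw [intervalIntegral.integral_const_mul, integral_rpow_mul_meijerH (Finset.mem_range.1 hi) ha hab hx,
    Finset.mul_sum, Finset.mul_sum, Finset.mul_sum]
  refine Finset.sum_congr rfl fun j _ => ?_
  have h1 : Real.Gamma (b + 1 + j) ≠ 0 := (Gamma_shift_pos hb j).ne'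
  have h2 : x ^ b ≠ 0 := (Real.rpow_pos_of_pos hx b).ne'
  rw [cauchyCoeff, Real.rpow_add hx, Real.rpow_neg hx.le]
  field_simp

theorem cauchyK10_eq_cauchyK01 (N : ℕ) (a b x y : ℝ) : cauchyK10 N a b x y = cauchyK01 N b a y x := by
  unfold cauchyK10 cauchyK01
  rw [show (-(N : ℝ) - b - a) = -N - a - b by ring, show -b - a = -a - b by ring, add_comm b a]
  congr 2
  ext t
  ring

/-- The term `1 / (x + y)` in the value of the integral cancels the explicit term of the kernel, so
that only the exponential part survives. -/
theorem cauchyK11_eq (ha : -1 < a) (hab : 0 < a + b + 1) (hb : -1 < b) (hx : 0 < x) (hy : 0 < y) :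
    cauchyK11 N a b x y = ((x ^ a * y ^ b * (-Real.exp (-(x + y)) / (x + y) +
      ∑ i ∈ Finset.range N, ∑ j ∈ Finset.range N, cauchyCoeff N a b i j *
        ((Real.Gamma (a + 1 + i) * expInt (a + i) y) *
          (Real.Gamma (b + 1 + j) * expInt (b + j) x))) : ℝ) : ℂ) := by
  have hG : ∀ t : ℝ, 0 < t → meijerG [-a - N] [N + b] [0, b] [-a] (t * x) *
      meijerG [-b - N] [N + a] [0, a] [-b] (t * y) =
      ((meijerH N a b (t * x) * meijerH N b a (t * y) : ℝ) : ℂ) := by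
    intro t ht
    rw [meijerG_eq_meijerH N ha hab (mul_pos ht hx),
      meijerG_eq_meijerH N hb (by linarith) (mul_pos ht hy), Complex.ofReal_mul]
  unfold cauchyK11
  rw [intervalIntegral_congr_Ioc hG, intervalIntegral.integral_ofReal,
    integral_meijerH_mul_meijerH N ha hb hab hx hy, ← Complex.ofReal_mul, ← Complex.ofReal_neg,
    ← Complex.ofReal_add]
  congr 1
  have hS : ∑ i ∈ Finset.range N, ∑ j ∈ Finset.range N, cauchyCoeff N a b i j *
        ((Real.Gamma (a + 1 + i) * expInt (a + i) y) *
          (Real.Gamma (b + 1 + j) * expInt (b + j) x)) =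
      ∑ i ∈ Finset.range N, ∑ j ∈ Finset.range N, rho N (a + b + 1) i * rho N (a + b + 1) j /
        (a + b + 1 + i + j) * (expInt (a + i) y * expInt (b + j) x) := by
    refine Finset.sum_congr rfl fun i _ => Finset.sum_congr rfl fun j _ => ?_
    have h1 : Real.Gamma (b + 1 + j) ≠ 0 := (Gamma_shift_pos hb j).ne'
    have h2 : Real.Gamma (a + 1 + i) ≠ 0 := (Gamma_shift_pos ha i).ne'
    rw [cauchyCoeff]
    field_simp
  rw [hS]
  ring

end CauchyKernels

/-! ### Identification of the kernels with the entries of `buresKernel` -/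

section BuresEntries

variable {N : ℕ} {a x y : ℝ}

theorem rpow_mul_Gamma_mul_expInt (N : ℕ) (a x : ℝ) (j : ℕ) :
    x ^ a * (Real.Gamma (a + 1 + 1 + j) * expInt (a + 1 + j) x) =
      (buresKernel N a).ω x * (buresKernel N a).U j x := by
  simp only [buresKernel]
  rw [Real.exp_neg]
  field_simp

/-- Here `b = a + 1` is essential: the recurrence expresses `E_(a+j)` through `E_(a+1+j)`, so the
functions of the second matrix are those of the first up to a sign and a constant. -/
theorem rpow_add_one_mul_Gamma_mul_expInt (ha : -1 < a) (hx : 0 < x) (j : ℕ) :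
    x ^ (a + 1) * (Real.Gamma (a + 1 + j) * expInt (a + j) x) =
      (buresKernel N a).ω x * (Real.Gamma (a + 1 + j) - (buresKernel N a).U j x) := by
  have h5 := mul_expInt_sub_one (a + 1 + j) hx
  rw [show a + 1 + (j : ℝ) - 1 = a + j by ring] at h5
  simp only [buresKernel]
  rw [Gamma_shift_add_one ha, Real.rpow_add_one hx.ne']
  have h6 : Real.exp x * Real.exp (-x) = 1 := by rw [← Real.exp_add]; simp
  linear_combination (x ^ a * Real.Gamma (a + 1 + j)) * h5 +
    x ^ a * Real.Gamma (a + 1 + j) * (a + 1 + j) * expInt (a + 1 + j) x * h6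

theorem deltaK00_eq_entry (ha : -1 < a) (hx : 0 < x) (hy : 0 < y) :
    deltaK00 N a (a + 1) x y = (buresKernel N a).entry (Sum.inr x) (Sum.inr y) := by
  unfold deltaK00
  rw [cauchyK00_eq (by linarith) hx hy, cauchyK00_eq (by linarith) hy hx,
    ← Complex.ofReal_sub]
  congr 1
  rw [Finset.sum_comm (f := fun i j => y ^ i * cauchyCoeff N a (a + 1) i j * x ^ j),
    ← Finset.sum_sub_distrib]
  refine Finset.sum_congr rfl fun i _ => ?_
  rw [← Finset.sum_sub_distrib]
  refine Finset.sum_congr rfl fun j _ => ?_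
  simp only [buresKernel]
  ring

/-- The opposite signs of `U j` in the two kernels produce the skew matrix `J`, and the constants
`Γ(a + 1 + j)` add up to `c`. -/
theorem sigmaK01_eq_entry (ha : -1 < a) (hx : 0 < x) (hy : 0 < y) :
    sigmaK01 N a (a + 1) x y = (buresKernel N a).entry (Sum.inl x) (Sum.inr y) := by
  unfold sigmaK01
  rw [cauchyK10_eq_cauchyK01, cauchyK01_eq ha (by linarith) (by linarith) hx hy,
    cauchyK01_eq (a := a + 1) (b := a) (by linarith) (by linarith) ha hx hy, ← Complex.ofReal_add]
  congr 1
  simp only [rpow_mul_Gamma_mul_expInt N a x, rpow_add_one_mul_Gamma_mul_expInt (N := N) ha hx,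
    cauchyCoeff_swap N a (a + 1)]
  rw [← Finset.sum_add_distrib]
  refine Finset.sum_congr rfl fun l _ => ?_
  rw [← mul_add, ← Finset.sum_add_distrib, SkewKernel.q, mul_add]
  congr 1
  change _ = (buresKernel N a).ω x * (∑ j ∈ Finset.range N, (cauchyCoeff N a (a + 1) l j -
    cauchyCoeff N a (a + 1) j l) * (buresKernel N a).U j x) + (buresKernel N a).ω x *
      ∑ j ∈ Finset.range N, cauchyCoeff N a (a + 1) j l * Real.Gamma (a + 1 + j)
  rw [← mul_add, ← Finset.sum_add_distrib, Finset.mul_sum]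
  exact Finset.sum_congr rfl fun j _ => by ring

theorem cauchyK11_eq_bures (ha : -1 < a) (hx : 0 < x) (hy : 0 < y) :
    cauchyK11 N a (a + 1) x y = (((buresKernel N a).ω x * (buresKernel N a).ω y *
      (∑ j ∈ Finset.range N, (buresKernel N a).c j * (buresKernel N a).U j x -
        ∑ i ∈ Finset.range N, ∑ j ∈ Finset.range N, (buresKernel N a).U i y *
          cauchyCoeff N a (a + 1) i j * (buresKernel N a).U j x - y / (x + y)) : ℝ) : ℂ) := by
  rw [cauchyK11_eq ha (by linarith) (by linarith) hx hy]
  congr 1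
  have e1 : ∑ j ∈ Finset.range N, (buresKernel N a).c j * (buresKernel N a).U j x =
      ∑ i ∈ Finset.range N, ∑ j ∈ Finset.range N, cauchyCoeff N a (a + 1) i j *
        Real.Gamma (a + 1 + i) * (buresKernel N a).U j x := by
    rw [Finset.sum_comm]
    refine Finset.sum_congr rfl fun j _ => ?_
    rw [← Finset.sum_mul]
    rfl
  rw [e1, ← Finset.sum_sub_distrib, mul_add, mul_sub, Finset.mul_sum, Finset.mul_sum, add_comm,
    sub_eq_add_neg]
  congr 1
  · refine Finset.sum_congr rfl fun i _ => ?_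
    rw [← Finset.sum_sub_distrib, Finset.mul_sum, Finset.mul_sum]
    refine Finset.sum_congr rfl fun j _ => ?_
    have h1 := rpow_mul_Gamma_mul_expInt N a x j
    have h2 := rpow_add_one_mul_Gamma_mul_expInt (N := N) ha hy i
    calc _ = cauchyCoeff N a (a + 1) i j * ((y ^ (a + 1) * (Real.Gamma (a + 1 + i) *
          expInt (a + i) y)) * (x ^ a * (Real.Gamma (a + 1 + 1 + j) * expInt (a + 1 + j) x))) := by
            ring
      _ = _ := by
            rw [h1, h2]
            ring
  · simp only [buresKernel]
    rw [neg_add, Real.exp_add, Real.rpow_add_one hy.ne']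
    ring

/-- Antisymmetrising `-y / (x + y)` gives `-(y - x) / (x + y)`, the entry of Schur's matrix. -/
theorem deltaK11_eq_entry (ha : -1 < a) (hx : 0 < x) (hy : 0 < y) :
    deltaK11 N a (a + 1) x y = (buresKernel N a).entry (Sum.inl x) (Sum.inl y) := by
  unfold deltaK11
  rw [cauchyK11_eq_bures ha hx hy, cauchyK11_eq_bures ha hy hx, ← Complex.ofReal_sub]
  congr 1
  set K := buresKernel N a with hK
  change _ = K.ω x * K.ω y * (∑ j ∈ Finset.range N, K.c j * (K.U j x - K.U j y) +
      ∑ i ∈ Finset.range N, ∑ j ∈ Finset.range N, K.U i x * (cauchyCoeff N a (a + 1) i j -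
        cauchyCoeff N a (a + 1) j i) * K.U j y - (y - x) / (x + y))
  have e1 : ∑ j ∈ Finset.range N, K.c j * (K.U j x - K.U j y) =
      ∑ j ∈ Finset.range N, K.c j * K.U j x - ∑ j ∈ Finset.range N, K.c j * K.U j y := by
    rw [← Finset.sum_sub_distrib]
    exact Finset.sum_congr rfl fun j _ => by ring
  have e2 : ∑ i ∈ Finset.range N, ∑ j ∈ Finset.range N, K.U i x * (cauchyCoeff N a (a + 1) i j -
        cauchyCoeff N a (a + 1) j i) * K.U j y =
      ∑ i ∈ Finset.range N, ∑ j ∈ Finset.range N, K.U i x * cauchyCoeff N a (a + 1) i j * K.U j y -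
      ∑ i ∈ Finset.range N, ∑ j ∈ Finset.range N, K.U i y * cauchyCoeff N a (a + 1) i j *
        K.U j x := by
    rw [Finset.sum_comm (f := fun i j => K.U i y * cauchyCoeff N a (a + 1) i j * K.U j x),
      ← Finset.sum_sub_distrib]
    refine Finset.sum_congr rfl fun i _ => ?_
    rw [← Finset.sum_sub_distrib]
    exact Finset.sum_congr rfl fun j _ => by ring
  rw [e1, e2, add_comm y x]
  ring

end BuresEntries

/-! ### Positivity, measurability and integrability of the weight -/

section BuresWeight

variable {a : ℝ} {n : ℕ}

theorem measurable_buresWeight (a : ℝ) (n : ℕ) :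
    Measurable fun z : Fin n → ℝ => buresWeight a z := by
  unfold buresWeight vandermondeProd
  refine Measurable.mul (Measurable.div ?_ ?_) ?_
  · refine Measurable.pow_const ?_ 2
    refine Finset.measurable_fun_prod _ fun i _ => Finset.measurable_fun_prod _ fun j _ => ?_
    fun_prop
  · refine Finset.measurable_fun_prod _ fun i _ => Finset.measurable_fun_prod _ fun j _ => ?_
    fun_prop
  · refine Finset.measurable_fun_prod _ fun i _ => ?_
    fun_prop

theorem buresWeight_nonneg (a : ℝ) {z : Fin n → ℝ} (hz : ∀ i, 0 < z i) : 0 ≤ buresWeight a z := by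
  unfold buresWeight
  refine mul_nonneg (div_nonneg (sq_nonneg _) (sumProd_pos hz).le) (Finset.prod_nonneg fun i _ => ?_)
  have := hz i
  positivity

theorem buresWeight_comp_cast (a : ℝ) {m : ℕ} (h : n = m) (z : Fin m → ℝ) :
    buresWeight a (z ∘ Fin.cast h) = buresWeight a z := by
  subst h
  rfl

/-- Each factor `(z j - z i)² / (z i + z j)` is at most `z i + z j`, hence at most `(1 + z i) (1 + z
j)`. Extending the product to all ordered pairs gives a dominating product of functions of one
variable. -/
theorem buresWeight_le (a : ℝ) {z : Fin n → ℝ} (hz : ∀ i, 0 < z i) :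
    buresWeight a z ≤ ∏ i, (1 + z i) ^ (2 * n) * (z i ^ a * Real.exp (-z i)) := by
  have h1 : vandermondeProd z ^ 2 / (∏ i, ∏ j ∈ Finset.Ioi i, (z i + z j)) ≤
      ∏ i, (1 + z i) ^ (2 * n) := by
    calc vandermondeProd z ^ 2 / (∏ i, ∏ j ∈ Finset.Ioi i, (z i + z j))
        = ∏ i, ∏ j ∈ Finset.Ioi i, ((z j - z i) ^ 2 / (z i + z j)) := by
          unfold vandermondeProd
          simp only [Finset.prod_div_distrib, Finset.prod_pow]
      _ ≤ ∏ i, ∏ j ∈ Finset.Ioi i, ((1 + z i) * (1 + z j)) := by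
          refine Finset.prod_le_prod (fun i _ => Finset.prod_nonneg fun j _ => ?_) fun i _ =>
            Finset.prod_le_prod (fun j _ => ?_) fun j _ => ?_
          · exact div_nonneg (sq_nonneg _) (add_pos (hz i) (hz j)).le
          · exact div_nonneg (sq_nonneg _) (add_pos (hz i) (hz j)).le
          · rw [div_le_iff₀ (add_pos (hz i) (hz j))]
            have hi := hz i
            have hj := hz j
            have : (0 : ℝ) ≤ z i * z j * (z i + z j) := by positivity
            nlinarith [mul_pos hi hj]
      _ ≤ ∏ i, ∏ j, ((1 + z i) * (1 + z j)) := by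
          refine Finset.prod_le_prod (fun i _ => Finset.prod_nonneg fun j _ => ?_) fun i _ =>
            Finset.prod_le_prod_of_subset_of_one_le (Finset.subset_univ _) (fun j _ => ?_)
              fun j _ _ => ?_
          all_goals
            have hi := hz i
            have hj := hz j
            first
            | positivity
            | nlinarith [mul_pos hi hj]
      _ = ∏ i, (1 + z i) ^ (2 * n) := by
          simp only [Finset.prod_mul_distrib, Finset.prod_const, Finset.card_univ, Fintype.card_fin]
          rw [Finset.prod_pow, ← pow_add, ← two_mul, Finset.prod_pow]
  unfold buresWeight
  refine (mul_le_mul_of_nonneg_right h1 (Finset.prod_nonneg fun i _ => ?_)).trans_eq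
    Finset.prod_mul_distrib.symm
  have := hz i
  positivity

theorem integrableOn_one_add_pow_mul (ha : -1 < a) (n : ℕ) :
    IntegrableOn (fun x : ℝ => (1 + x) ^ n * (x ^ a * Real.exp (-x))) (Ioi 0) := by
  have he : EqOn (fun x : ℝ => ∑ l ∈ Finset.range (n + 1), (n.choose l : ℝ) *
      (x ^ (a + l) * Real.exp (-(1 * x)))) (fun x : ℝ => (1 + x) ^ n * (x ^ a * Real.exp (-x)))
      (Ioi 0) := by
    intro x hx
    have hx0 : 0 < x := hx
    simp only
    rw [add_comm 1 x, add_pow, Finset.sum_mul]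
    refine Finset.sum_congr rfl fun l _ => ?_
    rw [Real.rpow_add hx0, Real.rpow_natCast, one_mul]
    ring
  refine IntegrableOn.congr_fun (integrable_finsetSum _ fun l _ => Integrable.const_mul ?_ _) he
    measurableSet_Ioi
  exact integrableOn_rpow_mul_exp_neg_Ioi_zero (by
    have : (0 : ℝ) ≤ l := by positivity
    linarith) one_pos

theorem restrict_posOrthant (n : ℕ) : (volume : Measure (Fin n → ℝ)).restrict (posOrthant n) =
    Measure.pi fun _ : Fin n => (volume : Measure ℝ).restrict (Ioi 0) := by
  rw [← Measure.restrict_pi_pi, volume_pi]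
  congr 1
  ext z
  simp [posOrthant]

theorem measurableSet_posOrthant (n : ℕ) : MeasurableSet (posOrthant n) := by
  have : posOrthant n = Set.univ.pi fun _ : Fin n => Ioi (0 : ℝ) := by
    ext z
    simp [posOrthant]
  rw [this]
  exact MeasurableSet.univ_pi fun _ => measurableSet_Ioi

theorem ae_pi_pos (n : ℕ) : ∀ᵐ z ∂(Measure.pi fun _ : Fin n =>
    (volume : Measure ℝ).restrict (Ioi 0)), ∀ i, 0 < z i := by
  rw [← restrict_posOrthant]
  exact ae_restrict_mem (measurableSet_posOrthant n)

theorem append_pos {k m : ℕ} {z : Fin k → ℝ} {u : Fin m → ℝ} (hz : ∀ i, 0 < z i)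
    (hu : ∀ i, 0 < u i) (i : Fin (k + m)) : 0 < Fin.append z u i := by
  refine Fin.addCases (fun i => ?_) (fun i => ?_) i
  · simpa using hz i
  · simpa using hu i

theorem measurable_append {k m : ℕ} (z : Fin k → ℝ) :
    Measurable fun u : Fin m → ℝ => Fin.append z u := by
  refine measurable_pi_iff.2 fun i => ?_
  refine Fin.addCases (fun i => ?_) (fun i => ?_) i
  · simp
  · simp only [Fin.append_right]
    fun_prop

theorem integrable_buresWeight_append (ha : -1 < a) {k m : ℕ} (z : Fin k → ℝ)
    (hz : ∀ i, 0 < z i) :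
    Integrable (fun u : Fin m → ℝ => buresWeight a (Fin.append z u))
      (Measure.pi fun _ : Fin m => (volume : Measure ℝ).restrict (Ioi 0)) := by
  have hint : Integrable (fun u : Fin m → ℝ =>
      (∏ i, (1 + z i) ^ (2 * (k + m)) * (z i ^ a * Real.exp (-z i))) *
      ∏ i, (1 + u i) ^ (2 * (k + m)) * (u i ^ a * Real.exp (-u i)))
      (Measure.pi fun _ : Fin m => (volume : Measure ℝ).restrict (Ioi 0)) :=
    (Integrable.fintype_prod (f := fun (_ : Fin m) (x : ℝ) =>
      (1 + x) ^ (2 * (k + m)) * (x ^ a * Real.exp (-x)))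
      fun _ => integrableOn_one_add_pow_mul ha _).const_mul _
  refine hint.mono' ((measurable_buresWeight a _).comp (measurable_append z)).aestronglyMeasurable ?_
  filter_upwards [ae_pi_pos m] with u hu
  have hpos := append_pos hz hu
  rw [Real.norm_of_nonneg (buresWeight_nonneg a hpos)]
  refine (buresWeight_le a hpos).trans_eq ?_
  rw [Fin.prod_univ_add]
  simp

theorem integral_pi_succ {m : ℕ} {μ : Measure ℝ} [SigmaFinite μ] {f : (Fin (m + 1) → ℝ) → ℝ}
    (hf : Integrable f (Measure.pi fun _ => μ)) :
    ∫ u, f u ∂(Measure.pi fun _ => μ) =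
      ∫ y, ∫ u, f (Fin.cons y u) ∂(Measure.pi fun _ : Fin m => μ) ∂μ := by
  have hmp := (measurePreserving_piFinSuccAbove (fun _ : Fin (m + 1) => μ) 0).symm
  have hemb := (MeasurableEquiv.piFinSuccAbove (fun _ : Fin (m + 1) => ℝ) 0).symm.measurableEmbedding
  rw [← hmp.integral_comp hemb, integral_prod (fun p => f ((MeasurableEquiv.piFinSuccAbove
    (fun _ : Fin (m + 1) => ℝ) 0).symm p)) ((hmp.integrable_comp_emb hemb).2 hf)]
  refine integral_congr_ae (Filter.Eventually.of_forall fun y => ?_)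
  refine integral_congr_ae (Filter.Eventually.of_forall fun u => ?_)
  simp [MeasurableEquiv.piFinSuccAbove, Fin.insertNthEquiv]

end BuresWeight

/-! ### Correlation functions by successive integration -/

section CorrelationFunctions

variable {N : ℕ} {a : ℝ}

/-- One constant serves all `n` equal to `N`, so that it applies to tuples whose length equals `N`
only propositionally. -/
theorem exists_pfSum_eq_buresWeight (N : ℕ) (a : ℝ) : ∃ κ : ℝ, ∀ n, n = N → ∀ z : Fin n → ℝ,
    (∀ i, 0 < z i) → pfSum ((buresKernel N a).matrix z) = κ * buresWeight a z := by
  obtain ⟨κ, hκ⟩ := (buresKernel N a).exists_pfSum_matrix_eq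
  refine ⟨κ, ?_⟩
  rintro n rfl z hz
  exact hκ z hz

theorem integral_pfSum_snoc (ha : -1 < a) {k : ℕ} (z : Fin k → ℝ) (hz : ∀ i, 0 < z i) :
    ∫ y in Ioi (0 : ℝ), pfSum ((buresKernel N a).matrix (Fin.snoc z y : Fin (k + 1) → ℝ)) =
      2 * (k + 1) * (2 * (N - k)) * pfSum ((buresKernel N a).matrix z) := by
  have h := ((buresKernel_isReproducing (N := N) ha).integral_pfSum z hz).2
  rw [Fintype.card_fin] at h
  refine Eq.trans ?_ h
  congr 1
  ext y
  rw [← (buresKernel N a).pfSum_matrix_comp finSuccEquivLast.symm]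
  congr 2
  ext o
  cases o <;> simp

/-- Induction on the number of variables integrated: the first of them is appended to `z`, the
others are integrated by induction, and the last integration multiplies the Pfaffian by `4 (k + 1)
(m + 1)`. -/
theorem integral_buresWeight_append (ha : -1 < a) {κ : ℝ} (hκ : ∀ n, n = N → ∀ z : Fin n → ℝ,
    (∀ i, 0 < z i) → pfSum ((buresKernel N a).matrix z) = κ * buresWeight a z) (m : ℕ) :
    ∀ k, k + m = N → ∀ z : Fin k → ℝ, (∀ i, 0 < z i) →
      κ * ∫ u, buresWeight a (Fin.append z u)
        ∂(Measure.pi fun _ : Fin m => (volume : Measure ℝ).restrict (Ioi 0)) =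
      4 ^ m * m ! * N ! / k ! * pfSum ((buresKernel N a).matrix z) := by
  induction m with
  | zero =>
    intro k hk z hz
    have hk' : k = N := by omega
    rw [Measure.pi_of_empty _ (fun i : Fin 0 => i.elim0), integral_dirac]
    have : Fin.append z (fun i : Fin 0 => i.elim0) = z ∘ Fin.cast (Nat.add_zero k) := by
      rw [← Fin.append_elim0]
    rw [this, buresWeight_comp_cast, ← hκ k hk' z hz, ← hk']
    have : (k ! : ℝ) ≠ 0 := by positivity
    field_simp
    simp
  | succ m ih =>
    intro k hk z hz
    rw [integral_pi_succ (integrable_buresWeight_append ha z hz), ← integral_const_mul]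
    have hin : ∀ y ∈ Ioi (0 : ℝ), κ * ∫ u, buresWeight a (Fin.append z (Fin.cons y u))
        ∂(Measure.pi fun _ : Fin m => (volume : Measure ℝ).restrict (Ioi 0)) =
        4 ^ m * m ! * N ! / (k + 1)! *
          pfSum ((buresKernel N a).matrix (Fin.snoc z y : Fin (k + 1) → ℝ)) := by
      intro y hy
      rw [← ih (k + 1) (by omega) (Fin.snoc z y) fun i => by
        refine Fin.lastCases ?_ (fun i => ?_) i
        · simpa using hy
        · simpa using hz i]
      congr 1
      refine integral_congr_ae (Filter.Eventually.of_forall fun u => ?_)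
      simp only
      rw [Fin.append_right_cons, buresWeight_comp_cast]
    rw [setIntegral_congr_fun measurableSet_Ioi hin, integral_const_mul, integral_pfSum_snoc ha z hz]
    have hN : (N : ℝ) - k = m + 1 := by
      rw [← hk]
      push_cast
      ring
    rw [hN, Nat.factorial_succ, Nat.factorial_succ]
    have : (k ! : ℝ) ≠ 0 := by positivity
    push_cast
    field_simp
    ring

theorem pfSum_of_isEmpty (z : Fin 0 → ℝ) : pfSum ((buresKernel N a).matrix z) = 1 := by
  unfold pfSum pfTerm
  simp

/-- With no point kept, the Pfaffian is `1` and the right-hand side is positive. This forces `κ ≠ 0`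
and evaluates the total mass in terms of `κ`. -/
theorem exists_buresWeight_eq (N : ℕ) (ha : -1 < a) : ∃ κ : ℝ, κ ≠ 0 ∧
    (∀ n, n = N → ∀ z : Fin n → ℝ, (∀ i, 0 < z i) →
      pfSum ((buresKernel N a).matrix z) = κ * buresWeight a z) ∧
    (∫ z in posOrthant N, buresWeight a z = 4 ^ N * N ! * N ! / κ) ∧
    ∀ m k, k + m = N → ∀ z : Fin k → ℝ, (∀ i, 0 < z i) →
      ∫ u in posOrthant m, buresWeight a (Fin.append z u) =
      4 ^ m * m ! * N ! / k ! * pfSum ((buresKernel N a).matrix z) / κ := by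
  obtain ⟨κ, hκ⟩ := exists_pfSum_eq_buresWeight N a
  have h := integral_buresWeight_append ha hκ
  have h0 := h N 0 (by simp) (fun i => i.elim0) (fun i => i.elim0)
  have he : ∫ u, buresWeight a (Fin.append (fun i : Fin 0 => i.elim0) u)
        ∂(Measure.pi fun _ : Fin N => (volume : Measure ℝ).restrict (Ioi 0)) =
      ∫ z in posOrthant N, buresWeight a z := by
    rw [restrict_posOrthant]
    refine integral_congr_ae (Filter.Eventually.of_forall fun u => ?_)
    simp only
    rw [← buresWeight_comp_cast a (Nat.zero_add N) u, ← Fin.elim0_append]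
  rw [he, pfSum_of_isEmpty, Nat.factorial_zero, Nat.cast_one, div_one, mul_one] at h0
  have hne : κ ≠ 0 := by
    rintro rfl
    rw [zero_mul] at h0
    have : (0 : ℝ) < 4 ^ N * N ! * N ! := by positivity
    linarith
  refine ⟨κ, hne, hκ, ?_, fun m k hk z hz => ?_⟩
  · rw [← h0]
    field_simp
  · rw [← h m k hk z hz, restrict_posOrthant]
    field_simp

theorem integrableOn_buresWeight (ha : -1 < a) (N : ℕ) :
    IntegrableOn (fun z : Fin N → ℝ => buresWeight a z) (posOrthant N) := by
  unfold IntegrableOn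
  rw [restrict_posOrthant]
  refine (integrable_buresWeight_append (m := N) ha (fun i : Fin 0 => i.elim0)
    (fun i => i.elim0)).congr (Filter.Eventually.of_forall fun u => ?_)
  simp only
  rw [← buresWeight_comp_cast a (Nat.zero_add N) u, ← Fin.elim0_append]

theorem buresZ_pos (ha : -1 < a) (N : ℕ) : 0 < buresZ N a := by
  obtain ⟨κ, hκ, -, h, -⟩ := exists_buresWeight_eq N ha
  have h0 : 0 ≤ ∫ z in posOrthant N, buresWeight a z :=
    setIntegral_nonneg (measurableSet_posOrthant N) fun z hz => buresWeight_nonneg a hz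
  have h1 : ∫ z in posOrthant N, buresWeight a z ≠ 0 := by
    rw [h]
    positivity
  have := lt_of_le_of_ne h0 h1.symm
  unfold buresZ
  positivity

/-- The unknown constant `κ` cancels between the marginal integral and the normalisation. -/
theorem buresR_eq_pfSum (ha : -1 < a) {k : ℕ} (hk : k ≤ N) (z : Fin k → ℝ) (hz : ∀ i, 0 < z i) :
    buresR N a k z =
      (N - k)! / (4 ^ k * k ! * N !) * pfSum ((buresKernel N a).matrix z) := by
  obtain ⟨κ, hκ, -, h, h'⟩ := exists_buresWeight_eq N ha
  unfold buresR buresZ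
  rw [h, h' (N - k) k (by omega) z hz]
  have h4 : (4 : ℝ) ^ N = 4 ^ k * 4 ^ (N - k) := by
    rw [← pow_add]
    congr 1
    omega
  have h5 : (N ! : ℝ) ≠ 0 := by positivity
  have h6 : (k ! : ℝ) ≠ 0 := by positivity
  rw [h4]
  field_simp

theorem pfSum_map_ofReal {ι : Type*} [Fintype ι] [DecidableEq ι] (A : Matrix (ι ⊕ ι) (ι ⊕ ι) ℝ) :
    pfSum (A.map fun x : ℝ => (x : ℂ)) = ((pfSum A : ℝ) : ℂ) := by
  unfold pfSum pfTerm
  push_cast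
  rfl

theorem pfaffian_buresMatrix (ha : -1 < a) {k : ℕ} (z : Fin k → ℝ) (hz : ∀ i, 0 < z i) :
    pfaffian (buresMatrix N a z) = (-1) ^ (k * (k - 1) / 2) * (1 / (2 ^ k * (k ! : ℂ)) *
      ((pfSum ((buresKernel N a).matrix z) : ℝ) : ℂ)) := by
  unfold buresMatrix
  rw [pfaffian_blockMatrix, ← pfSum_map_ofReal]
  congr 3
  ext p q
  rcases p with i | i <;> rcases q with j | j
  · simp [deltaK11_eq_entry ha (hz i) (hz j), SkewKernel.matrix]
  · simp [sigmaK01_eq_entry ha (hz i) (hz j), SkewKernel.matrix]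
  · simp only [Matrix.fromBlocks_apply₂₁, Matrix.of_apply, Matrix.map_apply, SkewKernel.matrix,
      sigmaK01_eq_entry ha (hz j) (hz i)]
    rw [(buresKernel N a).entry_skew]
    simp
  · simp [deltaK00_eq_entry ha (hz i) (hz j), SkewKernel.matrix]

theorem buresR_eq_pfaffian (ha : -1 < a) {k : ℕ} (hk : k ≤ N) (z : Fin k → ℝ) (hz : ∀ i, 0 < z i) :
    (buresR N a k z : ℂ) =
      (-1 : ℂ) ^ (k * (k - 1) / 2) * (((N - k)! : ℂ) / (2 ^ k * (N ! : ℂ))) *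
        pfaffian (buresMatrix N a z) := by
  rw [pfaffian_buresMatrix ha z hz, buresR_eq_pfSum ha hk z hz]
  have h1 : ((-1 : ℂ) ^ (k * (k - 1) / 2)) * (-1) ^ (k * (k - 1) / 2) = 1 := by
    rw [← mul_pow]
    simp
  have h2 : (4 : ℂ) ^ k = 2 ^ k * 2 ^ k := by
    rw [← mul_pow]
    norm_num
  push_cast
  rw [h2]
  linear_combination (-((N - k)! : ℂ) / (2 ^ k * (N ! : ℂ)) * (1 / (2 ^ k * (k ! : ℂ)) *
      ((pfSum ((buresKernel N a).matrix z) : ℝ) : ℂ))) * h1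

end CorrelationFunctions

/-! ### The Pfaffian point process -/

section PointProcess

variable {N : ℕ} {a : ℝ}

theorem pfSum_const_mul {R ι : Type*} [CommRing R] [Fintype ι] [DecidableEq ι] (r : R)
    (A : Matrix (ι ⊕ ι) (ι ⊕ ι) R) :
    pfSum (A.map fun x => r * x) = r ^ Fintype.card ι * pfSum A := by
  unfold pfSum pfTerm
  rw [Finset.mul_sum]
  refine Finset.sum_congr rfl fun σ _ => ?_
  simp only [Matrix.map_apply, Finset.prod_mul_distrib, Finset.prod_const, Finset.card_univ]
  ring

/-- The position of a point in one of the two copies of `ℝ`. -/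
def copyOf (i : Fin 2) (x : ℝ) : ℝ ⊕ ℝ := if i = 0 then Sum.inl x else Sum.inr x

theorem measurable_buresKernel_U (j : ℕ) : Measurable ((buresKernel N a).U j) := by
  have := measurable_expInt (a + 1 + j)
  simp only [buresKernel]
  fun_prop

theorem measurable_buresKernel_ω : Measurable (buresKernel N a).ω := by
  simp only [buresKernel]
  fun_prop

theorem measurable_buresKernel_q (l : ℕ) : Measurable ((buresKernel N a).q l) := by
  have h1 := measurable_buresKernel_ω (N := N) (a := a)
  have h2 := fun j => measurable_buresKernel_U (N := N) (a := a) j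
  unfold SkewKernel.q
  refine h1.mul (Measurable.add_const (Finset.measurable_fun_sum _ fun j _ => ?_) _)
  exact (h2 j).const_mul _

theorem measurable_buresKernel_entry (i j : Fin 2) :
    Measurable fun p : ℝ × ℝ => (buresKernel N a).entry (copyOf i p.1) (copyOf j p.2) := by
  have hω := measurable_buresKernel_ω (N := N) (a := a)
  have hU := fun j => measurable_buresKernel_U (N := N) (a := a) j
  have hq := fun l => measurable_buresKernel_q (N := N) (a := a) l
  fin_cases i <;> fin_cases j <;>
    simp only [copyOf, Fin.zero_eta, Fin.mk_one, if_true, one_ne_zero, if_false, SkewKernel.entry]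
  · refine Measurable.mul ((hω.comp measurable_fst).mul (hω.comp measurable_snd))
      (Measurable.sub (Measurable.add (Finset.measurable_fun_sum _ fun j _ => ?_)
        (Finset.measurable_fun_sum _ fun i _ => Finset.measurable_fun_sum _ fun j _ => ?_)) ?_)
    · exact (((hU j).comp measurable_fst).sub ((hU j).comp measurable_snd)).const_mul _
    · exact (((hU i).comp measurable_fst).mul_const _).mul ((hU j).comp measurable_snd)
    · fun_prop
  · refine Finset.measurable_fun_sum _ fun l _ => ?_
    exact (measurable_snd.pow_const l).mul ((hq l).comp measurable_fst)
  · refine Measurable.neg (Finset.measurable_fun_sum _ fun l _ => ?_)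
    exact (measurable_fst.pow_const l).mul ((hq l).comp measurable_snd)
  · refine Finset.measurable_fun_sum _ fun l _ => Finset.measurable_fun_sum _ fun j _ => ?_
    fun_prop

theorem measurable_pfSum_matrix (N : ℕ) (a : ℝ) (k : ℕ) :
    Measurable fun w : Fin k → ℝ => pfSum ((buresKernel N a).matrix w) := by
  have h : ∀ p p' : Fin k ⊕ Fin k, Measurable fun w : Fin k → ℝ =>
      (buresKernel N a).matrix w p p' := by
    intro p p'
    have key : ∀ (i j : Fin 2) (l l' : Fin k), Measurable fun w : Fin k → ℝ =>
        (buresKernel N a).entry (copyOf i (w l)) (copyOf j (w l')) := fun i j l l' =>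
      (measurable_buresKernel_entry i j).comp
        (Measurable.prodMk (measurable_pi_apply l) (measurable_pi_apply l'))
    rcases p with l | l <;> rcases p' with l' | l'
    · exact key 0 0 l l'
    · exact key 0 1 l l'
    · exact key 1 0 l l'
    · exact key 1 1 l l'
  unfold pfSum pfTerm
  refine Finset.measurable_fun_sum _ fun σ _ => Measurable.const_mul ?_ _
  exact Finset.measurable_fun_prod _ fun i _ => h _ _

/-- The matrix kernel of the Bures ensemble as a Pfaffian point process. -/
def buresPointKernel (N : ℕ) (a : ℝ) (x y : ℝ) : Matrix (Fin 2) (Fin 2) ℂ :=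
  -- The factor `1 / 2` supplies the power `2^(-k)` which is missing from the `1 / (4^k k!)` of the
  -- correlation functions once the Pfaffian has taken `1 / (2^k k!)`.
  Matrix.of fun i j => ((1 / 2 * (buresKernel N a).entry (copyOf i x) (copyOf j y) : ℝ) : ℂ)

theorem pfaffian_buresPointKernel {k : ℕ} (w : Fin k → ℝ) :
    pfaffian (kernelMatrix (buresPointKernel N a) w) =
      ((1 / (4 ^ k * k !) * pfSum ((buresKernel N a).matrix w) : ℝ) : ℂ) := by
  have h : pfSum ((((buresKernel N a).matrix w).map fun x => 1 / 2 * x).map fun x : ℝ => (x : ℂ)) =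
      pfSum (Matrix.fromBlocks (Matrix.of fun i j => buresPointKernel N a (w i) (w j) 0 0)
        (Matrix.of fun i j => buresPointKernel N a (w i) (w j) 0 1)
        (Matrix.of fun i j => buresPointKernel N a (w i) (w j) 1 0)
        (Matrix.of fun i j => buresPointKernel N a (w i) (w j) 1 1)) := by
    congr 1
    ext p p'
    rcases p with i | i <;> rcases p' with j | j <;> rfl
  rw [pfaffian_kernelMatrix, ← h, pfSum_map_ofReal, pfSum_const_mul, Fintype.card_fin]
  have h4 : (4 : ℂ) ^ k = 2 ^ k * 2 ^ k := by
    rw [← mul_pow]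
    norm_num
  push_cast
  rw [h4, one_div_pow]
  field_simp

/-- The symmetry of the weight is inherited from the Pfaffian, which does not change when both
copies of the index set are relabelled alike. -/
theorem buresWeight_comp_equiv (ha : -1 < a) {n : ℕ} (e : Fin n ≃ Fin N) {z : Fin N → ℝ}
    (hz : ∀ i, 0 < z i) : buresWeight a (z ∘ e) = buresWeight a z := by
  obtain ⟨κ, hne, hκ, -⟩ := exists_buresWeight_eq N ha
  have hn : n = N := by simpa using Fintype.card_congr e
  have h1 := hκ n hn (z ∘ e) fun i => hz _
  rw [SkewKernel.pfSum_matrix_comp, hκ N rfl z hz] at h1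
  exact (mul_left_cancel₀ hne h1).symm

theorem lintegral_pi_sum {ι ι' κ : Type*} [Fintype ι] [Fintype ι'] [Fintype κ] {μ : Measure ℝ}
    [SigmaFinite μ] (e : ι ⊕ ι' ≃ κ) {g : (κ → ℝ) → ℝ≥0∞} (hg : Measurable g) :
    ∫⁻ z, g z ∂(Measure.pi fun _ => μ) =
      ∫⁻ w, ∫⁻ u, g (Sum.elim w u ∘ e.symm) ∂(Measure.pi fun _ : ι' => μ)
        ∂(Measure.pi fun _ : ι => μ) := by
  have h1 := measurePreserving_piCongrLeft (fun _ : κ => μ) e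
  have h2 := measurePreserving_sumPiEquivProdPi_symm (fun _ : ι ⊕ ι' => μ)
  have h3 := h1.comp h2
  rw [← h3.lintegral_comp hg, lintegral_prod (fun p => g _) (hg.comp h3.measurable).aemeasurable]
  refine lintegral_congr fun w => lintegral_congr fun u => ?_
  simp only [Function.comp_apply]
  congr 1
  ext j
  obtain ⟨i, rfl⟩ := e.surjective j
  rw [MeasurableEquiv.coe_piCongrLeft, Equiv.piCongrLeft_apply_apply]
  rcases i with i | i <;> simp [MeasurableEquiv.sumPiEquivProdPi, Equiv.sumPiEquivProdPi]

theorem exists_sum_equiv_extending {k N : ℕ} (σ : Fin k ↪ Fin N) :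
    ∃ e : Fin k ⊕ Fin (N - k) ≃ Fin N, ∀ i, e (Sum.inl i) = σ i := by
  classical
  have hc : Fintype.card ((Set.range σ)ᶜ : Set (Fin N)) = N - k := by
    rw [Fintype.card_compl_set, Fintype.card_fin, Set.card_range_of_injective σ.injective,
      Fintype.card_fin]
  refine ⟨(Equiv.sumCongr (Equiv.ofInjective σ σ.injective)
    (Fintype.equivFinOfCardEq hc).symm).trans (Equiv.Set.sumCompl (Set.range σ)), fun i => ?_⟩
  simp

theorem lintegral_buresLaw {F : (Fin N → ℝ) → ℝ≥0∞} (hF : Measurable F) :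
    ∫⁻ z, F z ∂(buresLaw N a) =
      ∫⁻ z, F z * ENNReal.ofReal (1 / buresZ N a * (1 / (N ! : ℝ)) * buresWeight a z)
        ∂(Measure.pi fun _ : Fin N => (volume : Measure ℝ).restrict (Ioi 0)) := by
  unfold buresLaw
  rw [restrict_posOrthant, lintegral_withDensity_eq_lintegral_mul _
    (((measurable_buresWeight a N).const_mul _).ennreal_ofReal) hF]
  exact lintegral_congr fun z => mul_comm _ _

theorem buresR_nonneg (ha : -1 < a) {k : ℕ} {z : Fin k → ℝ} (hz : ∀ i, 0 < z i) :
    0 ≤ buresR N a k z := by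
  have hZ := buresZ_pos ha N
  unfold buresR
  refine mul_nonneg (by positivity) ?_
  exact setIntegral_nonneg (measurableSet_posOrthant _) fun u hu =>
    buresWeight_nonneg a (append_pos hz hu)

/-- The embedding is extended to a bijection from `k + (N - k)` labels. By the symmetry of the
weight, integrating out the complementary variables gives the same marginal for every embedding. -/
theorem lintegral_comp_embedding_buresLaw (ha : -1 < a) {k : ℕ} (σ : Fin k ↪ Fin N)
    {f : (Fin k → ℝ) → ℝ≥0∞} (hf : Measurable f) :
    ∫⁻ z, f (fun i => z (σ i)) ∂(buresLaw N a) =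
      ∫⁻ w, f w * ENNReal.ofReal (buresR N a k w)
        ∂(Measure.pi fun _ : Fin k => (volume : Measure ℝ).restrict (Ioi 0)) := by
  obtain ⟨e, he⟩ := exists_sum_equiv_extending σ
  have hF : Measurable fun z : Fin N → ℝ => f fun i => z (σ i) := hf.comp (by fun_prop)
  have hd : Measurable fun z : Fin N → ℝ =>
      ENNReal.ofReal (1 / buresZ N a * (1 / (N ! : ℝ)) * buresWeight a z) :=
    ((measurable_buresWeight a N).const_mul _).ennreal_ofReal
  have hZ := buresZ_pos ha N
  rw [lintegral_buresLaw hF, lintegral_pi_sum e (g := fun z => (f fun i => z (σ i)) *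
    ENNReal.ofReal (1 / buresZ N a * (1 / (N ! : ℝ)) * buresWeight a z)) (hF.mul hd)]
  refine lintegral_congr_ae ?_
  filter_upwards [ae_pi_pos k] with w hw
  have hfw : ∀ u : Fin (N - k) → ℝ, (fun i => (Sum.elim w u ∘ e.symm) (σ i)) = w := by
    intro u
    ext i
    simp [← he]
  have hwt : ∀ᵐ u ∂(Measure.pi fun _ : Fin (N - k) => (volume : Measure ℝ).restrict (Ioi 0)),
      buresWeight a (Sum.elim w u ∘ e.symm) = buresWeight a (Fin.append w u) := by
    filter_upwards [ae_pi_pos (N - k)] with u hu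
    rw [← buresWeight_comp_equiv ha (finSumFinEquiv.symm.trans e) (z := Sum.elim w u ∘ e.symm)]
    · congr 1
      ext i
      refine Fin.addCases (fun i => ?_) (fun i => ?_) i <;> simp
    · intro i
      simp only [Function.comp_apply]
      rcases e.symm i with j | j
      · exact hw j
      · exact hu j
  simp only [hfw]
  have hm : Measurable fun u : Fin (N - k) → ℝ => Sum.elim w u ∘ e.symm := by
    refine measurable_pi_iff.2 fun i => ?_
    simp only [Function.comp_apply]
    rcases e.symm i with j | j
    · exact measurable_const
    · exact measurable_pi_apply j
  have hdm : Measurable fun u : Fin (N - k) → ℝ => ENNReal.ofReal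
      (1 / buresZ N a * (1 / (N ! : ℝ)) * buresWeight a (Sum.elim w u ∘ e.symm)) := hd.comp hm
  rw [lintegral_const_mul _ hdm]
  congr 1
  unfold buresR
  rw [← integral_const_mul, restrict_posOrthant, ofReal_integral_eq_lintegral_ofReal
    ((integrable_buresWeight_append ha w hw).const_mul _)]
  · refine lintegral_congr_ae ?_
    filter_upwards [hwt] with u hu
    rw [hu]
  · filter_upwards [ae_pi_pos (N - k)] with u hu
    exact mul_nonneg (by positivity) (buresWeight_nonneg a (append_pos hw hu))

/-- All `N! / (N - k)!` embeddings contribute the same marginal `R_k`. The maximum with `0` only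
secures nonnegativity away from the orthant. For `k > N` there are no embeddings, and the Pfaffian
vanishes as well. -/
theorem isCorrelationFunction_buresLaw (ha : -1 < a) (k : ℕ) :
    IsCorrelationFunction (volume.restrict (Ioi (0 : ℝ))) (buresLaw N a) k fun w =>
      max 0 (1 / (4 ^ k * k !) * pfSum ((buresKernel N a).matrix w)) := by
  refine ⟨measurable_const.max ((measurable_pfSum_matrix N a k).const_mul _),
    fun w => le_max_left _ _, fun f hf => ?_⟩
  have hfσ : ∀ σ : Fin k ↪ Fin N, Measurable fun z : Fin N → ℝ => f fun i => z (σ i) := fun σ =>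
    hf.comp (by fun_prop)
  rw [lintegral_finsetSum _ fun σ _ => hfσ σ]
  rcases le_or_gt k N with hk | hk
  · simp only [lintegral_comp_embedding_buresLaw ha _ hf]
    rw [Finset.sum_const, Finset.card_univ, Fintype.card_embedding_eq, Fintype.card_fin,
      Fintype.card_fin, nsmul_eq_mul, ← lintegral_const_mul' _ _ (ENNReal.natCast_ne_top _)]
    refine lintegral_congr_ae ?_
    filter_upwards [ae_pi_pos k] with w hw
    have h0 := buresR_nonneg (N := N) ha hw
    have h1 : (N.descFactorial k : ℝ) * buresR N a k w =
        1 / (4 ^ k * k !) * pfSum ((buresKernel N a).matrix w) := by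
      rw [buresR_eq_pfSum ha hk w hw, ← Nat.factorial_mul_descFactorial hk]
      have h2 : ((N - k)! : ℝ) ≠ 0 := by positivity
      have h3 : (N.descFactorial k : ℝ) ≠ 0 := by
        exact_mod_cast (Nat.descFactorial_pos.2 hk).ne'
      push_cast
      field_simp
    rw [← h1, max_eq_right (by positivity), ENNReal.ofReal_mul (by positivity), ENNReal.ofReal_natCast]
    ring
  · have : IsEmpty (Fin k ↪ Fin N) := by
      refine Function.Embedding.isEmpty_of_card_lt ?_
      simpa using hk
    rw [Finset.univ_eq_empty, Finset.sum_empty]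
    simp [(buresKernel N a).pfSum_matrix_eq_zero (n := k) hk]

theorem isProbabilityMeasure_buresLaw (ha : -1 < a) : IsProbabilityMeasure (buresLaw N a) := by
  have hZ := buresZ_pos ha N
  constructor
  rw [← lintegral_one, lintegral_buresLaw measurable_const, ← restrict_posOrthant]
  simp only [one_mul]
  rw [← ofReal_integral_eq_lintegral_ofReal ((integrableOn_buresWeight ha N).const_mul _),
    integral_const_mul]
  · have : buresZ N a = 1 / (N ! : ℝ) * ∫ z in posOrthant N, buresWeight a z := rfl
    rw [mul_assoc, ← this, one_div, inv_mul_cancel₀ hZ.ne', ENNReal.ofReal_one]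
  · filter_upwards [ae_restrict_mem (measurableSet_posOrthant N)] with z hz
    exact mul_nonneg (by positivity) (buresWeight_nonneg a hz)

theorem isPfaffianPointProcess_buresLaw (ha : -1 < a) :
    IsPfaffianPointProcess (volume.restrict (Ioi (0 : ℝ))) (buresLaw N a) := by
  refine ⟨buresPointKernel N a, fun i j => ?_, fun x y => ?_, fun k =>
    ⟨_, isCorrelationFunction_buresLaw ha k, ?_⟩⟩
  · exact Complex.measurable_ofReal.comp ((measurable_buresKernel_entry i j).const_mul _)
  · ext i j
    simp only [buresPointKernel, Matrix.of_apply, Matrix.neg_apply, Matrix.transpose_apply]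
    rw [(buresKernel N a).entry_skew]
    push_cast
    ring
  · filter_upwards [ae_pi_pos k] with w hw
    rw [pfaffian_buresPointKernel]
    congr 1
    refine max_eq_right ?_
    rcases le_or_gt k N with hk | hk
    · have h0 := buresR_nonneg (N := N) ha hw
      rw [buresR_eq_pfSum ha hk w hw] at h0
      have h1 : (0 : ℝ) < (N - k)! / (4 ^ k * k ! * N !) := by positivity
      have := nonneg_of_mul_nonneg_right h0 h1
      positivity
    · rw [(buresKernel N a).pfSum_matrix_eq_zero (n := k) hk, mul_zero]

end PointProcess

theorem mainTheorem4 (N : ℕ) (hN : 1 ≤ N) (a : ℝ) (ha : -1 < a) :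
    (IntegrableOn (fun z : Fin N → ℝ => buresWeight a z) (posOrthant N) ∧ 0 < buresZ N a) ∧
    (∀ k : ℕ, 1 ≤ k → k ≤ N → ∀ z : Fin k → ℝ, (∀ i, 0 < z i) → Function.Injective z →
      IntegrableOn (fun w : Fin (N - k) → ℝ => buresWeight a (Fin.append z w))
        (posOrthant (N - k)) ∧
      (buresR N a k z : ℂ) =
        (-1 : ℂ) ^ (k * (k - 1) / 2) * (((N - k) ! : ℂ) / (2 ^ k * (N ! : ℂ))) *
          pfaffian (buresMatrix N a z)) ∧
    (IsProbabilityMeasure (buresLaw N a) ∧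
      IsPfaffianPointProcess (volume.restrict (Ioi (0 : ℝ))) (buresLaw N a)) := by
  refine ⟨⟨integrableOn_buresWeight ha N, buresZ_pos ha N⟩, fun k _ hk z hz _ => ⟨?_, ?_⟩,
    isProbabilityMeasure_buresLaw ha, isPfaffianPointProcess_buresLaw ha⟩
  · unfold IntegrableOn
    rw [restrict_posOrthant]
    exact integrable_buresWeight_append ha z hz
  · exact buresR_eq_pfaffian ha hk z hz

end
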